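/- **Machines.** A *multiway storage modification machine* (MWSMM) over a finite input alphabet $\Sigma$ has a finite set $D$ of directions and a program, which is a finite numbered list of instructions. Its memory is a finite directed graph whose nodes are numbered $0,1,2,\dots$ in order of creation; every node has exactly one outgoing edge for each $d\in D$. At the start there is one node, all of whose edges point to itself, and one execution, the *prologue*, at line $0$ with this node as its center. For a path $x\in D^*$, $p(x)$ is the node reached from the center along $x$. The instructions are: **new** (create a node whose edges all point to the center, and make it the center); **set** $xd$ **to** $y$ (redirect the $d$ edge of $p(x)$ to $p(y)$); **center** $x$ (move the center to $p(x)$); **if** $x\;y$ **then** $\ell$ (jump to line $\ell$ if $p(x)=p(y)$); **input** (read the next input symbol and jump to a line that depends on it, or go to the next line if the input is exhausted); **stop** (end this execution); and **match** $b$, where $b$ is a Boolean combination of equations between paths. A **match** ends the executions that reach it and selects nodes of the graph that make $b$ true when taken as the center: all of them if it is *parallel*, one of them, chosen non-deterministically, if it is *non-deterministic* (none if no node makes $b$ true). On each selected node, taken as local center, a new execution of the instructions after the **match** is started. In one step all current executions simultaneously carry out one instruction each, following their paths in the graph before the step. Executions are ordered: those that go on keep their order and precede newly started ones, which are ordered by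 the line of the **match** (at the start of a round: by its place in the chosen alternative) and then by the number of the node. New nodes are numbered in this order; if several executions redirect the same edge, the last one prevails. Executions that read in the same step read the same symbol, and a **match** reached by several executions in the same step selects nodes only once. An execution that reaches a non-existing line ends. When all executions have ended, a *round* starts, which takes one step: from a given finite list of alternatives, each a finite list of lines holding a **match** (the top-level match-blocks), the machine non-deterministically chooses one for which at least one node is selected, and starts the executions that follow all its **match** instructions in parallel. If there is no such alternative, the machine stops; it accepts if a fixed Boolean combination of equations between paths is true at the center of the machine, i.e. at the last center of the prologue. The machine recognizes the language $L(M)$ of all words on which some computation stops and accepts. It does so in polynomial time if there is a polynomial $p$ such that every $w\in L(M)$ has an accepting computation of at most $p(|w|)$ steps. The Turing machines are deterministic off-line multi-tape machines, with a two-way read-only input tape and finitely many work tapes; the space is the number of cells visited on a work tape, maximized over the work tapes. **Lemma** ($\mathrm{NPTIME}(\mathrm{MWSMM})\subseteq\mathrm{PSPACE}$). Let $\Sigma$ be a finite alphabet. 1. Every language over $\Sigma$ that is recognized in polynomial time by a non-deterministic MWSMM is decided in polynomial space by an off-line multi-tape Turing machine (which halts on all inputs). 2. More precisely, $t$ steps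 are simulated in space $O(t^2)$: for every non-deterministic MWSMM $M$ there are an off-line multi-tape Turing machine $N$ and a constant $C$ such that $N$ accepts exactly the words of $L(M)$, and for every word $w$ and every $t\in\mathbb N$, if $M$ has an accepting computation of at most $t$ steps on $w$, or if all computations of $M$ on $w$ stop after at most $t$ steps, then $N$ halts on $w$ and uses at most $C(t^2+1)$ cells of each work tape. -/

import Mathlib

namespace MWSMM

/-- The memory of a storage modification machine with `k` directions: the nodes are numbered
`0, …, size - 1`, and `ptr v d` is the node to which the edge of `v` with label `d` points. -/
structure Memory (k : ℕ) where
  size : ℕ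
  ptr : ℕ → Fin k → ℕ

/-- The node reached from `v` by following the directions of the path `x` from left to right. -/
def Memory.walk {k : ℕ} (g : Memory k) (v : ℕ) (x : List (Fin k)) : ℕ :=
  x.foldl g.ptr v

/-- Redirect the `d` edge of the node `u` to the node `v`. -/
def Memory.redirect {k : ℕ} (g : Memory k) (u : ℕ) (d : Fin k) (v : ℕ) : Memory k where
  size := g.size
  ptr := Function.update g.ptr u (Function.update (g.ptr u) d v)

/-- Create a node, with the first free number `g.size`, all of whose edges point to `v`. -/
def Memory.create {k : ℕ} (g : Memory k) (v : ℕ) : Memory k where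
  size := g.size + 1
  ptr := Function.update g.ptr g.size fun _ => v

/-- Boolean expressions on paths; the atoms say that two paths lead to the same node. -/
inductive BoolExpr (k : ℕ) where
  | eq (x y : List (Fin k))
  | not (b : BoolExpr k)
  | and (b₁ b₂ : BoolExpr k)
  | or (b₁ b₂ : BoolExpr k)

/-- The value of a boolean expression if `v` were the center. -/
def BoolExpr.eval {k : ℕ} (g : Memory k) (v : ℕ) : BoolExpr k → Bool
  | .eq x y => g.walk v x == g.walk v y
  | .not b => !(b.eval g v)
  | .and b₁ b₂ => b₁.eval g v && b₂.eval g v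
  | .or b₁ b₂ => b₁.eval g v || b₂.eval g v

/-- All nodes of the graph that make `b` true, in increasing order. -/
def Memory.matching {k : ℕ} (g : Memory k) (b : BoolExpr k) : List ℕ :=
  (List.range g.size).filter fun v => b.eval g v

/-- The updating process of a `match` instruction: the parallel one executes the instructions that
follow on all matching nodes, the non-deterministic one on one matching node. -/
inductive Mode where
  | parallel
  | nondet

/-- The instructions, over the input alphabet `α` and `k` directions.
* `new`: create a node whose edges all point to the center, and make it the center;
* `set x d y`: redirect the `d` edge of `p(x)` to `p(y)`;
* `center x`: move the center to `p(x)`;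
* `ifEq x y ln`: jump to line `ln` if `p(x) = p(y)`;
* `halt`: the instruction `stop`; end this execution;
* `select m b`: the instruction `match b`, with the updating process `m`;
* `input ln`: read the next input symbol `a` and jump to line `ln a`; go to the next line if the
  input is exhausted. -/
inductive Instr (α : Type) (k : ℕ) where
  | new
  | set (x : List (Fin k)) (d : Fin k) (y : List (Fin k))
  | center (x : List (Fin k))
  | ifEq (x y : List (Fin k)) (ln : ℕ)
  | halt
  | select (m : Mode) (b : BoolExpr k)
  | input (ln : α → ℕ)

/-- A non-deterministic multiway storage modification machine. The program is a numbered list of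
instructions; the prologue starts at line `0`, and a match-block is named by the number of the line
that holds its `match` instruction. The list `topLevel` holds the alternatives for a round: in each
round one alternative is chosen, and all its match-blocks are executed in parallel. With a single
alternative and only parallel `match` instructions the machine is deterministic. When the machine
stops, the result is read off at the center by means of `accept`. -/
structure Machine (α : Type) where
  dirs : ℕ
  prog : List (Instr α dirs)
  topLevel : List (List ℕ)
  accept : BoolExpr dirs

/-- One of the executions that run in parallel, with its line number and its local center; `main`
marks the execution of the prologue, whose center is the center of the machine. -/
structure Thread where
  pc : ℕ
  center : ℕ
  main : Bool

/-- A configuration: the graph, the center of the machine, the current parallel executions, and the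
number of input symbols that have been read. -/
structure Config (k : ℕ) where
  mem : Memory k
  center : ℕ
  threads : List Thread
  pos : ℕ

namespace Machine

variable {α : Type} (M : Machine α)

/-- At the start the graph has one node, whose edges all point to itself; it is the center. -/
def init : Config M.dirs where
  mem := ⟨1, fun _ _ => 0⟩
  center := 0
  threads := [⟨0, 0, true⟩]
  pos := 0

/-- `s` is a possible outcome of the `match` instruction at line `ℓ`: the list of the nodes on
which the instructions after line `ℓ` are executed. -/
def Selects (g : Memory M.dirs) (ℓ : ℕ) (s : List ℕ) : Prop :=
  match M.prog[ℓ]? with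
  | some (.select .parallel b) => s = g.matching b
  | some (.select .nondet b) =>
      (g.matching b = [] ∧ s = []) ∨ ∃ v ∈ g.matching b, s = [v]
  | _ => s = []

/-- The executions that start after the `match` instructions at the given lines. -/
def forks (sel : ℕ → List ℕ) (lines : List ℕ) : List Thread :=
  lines.flatMap fun ℓ => (sel ℓ).map fun v => ⟨ℓ + 1, v, false⟩

/-- The contribution of the execution `τ` to a step. All paths are followed in the graph `g` before
the step; the first component of `acc` is the graph with the changes made by the executions that
precede `τ`, and the second one lists the executions that go on. An execution ends at a `halt`, at
a line that does not exist, and at a `match`, where it is replaced by the executions on the selected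
nodes. -/
def execThread (g : Memory M.dirs) (symbol : Option α) (acc : Memory M.dirs × List Thread)
    (τ : Thread) : Memory M.dirs × List Thread :=
  match M.prog[τ.pc]? with
  | some .new =>
      (acc.1.create τ.center, acc.2 ++ [⟨τ.pc + 1, acc.1.size, τ.main⟩])
  | some (.set x d y) =>
      (acc.1.redirect (g.walk τ.center x) d (g.walk τ.center y),
        acc.2 ++ [⟨τ.pc + 1, τ.center, τ.main⟩])
  | some (.center x) => (acc.1, acc.2 ++ [⟨τ.pc + 1, g.walk τ.center x, τ.main⟩])
  | some (.ifEq x y ln) =>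
      (acc.1, acc.2 ++
        [⟨if g.walk τ.center x = g.walk τ.center y then ln else τ.pc + 1, τ.center, τ.main⟩])
  | some (.input ln) =>
      (acc.1, acc.2 ++ [⟨symbol.elim (τ.pc + 1) ln, τ.center, τ.main⟩])
  | some .halt => acc
  | some (.select _ _) => acc
  | none => acc

/-- Does the execution `τ` read an input symbol in the next step? -/
def reads (τ : Thread) : Bool :=
  match M.prog[τ.pc]? with
  | some (.input _) => true
  | _ => false

/-- One step of all current executions, each of which carries out one instruction. If several of
them redirect the same edge, the last one prevails; if several of them read an input symbol, they
read the same one. A `match` instruction reached by several executions at once selects its nodes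
once. -/
def exec (w : List α) (sel : ℕ → List ℕ) (c : Config M.dirs) : Config M.dirs :=
  let r := c.threads.foldl (M.execThread c.mem w[c.pos]?) (c.mem, [])
  { mem := r.1
    center := (r.2.find? fun τ => τ.main).elim c.center fun τ => τ.center
    threads := r.2 ++ forks sel
      ((List.range M.prog.length).filter fun ℓ => c.threads.any fun τ => τ.pc == ℓ)
    pos := if c.threads.any M.reads then c.pos + 1 else c.pos }

/-- The steps of the machine on the input `w`. As long as some execution is running, all of them
carry out one instruction; once all have ended, a new round starts with an alternative of
`topLevel` that selects at least one node. -/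
inductive Step (w : List α) : Config M.dirs → Config M.dirs → Prop
  | exec (c : Config M.dirs) (sel : ℕ → List ℕ) (hc : c.threads ≠ [])
      (hsel : ∀ ℓ, M.Selects c.mem ℓ (sel ℓ)) : Step w c (M.exec w sel c)
  | round (c : Config M.dirs) (sel : ℕ → List ℕ) (blocks : List ℕ) (hc : c.threads = [])
      (hsel : ∀ ℓ, M.Selects c.mem ℓ (sel ℓ)) (hb : blocks ∈ M.topLevel)
      (hne : forks sel blocks ≠ []) : Step w c { c with threads := forks sel blocks }

/-- The machine stops when no step is possible: all executions have ended and no top-level `match`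
selects a node. -/
def Halted (w : List α) (c : Config M.dirs) : Prop :=
  ∀ c', ¬ M.Step w c c'

/-- `M.Reaches w t c`: some computation on the input `w` is in the configuration `c` after exactly
`t` steps. -/
inductive Reaches (w : List α) : ℕ → Config M.dirs → Prop
  | init : Reaches w 0 M.init
  | step {t : ℕ} {c c' : Config M.dirs} (h : Reaches w t c) (hs : M.Step w c c') :
      Reaches w (t + 1) c'

/-- Some computation on the input `w` stops after at most `t` steps and accepts. -/
def AcceptsWithin (w : List α) (t : ℕ) : Prop :=
  ∃ s ≤ t, ∃ c, M.Reaches w s c ∧ M.Halted w c ∧ M.accept.eval c.mem c.center = true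

/-- Every computation on the input `w` stops after at most `t` steps. -/
def HaltsWithin (w : List α) (t : ℕ) : Prop :=
  ∀ s c, M.Reaches w s c → s ≤ t

/-- The language recognized by the machine. -/
def language : Language α :=
  {w | ∃ t, M.AcceptsWithin w t}

end Machine

/-- The languages that are recognized in polynomial time by a non-deterministic machine: every word
of the language has an accepting computation of polynomial length, and no other word has an
accepting computation. -/
def NPTIME (α : Type) : Set (Language α) :=
  {L | ∃ (M : Machine α) (p : Polynomial ℕ),
    M.language = L ∧ ∀ w ∈ L, M.AcceptsWithin w (p.eval w.length)}

end MWSMM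

namespace OfflineTM

/-- The symbols on the input tape: the input word is enclosed between two end markers. -/
inductive InputSymbol (α : Type) where
  | leftEnd
  | letter (a : α)
  | rightEnd

/-- Head moves. -/
inductive Move where
  | left
  | stay
  | right

/-- The effect of a move on a position; the head does not leave the tape on the left. -/
def Move.apply : Move → ℕ → ℕ
  | .left, i => i - 1
  | .stay, i => i
  | .right, i => i + 1

/-- A deterministic off-line Turing machine with a two-way read-only input tape and `tapes` work
tapes, which are infinite to the right. The value `verdict q` is `none` if `q` is not a halting
state, `some true` if it is an accepting one, and `some false` if it is a rejecting one. A
transition gives the new state, the move on the input tape, and for each work tape the symbol to be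
written and the move. -/
structure Machine (α : Type) where
  tapes : ℕ
  State : Type
  Symbol : Type
  finState : Finite State
  finSymbol : Finite Symbol
  start : State
  blank : Symbol
  verdict : State → Option Bool
  trans : State → InputSymbol α → (Fin tapes → Symbol) →
    State × Move × (Fin tapes → Symbol × Move)

namespace Machine

variable {α : Type} (N : Machine α)

/-- A configuration: the state, the position of the input head, and the contents and head positions
of the work tapes. -/
structure Config where
  state : N.State
  inputHead : ℕ
  tape : Fin N.tapes → ℕ → N.Symbol
  head : Fin N.tapes → ℕ

/-- At the start the input head is on the left end marker, and the work tapes are blank. -/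
def init : N.Config where
  state := N.start
  inputHead := 0
  tape := fun _ _ => N.blank
  head := fun _ => 0

/-- The symbol at position `i` of the input tape: the left end marker at position `0`, the word at
the positions `1, …, w.length`, and the right end marker after it. -/
def inputAt (w : List α) : ℕ → InputSymbol α
  | 0 => .leftEnd
  | i + 1 => w[i]?.elim .rightEnd .letter

/-- One step; a halted machine stays where it is. The input head does not move beyond the end
markers. -/
def step (w : List α) (c : N.Config) : N.Config :=
  match N.verdict c.state with
  | some _ => c
  | none =>
    let r := N.trans c.state (inputAt w c.inputHead) fun j => c.tape j (c.head j)
    { state := r.1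
      inputHead := min (r.2.1.apply c.inputHead) (w.length + 1)
      tape := fun j => Function.update (c.tape j) (c.head j) (r.2.2 j).1
      head := fun j => (r.2.2 j).2.apply (c.head j) }

/-- The configuration after `i` steps on the input `w`. -/
def run (w : List α) (i : ℕ) : N.Config :=
  (N.step w)^[i] N.init

/-- The machine accepts the input `w`. -/
def Accepts (w : List α) : Prop :=
  ∃ i, N.verdict (N.run w i).state = some true

/-- The machine halts on the input `w`. -/
def Halts (w : List α) : Prop :=
  ∃ i b, N.verdict (N.run w i).state = some b

/-- On the input `w` the machine visits at most the first `s` cells of each work tape. -/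
def UsesSpace (w : List α) (s : ℕ) : Prop :=
  ∀ i j, (N.run w i).head j < s

end Machine

/-- The languages that are decided in polynomial space. -/
def PSPACE (α : Type) : Set (Language α) :=
  {L | ∃ (N : Machine α) (p : Polynomial ℕ),
    ∀ w, N.Halts w ∧ N.UsesSpace w (p.eval w.length) ∧ (N.Accepts w ↔ w ∈ L)}

end OfflineTM

/-! A step can multiply the nodes and executions, so the graph after `t` steps may be exponentially
large and cannot be stored. It can, however, be described locally. The nodes and executions present
after `s` steps get names, which are words of length `s` over a fixed finite alphabet: what survives
a step gets a new first letter `0`, the node created by the execution `x` is called `1x`, and an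
execution started on the node `x` by the `j`-th `match` of the step is called `(j+2)x`. The
lexicographic order of the names is the order of the nodes and of the executions, so that "the last
one prevails" is a first-order statement. Which names denote nodes, where edges lead, and where
executions stand are relations on words of length `s + 1` that are defined by fixed first-order
formulas from the same relations on words of length `s` (`ruleF`, `Models.step`). The
non-determinism of a step amounts to a header and one name for each program line, so a computation
of `T` steps is coded by blocks with `O(T²)` symbols altogether (`exists_reaches`, `exists_blocks`).

A statement about the configuration after `T` steps is evaluated by a game. The existential player
chooses the blocks; then the two players choose witnesses for quantifiers and parts of conjunctions,
and descend one level at each atomic relation. The formulas have bounded size, so each level takes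
`O(T)` choices and a play `O(T²)`. Negation only exchanges the roles, and an atomic relation is
always the last thing to be evaluated, so a play never returns to a higher level and needs only
`O(T²)` symbols of memory (`val_eval`, `val_game`). A deterministic depth-first search finds the
value of the game. It stores just the choices on the current path and replays them from the start
after each play, so it also needs space `O(T²)` (`Val.search`).

The number `T` is not known. The searching machine tries `T = 0, 1, 2, …` and evaluates two games
for each value: does some computation stop and accept after exactly `T` steps, and does any
computation last for `T` steps at all? It accepts if the first answer is yes, and rejects if the
second one is no; since every computation has prefixes of all smaller lengths, no accepting
computation is missed (`search_spec`, `exists_simulation`). For membership in `PSPACE` the machine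
has to halt on every input; there the second game is replaced by a deterministic clock that compares
`T` with a polynomial in the length of the input (`val_clock`, `language_mem_PSPACE`). -/

namespace OfflineTM

/-! ### Stack machines and their simulation by Turing machines. -/

/-- What happens to a stack in one step. -/
inductive StackAct (Γ : Type) where
  | keep
  | pop
  | push (g : Γ)

/-- The effect on the content of the stack, whose top is the head of the list. -/
def StackAct.apply {Γ : Type} : StackAct Γ → List Γ → List Γ
  | .keep, l => l
  | .pop, l => l.tail
  | .push g, l => g :: l

/-- A deterministic machine with a two-way read-only input tape and finitely many stacks. -/
structure StackMachine (α : Type) where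
  arity : ℕ
  State : Type
  Symbol : Type
  finState : Finite State
  finSymbol : Finite Symbol
  start : State
  verdict : State → Option Bool
  trans : State → InputSymbol α → (Fin arity → Option Symbol) →
    State × Move × (Fin arity → StackAct Symbol)

namespace StackMachine

variable {α : Type} (M : StackMachine α)

structure Config where
  state : M.State
  pos : ℕ
  stk : Fin M.arity → List M.Symbol

def init : M.Config where
  state := M.start
  pos := 0
  stk := fun _ => []

def step (w : List α) (c : M.Config) : M.Config :=
  match M.verdict c.state with
  | some _ => c
  | none =>
    let r := M.trans c.state (Machine.inputAt w c.pos) fun j => (c.stk j).head?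
    { state := r.1
      pos := min (r.2.1.apply c.pos) (w.length + 1)
      stk := fun j => (r.2.2 j).apply (c.stk j) }

def run (w : List α) (i : ℕ) : M.Config :=
  (M.step w)^[i] M.init

/-- The first move of the Turing machine that carries out an action on a stack: the symbol to be
written and the move of the head, which stands on the top of the stack. -/
def headMove {Γ : Type} (s : Option Γ) : StackAct Γ → Option Γ × Move
  | .keep => (s, .stay)
  | .pop => (none, .left)
  | .push _ => (s, .right)

/-- The symbol written by the second move. -/
def lateWrite {Γ : Type} (s : Option Γ) : StackAct Γ → Option Γ
  | .push g => some g
  | _ => s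

/-- The Turing machine that keeps each stack on a work tape; the bottom cell stays blank, and each
step is carried out in two steps. -/
def toTM : Machine α where
  tapes := M.arity
  State := M.State ⊕ (M.State × (Fin M.arity → StackAct M.Symbol))
  Symbol := Option M.Symbol
  finState := by
    have := M.finState
    have := M.finSymbol
    have : Finite (StackAct M.Symbol) := by
      refine Finite.of_injective
        (fun a : StackAct M.Symbol => match a with
          | .keep => (Sum.inl true : Bool ⊕ M.Symbol)
          | .pop => Sum.inl false
          | .push g => Sum.inr g) ?_
      rintro (_ | _ | a) (_ | _ | b) h <;> simp_all
    infer_instance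
  finSymbol := by
    have := M.finSymbol
    infer_instance
  start := .inl M.start
  blank := none
  verdict := fun q => match q with
    | .inl q => M.verdict q
    | .inr _ => none
  trans := fun q a s => match q with
    | .inl q =>
      let r := M.trans q a s
      (.inr (r.1, r.2.2), r.2.1, fun j => headMove (s j) (r.2.2 j))
    | .inr (q, acts) => (.inl q, .stay, fun j => (lateWrite (s j) (acts j), .stay))

/-- The content of the cell at height `i` of a tape that holds the stack `l`. -/
def stackCell {Γ : Type} (l : List Γ) (i : ℕ) : Option Γ :=
  if i = 0 then none else l[l.length - i]?

/-- Nothing is required above the top of the stack, since a push overwrites the cell to which it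
moves. -/
def Holds {Γ : Type} (l : List Γ) (tape : ℕ → Option Γ) : Prop :=
  ∀ i ≤ l.length, tape i = stackCell l i

lemma Holds.top {Γ : Type} {l : List Γ} {tape : ℕ → Option Γ} (h : Holds l tape) :
    tape l.length = l.head? := by
  rw [h _ le_rfl]
  cases l <;> simp [stackCell]

/-- A push has to move before it writes, and a pop has to erase before it moves; this is why a step
is split into two. Popping the empty stack is harmless: the bottom cell is blank anyway, and the
head cannot leave the tape on the left. -/
lemma Holds.write {Γ : Type} {l : List Γ} {tape : ℕ → Option Γ} (h : Holds l tape)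
    (a : StackAct Γ) :
    let m := headMove (tape l.length) a
    let tape' := Function.update tape l.length m.1
    m.2.apply l.length = (a.apply l).length ∧
    Holds (a.apply l) (Function.update tape' (a.apply l).length
      (lateWrite (tape' (a.apply l).length) a)) := by
  cases a with
  | keep => simpa [headMove, StackAct.apply, lateWrite, Move.apply] using h
  | pop =>
    cases l with
    | nil =>
      have h0 : tape 0 = none := by simpa [stackCell] using h 0 le_rfl
      simp only [headMove, StackAct.apply, lateWrite, Move.apply]
      simp [Holds, stackCell]
    | cons g l =>
      simp only [headMove, StackAct.apply, lateWrite, Move.apply]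
      refine ⟨by simp, fun i hi => ?_⟩
      simp only [List.tail_cons] at hi ⊢
      have h1 := h i (by simp; omega)
      rw [Function.update_eq_self, Function.update_of_ne (by simp; omega), h1]
      unfold stackCell
      split_ifs with h0
      · rfl
      · rw [show (g :: l).length - i = (l.length - i) + 1 by simp; omega]
        simp
  | push g =>
    simp only [headMove, StackAct.apply, lateWrite, Move.apply, List.length_cons, Function.update_eq_self]
    refine ⟨trivial, fun i hi => ?_⟩
    simp only [List.length_cons] at hi
    rcases Nat.lt_or_ge l.length i with hl | hl
    · obtain rfl : i = l.length + 1 := by omega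
      simp [stackCell]
    · rw [Function.update_of_ne (by omega), h i hl]
      unfold stackCell
      split_ifs with h0
      · rfl
      · rw [show (g :: l).length - i = (l.length - i) + 1 by simp; omega]
        simp

/-- The Turing machine is at the beginning of the simulation of a step. -/
def Represents (c : M.Config) (d : M.toTM.Config) : Prop :=
  d.state = .inl c.state ∧ d.inputHead = c.pos ∧
    ∀ j, d.head j = (c.stk j).length ∧ Holds (c.stk j) (d.tape j)

/-- The heads move only in the first of the two steps. Hence the intermediate head positions are
already the new stack heights, which is what the space bound at odd times needs. -/
lemma Represents.step {w : List α} {c : M.Config} {d : M.toTM.Config} (h : M.Represents c d) :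
    M.Represents (M.step w c) (M.toTM.step w (M.toTM.step w d)) ∧
      ∀ j, (M.toTM.step w d).head j = ((M.step w c).stk j).length := by
  cases hv : M.verdict c.state with
  | some b =>
    have e1 : M.step w c = c := by simp [StackMachine.step, hv]
    have hd : M.toTM.verdict d.state = some b := by rw [h.1]; exact hv
    have e2 : M.toTM.step w d = d := by simp [Machine.step, hd]
    rw [e2, e2, e1]
    exact ⟨h, fun j => (h.2.2 j).1⟩
  | none =>
    obtain ⟨state, inputHead, tape, head⟩ := d
    obtain ⟨h1, h2, h3⟩ := h
    dsimp only at h1 h2 h3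
    subst h1 h2
    obtain rfl : head = fun j => (c.stk j).length := funext fun j => (h3 j).1
    change Fin M.arity → ℕ → Option M.Symbol at tape
    have ht : (fun j : Fin M.arity => tape j ((c.stk j).length)) = fun j => (c.stk j).head? :=
      funext fun j => (h3 j).2.top
    have key := fun j => (h3 j).2.write
      ((M.trans c.state (Machine.inputAt w c.pos) fun j => (c.stk j).head?).2.2 j)
    dsimp only at key
    rw [StackMachine.step]
    simp only [hv]
    simp only [Machine.step, toTM, hv]
    rw [ht]
    refine ⟨⟨rfl, by simp [Move.apply], fun j => ⟨(key j).1, ?_⟩⟩, fun j => (key j).1⟩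
    dsimp only
    rw [(key j).1]
    exact (key j).2

lemma represents_run (w : List α) (i : ℕ) :
    M.Represents (M.run w i) (M.toTM.run w (2 * i)) := by
  induction i with
  | zero =>
    refine ⟨rfl, rfl, fun j => ⟨rfl, fun i hi => ?_⟩⟩
    obtain rfl : i = 0 := by simpa [run, init] using hi
    rfl
  | succ i ih =>
    have := (ih.step (w := w)).1
    rw [run, Function.iterate_succ_apply', Machine.run, show 2 * (i + 1) = 2 * i + 1 + 1 by ring,
      Function.iterate_succ_apply', Function.iterate_succ_apply']
    exact this

/-- A halted machine stays where it is, so its configuration at time `i` is also the one at time `2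
* i`, which represents the stack machine at time `i`. -/
lemma verdict_toTM {w : List α} {i : ℕ} {b : Bool}
    (h : M.toTM.verdict (M.toTM.run w i).state = some b) :
    ∃ i', M.verdict (M.run w i').state = some b := by
  have hstay : M.toTM.step w (M.toTM.run w i) = M.toTM.run w i := by
    simp [Machine.step, h]
  have h2 : M.toTM.run w (2 * i) = M.toTM.run w i := by
    rw [Machine.run, two_mul, Function.iterate_add_apply]
    exact Function.iterate_fixed hstay i
  refine ⟨i, ?_⟩
  rw [← h, ← h2, (M.represents_run w i).1]
  rfl

lemma verdict_run {w : List α} {i : ℕ} {b : Bool} (h : M.verdict (M.run w i).state = some b) :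
    M.toTM.verdict (M.toTM.run w (2 * i)).state = some b := by
  rw [(M.represents_run w i).1, ← h]
  rfl

lemma toTM_accepts (w : List α) :
    M.toTM.Accepts w ↔ ∃ i, M.verdict (M.run w i).state = some true :=
  ⟨fun ⟨_, h⟩ => M.verdict_toTM h, fun ⟨_, h⟩ => ⟨_, M.verdict_run h⟩⟩

lemma toTM_usesSpace {w : List α} {s : ℕ} (h : ∀ i j, ((M.run w i).stk j).length < s) :
    M.toTM.UsesSpace w s := by
  intro i j
  rcases Nat.even_or_odd' i with ⟨k, rfl | rfl⟩
  · rw [((M.represents_run w k).2.2 j).1]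
    exact h k j
  · have := ((M.represents_run w k).step (w := w)).2 j
    rw [Machine.run, Function.iterate_succ_apply']
    refine lt_of_eq_of_lt this ?_
    have h' := h (k + 1) j
    rwa [run, Function.iterate_succ_apply'] at h'

def Config.Bounded {M : StackMachine α} (s : ℕ) (c : M.Config) : Prop :=
  ∀ j, (c.stk j).length ≤ s

/-- `c'` is reached from `c`, and all stacks have at most `s` entries on the way. -/
def Leads (w : List α) (s : ℕ) : M.Config → M.Config → Prop :=
  Relation.ReflTransGen fun x y => x.Bounded s ∧ M.step w x = y

variable {M}

lemma Leads.mono {w : List α} {s s' : ℕ} (hs : s ≤ s') {c c' : M.Config} (h : M.Leads w s c c') :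
    M.Leads w s' c c' :=
  Relation.ReflTransGen.mono (fun _ _ h => ⟨fun j => (h.1 j).trans hs, h.2⟩) _ _ h

lemma Leads.single {w : List α} {s : ℕ} {c c' : M.Config} (hc : c.Bounded s)
    (h : M.step w c = c') : M.Leads w s c c' :=
  Relation.ReflTransGen.single ⟨hc, h⟩

lemma Leads.head {w : List α} {s : ℕ} {c c' c'' : M.Config} (hc : c.Bounded s)
    (h : M.step w c = c') (h' : M.Leads w s c' c'') : M.Leads w s c c'' :=
  Relation.ReflTransGen.head ⟨hc, h⟩ h'

lemma Leads.refl {w : List α} {s : ℕ} {c : M.Config} : M.Leads w s c c :=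
  Relation.ReflTransGen.refl

lemma Leads.trans {w : List α} {s : ℕ} {c c' c'' : M.Config} (h : M.Leads w s c c')
    (h' : M.Leads w s c' c'') : M.Leads w s c c'' :=
  Relation.ReflTransGen.trans h h'

lemma Leads.iterate {w : List α} {s : ℕ} {c c' : M.Config} (h : M.Leads w s c c') :
    ∃ n, (M.step w)^[n] c = c' ∧ ∀ i < n, ((M.step w)^[i] c).Bounded s := by
  induction h with
  | refl => exact ⟨0, rfl, by simp⟩
  | tail _ h ih =>
    obtain ⟨n, h1, h2⟩ := ih
    refine ⟨n + 1, ?_, fun i hi => ?_⟩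
    · rw [Function.iterate_succ_apply', h1, h.2]
    · rcases Nat.lt_succ_iff_lt_or_eq.mp hi with hi | rfl
      · exact h2 i hi
      · rw [h1]; exact h.1

/-- From the halting configuration on the run is constant, so the bounds on the way to it are bounds
for the whole run. The additional cell is the blank one at the bottom. -/
lemma Leads.halts {w : List α} {s : ℕ} {c : M.Config} (h : M.Leads w s M.init c)
    (hc : c.Bounded s) {b : Bool} (hb : M.verdict c.state = some b) :
    M.toTM.Halts w ∧ M.toTM.UsesSpace w (s + 1) ∧ (M.toTM.Accepts w ↔ b = true) := by
  obtain ⟨n, h1, h2⟩ := h.iterate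
  have hstay : M.step w c = c := by simp [step, hb]
  have hlate : ∀ i, n ≤ i → M.run w i = c := by
    intro i hi
    obtain ⟨k, rfl⟩ := Nat.exists_eq_add_of_le' hi
    rw [run, Function.iterate_add_apply, h1]
    exact Function.iterate_fixed hstay k
  refine ⟨⟨2 * n, b, M.verdict_run (by rw [hlate n le_rfl, hb])⟩, ?_, ?_⟩
  · refine M.toTM_usesSpace fun i j => Nat.lt_succ_of_le ?_
    rcases Nat.lt_or_ge i n with hi | hi
    · exact h2 i hi j
    · rw [hlate i hi]
      exact hc j
  · rw [M.toTM_accepts]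
    constructor
    · rintro ⟨i, hi⟩
      -- Both `c` and the configuration at time `i` are fixed points, so both are the configuration
      -- at time `i + n`.
      have h3 : M.run w (i + n) = c := hlate _ (by omega)
      have h4 : M.run w (n + i) = M.run w i := by
        rw [run, Function.iterate_add_apply]
        exact Function.iterate_fixed (by simp [step, show M.verdict ((M.step w)^[i] M.init).state = _ from hi]) n
      rw [add_comm, h4] at h3
      rw [h3, hb] at hi
      simpa using hi
    · rintro rfl
      exact ⟨n, by rw [hlate n le_rfl, hb]⟩

end StackMachine

end OfflineTM

/-! ### Games with choices and their evaluation by depth-first search. -/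

namespace OfflineTM

/-- The role of a state of a machine with choices: it ends the computation with a value, has one
successor, or leaves the choice to one of the two players (`true` for the existential one). -/
inductive Status where
  | verdict (b : Bool)
  | det
  | choose (o : Bool)

/-- The result of a transition of a machine with choices; `adv` moves a token of the counter. -/
structure Outcome (Q Γ : Type) where
  state : Q
  move : Move := .stay
  L : StackAct Γ := .keep
  R : StackAct Γ := .keep
  K : StackAct Γ := .keep
  adv : Bool := false

/-- A machine with choices: it has three stacks, a unary counter whose tokens can be used up one by
one, and a two-way input tape. There is a starting state for each of two games. -/
structure ChoiceMachine (α : Type) where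
  State : Type
  Symbol : Type
  finState : Finite State
  finSymbol : Finite Symbol
  branch : ℕ
  start : Bool → State
  status : State → Status
  trans : State → InputSymbol α → Option Symbol → Option Symbol → Option Symbol → Bool →
    Fin (branch + 1) → Outcome State Symbol

namespace ChoiceMachine

variable {α : Type} (G : ChoiceMachine α)

structure Config where
  state : G.State
  pos : ℕ
  L : List G.Symbol
  R : List G.Symbol
  K : List G.Symbol
  rem : ℕ
  used : ℕ

def init (b : Bool) (T : ℕ) : G.Config := ⟨G.start b, 0, [], [], [], T, 0⟩

def outcome (w : List α) (c : G.Config) (a : Fin (G.branch + 1)) : Outcome G.State G.Symbol :=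
  G.trans c.state (Machine.inputAt w c.pos) c.L.head? c.R.head? c.K.head? (decide (0 < c.rem)) a

def next (w : List α) (c : G.Config) (a : Fin (G.branch + 1)) : G.Config :=
  let r := G.outcome w c a
  let adv := r.adv && decide (0 < c.rem)
  { state := r.state
    pos := min (r.move.apply c.pos) (w.length + 1)
    L := r.L.apply c.L
    R := r.R.apply c.R
    K := r.K.apply c.K
    rem := if adv then c.rem - 1 else c.rem
    used := if adv then c.used + 1 else c.used }

structure Config.Fits {G : ChoiceMachine α} (w : List α) (S T : ℕ) (c : G.Config) : Prop where
  pos : c.pos ≤ w.length + 1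
  L : c.L.length ≤ S
  R : c.R.length ≤ S
  K : c.K.length ≤ S
  count : c.rem + c.used = T

/-- `G.Val w S T n c v`: the game from the configuration `c` on has the value `v`; there are at most
`n` choices in each play, and the stacks have at most `S` entries. -/
inductive Val (w : List α) (S T : ℕ) : ℕ → G.Config → Bool → Prop
  | verdict {n : ℕ} {c : G.Config} {b : Bool} (hf : c.Fits w S T) (h : G.status c.state = .verdict b) :
      Val w S T n c b
  | det {n : ℕ} {c : G.Config} {b : Bool} (hf : c.Fits w S T) (h : G.status c.state = .det)
      (h' : Val w S T n (G.next w c 0) b) : Val w S T n c b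
  | choose {n : ℕ} {c : G.Config} {o : Bool} {f : Fin (G.branch + 1) → Bool} (hf : c.Fits w S T)
      (h : G.status c.state = .choose o) (h' : ∀ a, Val w S T n (G.next w c a) (f a)) :
      Val w S T (n + 1) c (if o then decide (∃ a, f a = true) else decide (∀ a, f a = true))

/-- The states of the machine that evaluates the games by depth-first search. -/
inductive SearchState (Q : Type) where
  | run (b : Bool) (q : Q)
  | up (b v : Bool)
  | rewind (b : Bool)
  | reset (b : Bool)
  | done (v : Bool)

inductive SearchSymbol (Γ : Type) (m : ℕ) where
  | work (g : Γ)
  | choice (o : Bool) (a : Fin (m + 1))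
  | token

def SearchSymbol.work? {Γ : Type} {m : ℕ} : SearchSymbol Γ m → Option Γ
  | .work g => some g
  | _ => none

def liftAct {Γ : Type} {m : ℕ} : StackAct Γ → StackAct (SearchSymbol Γ m)
  | .keep => .keep
  | .pop => .pop
  | .push g => .push (.work g)

/-- The actions on the seven stacks of the searching machine: the three stacks of the machine with
choices, the unused and the used tokens, the choices made, and the choices to be repeated. -/
def searchActs {Q Γ : Type} {m : ℕ} (r : Outcome Q Γ) (more : Bool)
    (p q : StackAct (SearchSymbol Γ m)) : Fin 7 → StackAct (SearchSymbol Γ m) :=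
  ![liftAct r.L, liftAct r.R, liftAct r.K, if r.adv && more then .pop else .keep,
    if r.adv && more then .push .token else .keep, p, q]

instance {Q : Type} [Finite Q] : Finite (SearchState Q) := by
  refine Finite.of_injective
    (fun a : SearchState Q => match a with
      | .run b q => (Sum.inl (b, q) : (Bool × Q) ⊕ (Bool × Bool) ⊕ Bool ⊕ Bool ⊕ Bool)
      | .up b v => Sum.inr (Sum.inl (b, v))
      | .rewind b => Sum.inr (Sum.inr (Sum.inl b))
      | .reset b => Sum.inr (Sum.inr (Sum.inr (Sum.inl b)))
      | .done b => Sum.inr (Sum.inr (Sum.inr (Sum.inr b)))) ?_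
  rintro (_ | _ | _ | _ | _) (_ | _ | _ | _ | _) h <;> simp_all

instance {Γ : Type} [Finite Γ] {m : ℕ} : Finite (SearchSymbol Γ m) := by
  refine Finite.of_injective
    (fun a : SearchSymbol Γ m => match a with
      | .work g => (Sum.inl g : Γ ⊕ (Bool × Fin (m + 1)) ⊕ Unit)
      | .choice o a => Sum.inr (Sum.inl (o, a))
      | .token => Sum.inr (Sum.inr ())) ?_
  rintro (_ | _ | _) (_ | _ | _) h <;> simp_all

/-- Is the value `v` of a branch the value of the node, whatever the later branches are? -/
def settled {m : ℕ} (o v : Bool) (a : Fin (m + 1)) : Bool := (o == v) || decide (a = Fin.last m)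

/-- In `run` the game is played: prescribed choices are taken from stack `6`, further ones are `0`,
and all of them are recorded on stack `5`. In `up` the value of a finished subgame is carried
towards the root. At the first node that it does not settle, the next branch is due; since
configurations are not saved, `rewind` moves the path to stack `6`, `reset` restores the start, and
the path is replayed. A value that arrives at the root ends the search or starts the other game,
after the second game with one token more. -/
def searchTrans (q : SearchState G.State) (s : InputSymbol α)
    (t : Fin 7 → Option (SearchSymbol G.Symbol G.branch)) :
    SearchState G.State × Move × (Fin 7 → StackAct (SearchSymbol G.Symbol G.branch)) :=
  match q with
  | .run b q =>
    let r := G.trans q s ((t 0).bind (·.work?)) ((t 1).bind (·.work?)) ((t 2).bind (·.work?))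
      (t 3).isSome
    match G.status q with
    | .verdict v => (.up b v, .stay, fun _ => .keep)
    | .det => (.run b (r 0).state, (r 0).move, searchActs (r 0) (t 3).isSome .keep .keep)
    | .choose o =>
      match t 6 with
      | some (.choice o' a) =>
        (.run b (r a).state, (r a).move, searchActs (r a) (t 3).isSome (.push (.choice o' a)) .pop)
      | _ => (.run b (r 0).state, (r 0).move,
          searchActs (r 0) (t 3).isSome (.push (.choice o 0)) .keep)
  | .up b v =>
    match t 5 with
    | some (.choice o a) =>
      if settled o v a then (.up b v, .stay, ![.keep, .keep, .keep, .keep, .keep, .pop, .keep])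
      else (.rewind b, .stay,
        ![.keep, .keep, .keep, .keep, .keep, .pop, .push (.choice o (a + 1))])
    | _ =>
      if b == v then (.done v, .stay, fun _ => .keep)
      else if b then (.reset false, .stay, fun _ => .keep)
      else (.reset true, .stay, ![.keep, .keep, .keep, .push .token, .keep, .keep, .keep])
  | .rewind b =>
    match t 5 with
    | some g => (.rewind b, .stay, ![.keep, .keep, .keep, .keep, .keep, .pop, .push g])
    | none => (.reset b, .stay, fun _ => .keep)
  | .reset b =>
    match s, t 0, t 1, t 2, t 4 with
    | .leftEnd, none, none, none, none => (.run b (G.start b), .stay, fun _ => .keep)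
    | _, _, _, _, none => (.reset b, .left, ![.pop, .pop, .pop, .keep, .keep, .keep, .keep])
    | _, _, _, _, some g => (.reset b, .left, ![.pop, .pop, .pop, .push g, .pop, .keep, .keep])
  | .done v => (.done v, .stay, fun _ => .keep)

/-- The machine that evaluates the two games for `T = 0, 1, 2, …` by depth-first search: it accepts
when the first game has the value `true`, and otherwise rejects when the second one has the value
`false`. After each play it starts again, and repeats the choices on the path to the next node. -/
def search : StackMachine α where
  arity := 7
  State := SearchState G.State
  Symbol := SearchSymbol G.Symbol G.branch
  finState := have := G.finState; inferInstance
  finSymbol := have := G.finSymbol; inferInstance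
  start := .run true (G.start true)
  verdict := fun q => match q with
    | .done v => some v
    | _ => none
  trans := G.searchTrans

abbrev Path := List (Bool × Fin (G.branch + 1))

def tokens (n : ℕ) : List (SearchSymbol G.Symbol G.branch) := List.replicate n .token

def works (l : List G.Symbol) : List (SearchSymbol G.Symbol G.branch) := l.map .work

def choices (p : G.Path) : List (SearchSymbol G.Symbol G.branch) := p.map fun a => .choice a.1 a.2

/-- The configuration of the searching machine in the state `x`, with the stacks of `c`. -/
def conf (x : SearchState G.State) (c : G.Config) (p q : G.Path) : G.search.Config where
  state := x
  pos := c.pos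
  stk := ![G.works c.L, G.works c.R, G.works c.K, G.tokens c.rem, G.tokens c.used, G.choices p,
    G.choices q]

variable {G}

@[simp] lemma head?_works (l : List G.Symbol) : (G.works l).head?.bind (·.work?) = l.head? := by
  cases l <;> rfl

@[simp] lemma isSome_tokens (n : ℕ) : (G.tokens n).head?.isSome = decide (0 < n) := by
  cases n <;> simp [tokens, List.replicate_succ]

@[simp] lemma apply_liftAct (a : StackAct G.Symbol) (l : List G.Symbol) :
    (liftAct a).apply (G.works l) = G.works (a.apply l) := by
  cases a <;> simp [liftAct, StackAct.apply, works]

lemma conf_bounded {w : List α} {x : SearchState G.State} {c : G.Config} {p q : G.Path} {S T U : ℕ}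
    (hc : c.Fits w S T) (hS : S ≤ U) (hT : T ≤ U) (hp : p.length ≤ U) (hq : q.length ≤ U) :
    (G.conf x c p q).Bounded U := by
  obtain ⟨-, h1, h2, h3, h4⟩ := hc
  intro j
  change Fin 7 at j
  have hw (l : List G.Symbol) : (G.works l).length = l.length := List.length_map _
  have ht (n : ℕ) : (G.tokens n).length = n := List.length_replicate
  have hc (l : G.Path) : (G.choices l).length = l.length := List.length_map _
  fin_cases j
  · exact (hw c.L).trans_le (h1.trans hS)
  · exact (hw c.R).trans_le (h2.trans hS)
  · exact (hw c.K).trans_le (h3.trans hS)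
  · exact (ht c.rem).trans_le (by omega)
  · exact (ht c.used).trans_le (by omega)
  · exact (hc p).trans_le hp
  · exact (hc q).trans_le hq

/-- With the seven stacks written out, each kind of step can be verified by evaluating
`searchTrans`. -/
lemma step_eq {w : List α} {x : SearchState G.State} {c : G.Config} {p q : G.Path}
    (hx : G.search.verdict x = none) :
    G.search.step w (G.conf x c p q) =
      let r := G.searchTrans x (Machine.inputAt w c.pos)
        ![(G.works c.L).head?, (G.works c.R).head?, (G.works c.K).head?, (G.tokens c.rem).head?,
          (G.tokens c.used).head?, (G.choices p).head?, (G.choices q).head?]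
      { state := r.1
        pos := min (r.2.1.apply c.pos) (w.length + 1)
        stk := ![(r.2.2 0).apply (G.works c.L), (r.2.2 1).apply (G.works c.R),
          (r.2.2 2).apply (G.works c.K), (r.2.2 3).apply (G.tokens c.rem),
          (r.2.2 4).apply (G.tokens c.used), (r.2.2 5).apply (G.choices p),
          (r.2.2 6).apply (G.choices q)] } := by
  have e : (fun j => ((G.conf x c p q).stk j).head?) =
      ![(G.works c.L).head?, (G.works c.R).head?, (G.works c.K).head?, (G.tokens c.rem).head?,
        (G.tokens c.used).head?, (G.choices p).head?, (G.choices q).head?] := by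
    funext j
    change Fin 7 at j
    fin_cases j <;> rfl
  have hx' : G.search.verdict (G.conf x c p q).state = none := hx
  unfold StackMachine.step
  rw [hx']
  dsimp only
  rw [e]
  simp only [search]
  congr 1
  funext j
  fin_cases j <;> rfl

lemma ext_config {N : StackMachine α} {c c' : N.Config} (h1 : c.state = c'.state)
    (h2 : c.pos = c'.pos) (h3 : c.stk = c'.stk) : c = c' := by
  cases c; cases c'; simp_all

variable (G) in
/-- The searching machine runs the game `b` and is in the configuration `c`. -/
def runConf (b : Bool) (c : G.Config) (p q : G.Path) : G.search.Config :=
  G.conf (.run b c.state) c p q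

/-- The common part of the three kinds of moves in `run`, which differ only in the actions `A` and
`B` on the two stacks of choices. -/
lemma acts_apply (w : List α) (c : G.Config) (a : Fin (G.branch + 1))
    (A B : StackAct (SearchSymbol G.Symbol G.branch)) (p q p' q' : G.Path)
    (hA : A.apply (G.choices p) = G.choices p') (hB : B.apply (G.choices q) = G.choices q') :
    let acts := searchActs (G.outcome w c a) (decide (0 < c.rem)) A B
    (![(acts 0).apply (G.works c.L), (acts 1).apply (G.works c.R), (acts 2).apply (G.works c.K),
      (acts 3).apply (G.tokens c.rem), (acts 4).apply (G.tokens c.used), (acts 5).apply (G.choices p),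
      (acts 6).apply (G.choices q)] : Fin 7 → List (SearchSymbol G.Symbol G.branch)) =
    ![G.works (G.next w c a).L, G.works (G.next w c a).R, G.works (G.next w c a).K,
      G.tokens (G.next w c a).rem, G.tokens (G.next w c a).used, G.choices p', G.choices q'] := by
  intro acts
  have h0 : acts 0 = liftAct (G.outcome w c a).L := rfl
  have h1 : acts 1 = liftAct (G.outcome w c a).R := rfl
  have h2 : acts 2 = liftAct (G.outcome w c a).K := rfl
  have h3 : acts 3 = if (G.outcome w c a).adv && decide (0 < c.rem) then .pop else .keep := rfl
  have h4 : acts 4 = if (G.outcome w c a).adv && decide (0 < c.rem) then .push .token else .keep :=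
    rfl
  have h5 : acts 5 = A := rfl
  have h6 : acts 6 = B := rfl
  rw [h0, h1, h2, h3, h4, h5, h6, hA, hB, apply_liftAct, apply_liftAct, apply_liftAct]
  simp only [next]
  split_ifs with h
  · simp [StackAct.apply, tokens, List.replicate_succ]
  · simp [StackAct.apply]

lemma step_run_det {w : List α} {b : Bool} {c : G.Config} {p q : G.Path}
    (h : G.status c.state = .det) :
    G.search.step w (G.runConf b c p q) = G.runConf b (G.next w c 0) p q := by
  rw [runConf, step_eq (by rfl)]
  simp only [searchTrans, h]
  simp [-Fin.isValue]
  refine ext_config rfl rfl (acts_apply w c 0 .keep .keep p q p q rfl rfl)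

lemma step_run_repeat {w : List α} {b o o' : Bool} {c : G.Config} {a : Fin (G.branch + 1)}
    {p q : G.Path} (h : G.status c.state = .choose o) :
    G.search.step w (G.runConf b c p ((o', a) :: q)) =
      G.runConf b (G.next w c a) ((o', a) :: p) q := by
  rw [runConf, step_eq (by rfl)]
  simp only [searchTrans, h]
  simp [choices, -Fin.isValue]
  refine ext_config rfl rfl
    (acts_apply w c a (.push (.choice o' a)) .pop p ((o', a) :: q) ((o', a) :: p) q rfl rfl)

lemma step_run_choose {w : List α} {b o : Bool} {c : G.Config} {p : G.Path}
    (h : G.status c.state = .choose o) :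
    G.search.step w (G.runConf b c p []) = G.runConf b (G.next w c 0) ((o, 0) :: p) [] := by
  rw [runConf, step_eq (by rfl)]
  simp only [searchTrans, h]
  simp [choices, -Fin.isValue]
  refine ext_config rfl rfl
    (acts_apply w c 0 (.push (.choice o 0)) .keep p [] ((o, 0) :: p) [] rfl rfl)

lemma step_run_verdict {w : List α} {b v : Bool} {c : G.Config} {p q : G.Path}
    (hc : c.pos ≤ w.length + 1) (h : G.status c.state = .verdict v) :
    G.search.step w (G.runConf b c p q) = G.conf (.up b v) c p q := by
  rw [runConf, step_eq (by rfl)]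
  simp only [searchTrans, h]
  exact ext_config rfl (min_eq_left hc) rfl

lemma step_up_settled {w : List α} {b v o : Bool} {a : Fin (G.branch + 1)} {c : G.Config}
    {p q : G.Path} (hc : c.pos ≤ w.length + 1) (h : settled o v a = true) :
    G.search.step w (G.conf (.up b v) c ((o, a) :: p) q) = G.conf (.up b v) c p q := by
  rw [step_eq (by rfl)]
  simp [searchTrans, choices, h, -Fin.isValue]
  exact ext_config rfl (min_eq_left hc) rfl

lemma step_up_next {w : List α} {b v o : Bool} {a : Fin (G.branch + 1)} {c : G.Config}
    {p q : G.Path} (hc : c.pos ≤ w.length + 1) (h : settled o v a = false) :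
    G.search.step w (G.conf (.up b v) c ((o, a) :: p) q) =
      G.conf (.rewind b) c p ((o, a + 1) :: q) := by
  rw [step_eq (by rfl)]
  simp [searchTrans, choices, h, -Fin.isValue]
  exact ext_config rfl (min_eq_left hc) rfl

/-- The latest choice is on top of the record, so moving the entries one by one leaves the choice at
the root on top, as the replay requires. -/
lemma leads_rewind {w : List α} {S T U : ℕ} {b : Bool} {c : G.Config}
    (hf : c.Fits w S T) (hS : S ≤ U) (hT : T ≤ U) (p q : G.Path) (hpq : p.length + q.length ≤ U) :
    G.search.Leads w U (G.conf (.rewind b) c p q) (G.conf (.reset b) c [] (p.reverse ++ q)) := by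
  induction p generalizing q with
  | nil =>
    refine .single (conf_bounded hf hS hT (by simp) (by simpa using hpq)) ?_
    rw [step_eq (by rfl)]
    simp [searchTrans, choices, -Fin.isValue]
    exact ext_config rfl (min_eq_left hf.pos) rfl
  | cons a p ih =>
    have hpq' : p.length + 1 + q.length ≤ U := by simpa using hpq
    refine .head (c' := G.conf (.rewind b) c p (a :: q))
      (conf_bounded hf hS hT (by simp; omega) (by omega)) ?_ ?_
    · rw [step_eq (by rfl)]
      simp [searchTrans, choices, -Fin.isValue]
      exact ext_config rfl (min_eq_left hf.pos) rfl
    · simpa using ih (a :: q) (by simp; omega)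

/-- All stacks are emptied simultaneously while the input head moves left, so the sum of everything
that remains to be removed decreases. Returning the used tokens restores the counter because `rem +
used = T` is kept. -/
lemma leads_reset {w : List α} {S T U : ℕ} {b : Bool} {c : G.Config}
    (hf : c.Fits w S T) (hS : S ≤ U) (hT : T ≤ U) (q : G.Path) (hq : q.length ≤ U) :
    G.search.Leads w U (G.conf (.reset b) c [] q) (G.runConf b (G.init b T) [] q) := by
  induction hm : c.pos + c.L.length + c.R.length + c.K.length + c.used using
    Nat.strong_induction_on generalizing c with
  | _ m ih =>
  have hb : (G.conf (.reset b) c [] q).Bounded U := conf_bounded hf hS hT (by simp) hq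
  by_cases h0 : m = 0
  · obtain ⟨x, pos, L, R, K, rem, used⟩ := c
    dsimp only at hm
    obtain rfl : pos = 0 := by omega
    obtain rfl : L = [] := List.eq_nil_of_length_eq_zero (by omega)
    obtain rfl : R = [] := List.eq_nil_of_length_eq_zero (by omega)
    obtain rfl : K = [] := List.eq_nil_of_length_eq_zero (by omega)
    obtain rfl : used = 0 := by omega
    obtain rfl : rem = T := hf.count
    exact .single hb (by rw [step_eq (by rfl)]; rfl)
  · let c' : G.Config := ⟨c.state, c.pos - 1, c.L.tail, c.R.tail, c.K.tail,
      if c.used = 0 then c.rem else c.rem + 1, c.used - 1⟩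
    have hstep : G.search.step w (G.conf (.reset b) c [] q) = G.conf (.reset b) c' [] q := by
      have hp := hf.pos
      obtain ⟨x, pos, L, R, K, rem, used⟩ := c
      rw [step_eq (by rfl)]
      dsimp only at hm hp
      have hpos : min (pos - 1) (w.length + 1) = pos - 1 := by omega
      have hw (l : List G.Symbol) : (G.works l).tail = G.works l.tail := by cases l <;> rfl
      rcases Nat.eq_zero_or_pos used with rfl | hu
      · have : G.searchTrans (.reset b) (Machine.inputAt w pos)
            ![(G.works L).head?, (G.works R).head?, (G.works K).head?, (G.tokens rem).head?,
              (G.tokens 0).head?, (G.choices []).head?, (G.choices q).head?] =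
            (.reset b, .left, ![.pop, .pop, .pop, .keep, .keep, .keep, .keep]) := by
          rcases pos with _ | pos
          · rcases L with _ | ⟨g, L⟩
            · rcases R with _ | ⟨g, R⟩
              · rcases K with _ | ⟨g, K⟩
                · simp at hm; omega
                · rfl
              · rfl
            · rfl
          · simp only [Machine.inputAt]
            cases w[pos]? <;> rfl
        simp only [this]
        refine ext_config rfl hpos ?_
        simp [conf, c', StackAct.apply, hw]
        rfl
      · obtain ⟨u, rfl⟩ := Nat.exists_eq_add_of_le' hu
        have : G.searchTrans (.reset b) (Machine.inputAt w pos)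
            ![(G.works L).head?, (G.works R).head?, (G.works K).head?, (G.tokens rem).head?,
              (G.tokens (u + 1)).head?, (G.choices []).head?, (G.choices q).head?] =
            (.reset b, .left, ![.pop, .pop, .pop, .push .token, .pop, .keep, .keep]) := by
          rcases pos with _ | pos
          · cases L <;> cases R <;> cases K <;> rfl
          · simp only [Machine.inputAt]
            cases w[pos]? <;> rfl
        simp only [this]
        refine ext_config rfl hpos ?_
        simp [conf, c', StackAct.apply, hw, tokens, List.replicate_succ]
        rfl
    refine .head hb hstep (ih _ ?_ ?_ rfl)
    · simp only [c', List.length_tail]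
      omega
    · obtain ⟨h1, h2, h3, h4, h5⟩ := hf
      refine ⟨?_, ?_, ?_, ?_, ?_⟩ <;> simp only [c', List.length_tail] <;> try omega
      split_ifs <;> omega

/-- The searching machine finds the value of a node, and returns to it. -/
lemma Val.search {w : List α} {S T U n : ℕ} {b v : Bool} {c : G.Config}
    (hval : G.Val w S T n c v) (hS : S ≤ U) (hT : T ≤ U) (p : G.Path) (hp : p.length + n ≤ U)
    (hrep : ∀ q : G.Path, p.length + q.length ≤ U →
      G.search.Leads w U (G.runConf b (G.init b T) [] (p.reverse ++ q)) (G.runConf b c p q)) :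
    ∃ c', c'.Fits w S T ∧
      G.search.Leads w U (G.runConf b c p []) (G.conf (.up b v) c' p []) := by
  induction hval generalizing p with
  | @verdict n c v hf h =>
    exact ⟨c, hf, .single (conf_bounded hf hS hT (by omega) (by simp))
      (step_run_verdict hf.pos h)⟩
  | @det n c v hf h h' ih =>
    obtain ⟨c', hc', hl⟩ := ih p hp fun q hq => (hrep q hq).trans
      (.single (conf_bounded hf hS hT (by omega) (by omega)) (step_run_det h))
    exact ⟨c', hc', .head (conf_bounded hf hS hT (by omega) (by simp)) (step_run_det h) hl⟩
  | @choose n c o f hf h h' ih =>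
    -- The replay property passes to the children: replay up to this node, then take the prescribed
    -- branch.
    have hext (a : Fin (G.branch + 1)) (q : G.Path) (hq : p.length + q.length + 1 ≤ U) :
        G.search.Leads w U (G.runConf b (G.init b T) [] (p.reverse ++ (o, a) :: q))
          (G.runConf b (G.next w c a) ((o, a) :: p) q) :=
      (hrep ((o, a) :: q) (by simp; omega)).trans
        (.single (conf_bounded hf hS hT (by omega) (by simp; omega)) (step_run_repeat h))
    -- Induction on the number `k` of branches after `a`; the branches before `a` have the value
    -- that does not settle the node.
    have key : ∀ k (a : Fin (G.branch + 1)), (a : ℕ) + k = G.branch →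
        (∀ a' < a, f a' = !o) → ∃ c', c'.Fits w S T ∧
          G.search.Leads w U (G.runConf b (G.next w c a) ((o, a) :: p) [])
            (G.conf (.up b (if o then decide (∃ a, f a = true) else decide (∀ a, f a = true)))
              c' p []) := by
      intro k
      induction k with
      | zero =>
        intro a ha hlt
        obtain ⟨c1, hc1, hl⟩ := ih a ((o, a) :: p) (by simp; omega) fun q hq => by
          simpa using hext a q (by simp at hq; omega)
        -- All other branches have the value `!o`, so the last one determines the value of the node,
        -- whatever it is.
        have hlast : a = Fin.last _ := Fin.ext (by simpa using ha)
        have hv : (if o then decide (∃ a, f a = true) else decide (∀ a, f a = true)) = f a := by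
          have hall : ∀ a', a' ≠ a → f a' = !o := fun a' hne => hlt a' (by
            rw [hlast] at hne ⊢; exact Fin.lt_last_iff_ne_last.mpr hne)
          cases o
          · cases hfa : f a
            · simp only [Bool.false_eq_true, if_false, decide_eq_false_iff_not]
              intro hh; simp [hh a] at hfa
            · simp only [Bool.false_eq_true, if_false, decide_eq_true_eq]
              intro a'
              by_cases hne : a' = a
              · rw [hne, hfa]
              · simpa using hall a' hne
          · cases hfa : f a
            · simp only [if_true, decide_eq_false_iff_not]
              rintro ⟨a', ha'⟩
              by_cases hne : a' = a
              · rw [hne, hfa] at ha'; simp at ha'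
              · rw [hall a' hne] at ha'; simp at ha'
            · simp only [if_true, decide_eq_true_eq]
              exact ⟨a, hfa⟩
        rw [hv]
        refine ⟨c1, hc1, hl.trans (.single (conf_bounded hc1 hS hT (by simp; omega) (by simp))
          (step_up_settled hc1.pos (by simp [settled, hlast])))⟩
      | succ k ihk =>
        intro a ha hlt
        obtain ⟨c1, hc1, hl⟩ := ih a ((o, a) :: p) (by simp; omega) fun q hq => by
          simpa using hext a q (by simp at hq; omega)
        by_cases hfa : f a = o
        · have hv : (if o then decide (∃ a, f a = true) else decide (∀ a, f a = true)) = f a := by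
            cases o
            · simp only [Bool.false_eq_true, if_false, hfa, decide_eq_false_iff_not]
              intro hh; simp [hh a] at hfa
            · simp only [if_true, hfa, decide_eq_true_eq]
              exact ⟨a, hfa⟩
          rw [hv]
          exact ⟨c1, hc1, hl.trans (.single (conf_bounded hc1 hS hT (by simp; omega) (by simp))
            (step_up_settled hc1.pos (by simp [settled, hfa])))⟩
        · have hne : a ≠ Fin.last _ := fun hh => by rw [hh] at ha; simp at ha
          have hfa' : f a = !o := by cases o <;> cases hh : f a <;> simp_all
          have hval1 : ((a + 1 : Fin (G.branch + 1)) : ℕ) = a + 1 :=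
            Fin.val_add_one_of_lt (Fin.lt_last_iff_ne_last.mpr hne)
          obtain ⟨c', hc', hl'⟩ := ihk (a + 1) (by omega) (fun a' ha' => by
            rcases lt_or_eq_of_le (show (a' : ℕ) ≤ a by
              have : (a' : ℕ) < (a + 1 : Fin (G.branch + 1)) := ha'
              omega) with h1 | h1
            · exact hlt a' h1
            · rw [Fin.ext h1, hfa'])
          refine ⟨c', hc', (hl.trans (.single (conf_bounded hc1 hS hT (by simp; omega) (by simp))
            (step_up_next hc1.pos (by simp [settled, hne, hfa'])))).trans ?_⟩
          -- Transition to the next branch: rewind the record, reset the game, and replay the path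
          -- with the last choice increased.
          refine (leads_rewind hc1 hS hT p _ (by simp; omega)).trans ?_
          refine (leads_reset hc1 hS hT _ (by simp; omega)).trans ?_
          exact (hext (a + 1) [] (by simp; omega)).trans hl'
    obtain ⟨c', hc', hl⟩ := key G.branch 0 (by simp) (by simp)
    exact ⟨c', hc', .head (conf_bounded hf hS hT (by omega) (by simp)) (step_run_choose h) hl⟩

lemma Val.search_root {w : List α} {T U : ℕ} {b v : Bool} (hval : G.Val w U T U (G.init b T) v)
    (hT : T ≤ U) : ∃ c', c'.Fits w U T ∧
      G.search.Leads w U (G.runConf b (G.init b T) [] []) (G.conf (.up b v) c' [] []) :=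
  hval.search le_rfl hT [] (by simp) fun _ _ => .refl

lemma step_up_root {w : List α} {b v : Bool} {c : G.Config} (hc : c.pos ≤ w.length + 1) :
    G.search.step w (G.conf (.up b v) c [] []) =
      if b = v then G.conf (.done v) c [] []
      else if b then G.conf (.reset false) c [] []
      else G.conf (.reset true) { c with rem := c.rem + 1 } [] [] := by
  rw [step_eq (by rfl)]
  cases b <;> cases v <;> exact ext_config rfl (min_eq_left hc) rfl

/-- If the machine accepts or rejects for the value `T` of the counter, it stops; otherwise it goes
on with `T + 1`. -/
lemma search_round {w : List α} {T U : ℕ} {va vb : Bool}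
    (hA : G.Val w U T U (G.init true T) va) (hB : G.Val w U T U (G.init false T) vb)
    (hT : T + 1 ≤ U) :
    (va = true ∨ vb = false → ∃ c', c'.Bounded U ∧ c'.state = .done va ∧
      G.search.Leads w U (G.runConf true (G.init true T) [] []) c') ∧
    (va = false → vb = true → G.search.Leads w U (G.runConf true (G.init true T) [] [])
      (G.runConf true (G.init true (T + 1)) [] [])) := by
  obtain ⟨c, hc, hl⟩ := hA.search_root (by omega)
  have hb : ∀ x, (G.conf x c [] []).Bounded U := fun x =>
    conf_bounded hc le_rfl (by omega) (by simp) (by simp)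
  cases va with
  | true =>
    refine ⟨fun _ => ⟨G.conf (.done true) c [] [], hb _, rfl, hl.trans (.single (hb _) ?_)⟩, by simp⟩
    rw [step_up_root hc.pos]; rfl
  | false =>
    obtain ⟨c2, hc2, hl2⟩ := hB.search_root (by omega)
    have hb2 : ∀ x, (G.conf x c2 [] []).Bounded U := fun x =>
      conf_bounded hc2 le_rfl (by omega) (by simp) (by simp)
    have hl3 := ((hl.trans (.single (c' := G.conf (.reset false) c [] []) (hb _)
      (by rw [step_up_root hc.pos]; rfl))).trans
        (leads_reset hc le_rfl (by omega) [] (by simp))).trans hl2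
    cases vb with
    | false =>
      refine ⟨fun _ => ⟨G.conf (.done false) c2 [] [], hb2 _, rfl, hl3.trans
        (.single (hb2 _) ?_)⟩, by simp⟩
      rw [step_up_root hc2.pos]; rfl
    | true =>
      refine ⟨by simp, fun _ _ => ?_⟩
      refine (hl3.trans (.single (c' := G.conf (.reset true) { c2 with rem := c2.rem + 1 } [] [])
        (hb2 _) (by rw [step_up_root hc2.pos]; rfl))).trans
        (leads_reset (S := U) ?_ le_rfl (by omega) [] (by simp))
      obtain ⟨h1, h2, h3, h4, h5⟩ := hc2
      exact ⟨h1, h2, h3, h4, by dsimp only; omega⟩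

/-- After a verdict the run is constant, so a configuration without verdict can only be visited
before. -/
lemma Leads.verdict_none {N : StackMachine α} {w : List α} {s i : ℕ} {c : N.Config}
    (h : N.Leads w s N.init c) (hc : N.verdict c.state = none) {v : Bool}
    (hv : N.verdict (N.run w i).state = some v) : ∃ n < i, N.run w n = c := by
  obtain ⟨n, h1, -⟩ := h.iterate
  refine ⟨n, ?_, h1⟩
  by_contra hn
  obtain ⟨k, rfl⟩ := Nat.exists_eq_add_of_le' (not_lt.mp hn)
  rw [Function.iterate_add_apply, Function.iterate_fixed] at h1
  · rw [← h1, show N.verdict ((N.step w)^[i] N.init).state = _ from hv] at hc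
    simp at hc
  · simp [StackMachine.step, show N.verdict ((N.step w)^[i] N.init).state = _ from hv]

/-- The searching machine, as a Turing machine, decides by means of the values of the games. -/
theorem search_spec {w : List α} {U : ℕ → ℕ} (hU : Monotone U) (hT : ∀ T, T + 1 ≤ U T)
    {VA VB : ℕ → Bool} (hA : ∀ T, G.Val w (U T) T (U T) (G.init true T) (VA T))
    (hB : ∀ T, G.Val w (U T) T (U T) (G.init false T) (VB T)) :
    (∀ T, (∀ T' < T, VA T' = false ∧ VB T' = true) → VA T = true ∨ VB T = false →
      G.search.toTM.Halts w ∧ G.search.toTM.UsesSpace w (U T + 1) ∧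
        (G.search.toTM.Accepts w ↔ VA T = true)) ∧
    ((∀ T, VA T = false ∧ VB T = true) → ¬ G.search.toTM.Accepts w) := by
  have hinit : G.search.init = G.runConf true (G.init true 0) [] [] := by
    refine ext_config rfl rfl ?_
    funext j
    change Fin 7 at j
    fin_cases j <;> rfl
  have hlead : ∀ T, (∀ T' < T, VA T' = false ∧ VB T' = true) →
      G.search.Leads w (U T) G.search.init (G.runConf true (G.init true T) [] []) := by
    intro T
    induction T with
    | zero => intro _; rw [hinit]; exact .refl
    | succ T ih =>
      intro h
      have h1 := (ih fun T' hT' => h T' (by omega)).mono (hU (Nat.le_succ T))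
      exact h1.trans (((search_round (hA T) (hB T) (hT T)).2 (h T (by omega)).1
        (h T (by omega)).2).mono (hU (Nat.le_succ T)))
  refine ⟨fun T h hs => ?_, fun h => ?_⟩
  · obtain ⟨c, hc, hst, hl⟩ := (search_round (hA T) (hB T) (hT T)).1 hs
    exact ((hlead T h).trans hl).halts hc (by rw [hst]; rfl)
  · rw [StackMachine.toTM_accepts]
    rintro ⟨i, hi⟩
    have hvis : ∀ T, ∃ n < i, G.search.run w n = G.runConf true (G.init true T) [] [] :=
      fun T => Leads.verdict_none (hlead T fun T' _ => h T') rfl hi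
    choose n hn hrun using hvis
    -- The starts of the rounds have different numbers of tokens, so they occur at different times.
    -- There would be infinitely many of them before the time `i` of the verdict.
    have hinj : Function.Injective n := by
      intro T T' he
      have h1 := (hrun T).symm.trans ((congrArg (G.search.run w) he).trans (hrun T'))
      have h2 : (G.tokens T).length = (G.tokens T').length :=
        congrArg (fun c : G.search.Config => (c.stk (3 : Fin 7)).length) h1
      simpa [tokens] using h2
    exact Set.infinite_range_of_injective hinj
      ((Set.finite_lt_nat i).subset (by rintro _ ⟨T, rfl⟩; exact hn T))

end ChoiceMachine

end OfflineTM

/-! ### First-order formulas about words, recursive systems of rules, and the evaluation game. -/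

namespace OfflineTM

/-- First-order formulas about words of the same length. -/
inductive Form (V K : Type) where
  | rel (k : K) (x y : V)
  | lt (x y : V)
  | fls
  | not (φ : Form V K)
  | and (φ ψ : Form V K)
  | ex (x : V) (φ : Form V K)

namespace Form

variable {V K : Type}

open Classical in
/-- The truth of a formula about words of length `n`, ordered lexicographically. -/
def Holds {m : ℕ} (n : ℕ) (R : K → List (Fin m) → List (Fin m) → Prop) :
    Form V K → (V → List (Fin m)) → Prop
  | rel k x y, e => R k (e x) (e y)
  | lt x y, e => e x < e y
  | fls, _ => False
  | not φ, e => ¬ φ.Holds n R e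
  | and φ ψ, e => φ.Holds n R e ∧ ψ.Holds n R e
  | ex x φ, e => ∃ u, u.length = n ∧ φ.Holds n R (Function.update e x u)

/-- The states of the game contain the formulas that are being evaluated; finiteness of these sets
makes the number of states finite. -/
def subs : Form V K → Set (Form V K)
  | rel k x y => {rel k x y}
  | lt x y => {lt x y}
  | fls => {fls}
  | not φ => insert (not φ) φ.subs
  | and φ ψ => insert (and φ ψ) (φ.subs ∪ ψ.subs)
  | ex x φ => insert (ex x φ) φ.subs

lemma mem_subs (φ : Form V K) : φ ∈ φ.subs := by
  cases φ <;> simp [subs]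

lemma finite_subs (φ : Form V K) : φ.subs.Finite := by
  induction φ with
  | rel | lt | fls => exact Set.finite_singleton _
  | not φ ih => exact ih.insert _
  | and φ ψ ih₁ ih₂ => exact (ih₁.union ih₂).insert _
  | ex x φ ih => exact ih.insert _

/-- Used to bound the number of choices: on words of length `n` each symbol counted here costs at
most `n + 2` of them. -/
def size : Form V K → ℕ
  | rel _ _ _ => 1
  | lt _ _ => 1
  | fls => 1
  | not φ => φ.size + 1
  | and φ ψ => φ.size + ψ.size + 1
  | ex _ φ => φ.size + 1

end Form

/-- A system of rules that defines binary relations between words of length `n` by recursion on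
`n`. The step from `n` to `n + 1` also depends on a block, which consists of a header, an input
symbol, and a list of `n` cells, i.e. a word of length `n` for each variable. The flag `reads` says
whether the next block gets the next input symbol. -/
structure System (α : Type) where
  sym : ℕ
  Var : Type
  Kind : Type
  Hdr : Type
  finVar : Finite Var
  finKind : Finite Kind
  finHdr : Finite Hdr
  hdr : Hdr
  arg₁ : Var
  arg₂ : Var
  arg_ne : arg₁ ≠ arg₂
  rule : Kind → Fin (sym + 1) → Fin (sym + 1) → Hdr → Option α → Form Var Kind
  base : Kind → Bool
  final : Bool → Form Var Kind
  reads : Hdr → Bool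

namespace System

variable {α : Type} (Y : System α)

abbrev Sym := Fin (Y.sym + 1)

abbrev Cell := Y.Var → Y.Sym

structure Block where
  hdr : Y.Hdr
  letter : Option α
  cells : List Y.Cell

/-- The words that are written in a list of cells. -/
def track (l : List Y.Cell) (v : Y.Var) : List Y.Sym := l.map fun g => g v

open Classical in
-- Apart from the two arguments, the variables take their values from the block. In this way a rule
-- can refer to the choices made in the step.
noncomputable def env (l : List Y.Cell) (x y : List Y.Sym) : Y.Var → List Y.Sym :=
  Function.update (Function.update (Y.track l) Y.arg₁ x) Y.arg₂ y

/-- The relations on words of length `B.length`; the block of the last step is the head of `B`. -/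
def Rel : List Y.Block → Y.Kind → List Y.Sym → List Y.Sym → Prop
  | [], k, _, _ => Y.base k = true
  | c :: B, k, g :: x, g' :: y =>
      (Y.rule k g g' c.hdr c.letter).Holds B.length (Rel B) (Y.env c.cells x y)
  | _, _, _, _ => False

/-- The number of input symbols that are read in the given blocks. -/
def position : List Y.Block → ℕ
  | [] => 0
  | c :: B => position B + if Y.reads c.hdr then 1 else 0

/-- A block always carries the symbol at the current input position, whether or not it is consumed,
so the symbol is not a free choice. -/
def Valid (w : List α) : List Y.Block → Prop
  | [] => True
  | c :: B => c.letter = w[Y.position B]? ∧ c.cells.length = B.length ∧ Valid w B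

/-- The statement that is evaluated by the game `b`. -/
def Value (w : List α) (b : Bool) (T : ℕ) : Prop :=
  ∃ B : List Y.Block, B.length = T ∧ Y.Valid w B ∧
    (Y.final b).Holds T (Y.Rel B) fun _ => List.replicate T 0

/-- The formulas that occur in the evaluation. -/
def formulas : Set (Form Y.Var Y.Kind) :=
  (⋃ b, (Y.final b).subs) ∪
    ⋃ i : Y.Kind × Y.Sym × Y.Sym × Y.Hdr × Option α,
      (Y.rule i.1 i.2.1 i.2.2.1 i.2.2.2.1 i.2.2.2.2).subs

lemma finite_formulas [Finite α] : Y.formulas.Finite := by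
  have := Y.finKind
  have := Y.finHdr
  exact (Set.finite_iUnion fun _ => Form.finite_subs _).union
    (Set.finite_iUnion fun _ => Form.finite_subs _)

lemma final_subs (b : Bool) : (Y.final b).subs ⊆ Y.formulas :=
  (Set.subset_iUnion (fun b => (Y.final b).subs) b).trans Set.subset_union_left

lemma rule_subs (k : Y.Kind) (g g' : Y.Sym) (h : Y.Hdr) (a : Option α) :
    (Y.rule k g g' h a).subs ⊆ Y.formulas :=
  (Set.subset_iUnion (fun i : Y.Kind × Y.Sym × Y.Sym × Y.Hdr × Option α =>
      (Y.rule i.1 i.2.1 i.2.2.1 i.2.2.2.1 i.2.2.2.2).subs) (k, g, g', h, a)).trans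
    Set.subset_union_right

open Classical in
/-- The formula `φ` as an element of the set of all relevant formulas. -/
noncomputable def clip (φ : Form Y.Var Y.Kind) : Y.formulas :=
  if h : φ ∈ Y.formulas then ⟨φ, h⟩ else ⟨Y.final true, Y.final_subs true (Form.mem_subs _)⟩

lemma clip_val {φ : Form Y.Var Y.Kind} (h : φ ∈ Y.formulas) : (Y.clip φ).1 = φ := by
  simp [clip, h]

/-- What is done between two sweeps over the list of cells. -/
inductive Goal where
  | eval (φ : Y.formulas) (pol : Bool)
  | enter (k : Y.Kind) (pol : Bool)
  | header (b : Bool)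
  | verdict (v : Bool)

/-- The sweeps: choose a word, compare two words, pass two words to the relation at the preceding
level, get the next block, and choose a block. -/
inductive Op where
  | guess (x : Y.Var) (φ : Y.formulas) (pol : Bool)
  | test (o : Option Bool) (x y : Y.Var) (pol : Bool)
  | call (k : Y.Kind) (x y : Y.Var) (pol : Bool)
  | load (φ : Y.formulas) (pol : Bool)
  | block (b : Bool)

inductive GameState where
  | go (t : Y.Goal)
  | sweep (op : Y.Op)
  | back (t : Y.Goal)
  | setup (b : Bool)
  | grow (b : Bool)
  | begin (b : Bool)

inductive GameSymbol where
  | cell (g : Y.Cell)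
  | hdr (h : Y.Hdr) (a : Option α)

instance [Finite α] : Finite Y.Goal := by
  have := Y.finKind
  have : Finite Y.formulas := Y.finite_formulas
  refine Finite.of_injective
    (fun t : Y.Goal => match t with
      | .eval φ p => (Sum.inl (φ, p) : (Y.formulas × Bool) ⊕ (Y.Kind × Bool) ⊕ Bool ⊕ Bool)
      | .enter k p => Sum.inr (Sum.inl (k, p))
      | .header b => Sum.inr (Sum.inr (Sum.inl b))
      | .verdict b => Sum.inr (Sum.inr (Sum.inr b))) ?_
  rintro (_ | _ | _ | _) (_ | _ | _ | _) h <;> simp_all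

instance [Finite α] : Finite Y.Op := by
  have := Y.finKind
  have := Y.finVar
  have : Finite Y.formulas := Y.finite_formulas
  refine Finite.of_injective
    (fun t : Y.Op => match t with
      | .guess x φ p => (Sum.inl (x, φ, p) : (Y.Var × Y.formulas × Bool) ⊕
          (Option Bool × Y.Var × Y.Var × Bool) ⊕ (Y.Kind × Y.Var × Y.Var × Bool) ⊕
          (Y.formulas × Bool) ⊕ Bool)
      | .test o x y p => Sum.inr (Sum.inl (o, x, y, p))
      | .call k x y p => Sum.inr (Sum.inr (Sum.inl (k, x, y, p)))
      | .load φ p => Sum.inr (Sum.inr (Sum.inr (Sum.inl (φ, p))))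
      | .block b => Sum.inr (Sum.inr (Sum.inr (Sum.inr b)))) ?_
  rintro (_ | _ | _ | _ | _) (_ | _ | _ | _ | _) h <;> simp_all

instance [Finite α] : Finite Y.GameState := by
  refine Finite.of_injective
    (fun t : Y.GameState => match t with
      | .go t => (Sum.inl t : Y.Goal ⊕ Y.Op ⊕ Y.Goal ⊕ Bool ⊕ Bool ⊕ Bool)
      | .sweep p => Sum.inr (Sum.inl p)
      | .back t => Sum.inr (Sum.inr (Sum.inl t))
      | .setup b => Sum.inr (Sum.inr (Sum.inr (Sum.inl b)))
      | .grow b => Sum.inr (Sum.inr (Sum.inr (Sum.inr (Sum.inl b))))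
      | .begin b => Sum.inr (Sum.inr (Sum.inr (Sum.inr (Sum.inr b))))) ?_
  rintro (_ | _ | _ | _ | _ | _) (_ | _ | _ | _ | _ | _) h <;> simp_all

instance [Finite α] : Finite Y.GameSymbol := by
  have := Y.finVar
  have := Y.finHdr
  refine Finite.of_injective
    (fun t : Y.GameSymbol => match t with
      | .cell g => (Sum.inl g : Y.Cell ⊕ (Y.Hdr × Option α))
      | .hdr h a => Sum.inr (h, a)) ?_
  rintro (_ | _) (_ | _) h <;> simp_all

/-- What a player chooses in one step; each state uses one component. -/
structure Pick where
  side : Bool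
  sym : Y.Sym
  cell : Y.Cell
  hdr : Y.Hdr

lemma exists_picks : ∃ (n : ℕ) (f : Fin (n + 1) → Y.Pick), Function.Surjective f := by
  have := Y.finVar
  have := Y.finHdr
  have : Finite Y.Pick := by
    refine Finite.of_injective (fun p : Y.Pick => (p.side, p.sym, p.cell, p.hdr)) ?_
    rintro ⟨_, _, _, _⟩ ⟨_, _, _, _⟩ h
    simp_all
  obtain ⟨n, ⟨e⟩⟩ := Finite.exists_equiv_fin Y.Pick
  cases n with
  | zero => exact (e ⟨true, 0, fun _ => 0, Y.hdr⟩).elim0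
  | succ n => exact ⟨n, e.symm, e.symm.surjective⟩

noncomputable def picks : ℕ := Y.exists_picks.choose

noncomputable def pick : Fin (Y.picks + 1) → Y.Pick := Y.exists_picks.choose_spec.choose

lemma pick_surjective : Function.Surjective Y.pick := Y.exists_picks.choose_spec.choose_spec

def Op.finish {Y : System α} : Y.Op → Y.Goal
  | .guess _ φ pol => .eval φ pol
  | .test o _ _ pol => .verdict (o.getD false == pol)
  | .call k _ _ pol => .enter k pol
  | .load φ pol => .eval φ pol
  | .block b => .header b

/-- The existential player claims that the truth value of the formula is `pol`. So a witness is
chosen by this player if `pol` is true and by the opponent otherwise, and for a conjunction it is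
the other way round. -/
def status : Y.GameState → Status
  | .go (.eval φ pol) => match φ.1 with
    | .and _ _ => .choose (!pol)
    | _ => .det
  | .go (.enter _ _) => .det
  | .go (.header _) => .choose true
  | .go (.verdict v) => .verdict v
  | .sweep (.guess _ _ pol) => .choose pol
  | .sweep (.block _) => .choose true
  | _ => .det

/-- The comparison of two words, given its outcome on the preceding symbols. -/
def compareStep {m : ℕ} (o : Option Bool) (a b : Fin m) : Option Bool :=
  match o with
  | some v => some v
  | none => if a < b then some true else if b < a then some false else none

open Classical in
-- All other variables are erased: after a call only the two arguments matter, because the game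
-- never comes back to the calling formula.
noncomputable def argCell (a b : Y.Sym) : Y.Cell :=
  Function.update (Function.update (fun _ => 0) Y.arg₁ a) Y.arg₂ b

open Classical in
noncomputable def mergeCell (g e : Y.Cell) : Y.Cell :=
  Function.update (Function.update e Y.arg₁ (g Y.arg₁)) Y.arg₂ (g Y.arg₂)

open Classical in
/-- A sweep treats the cell `g`. -/
noncomputable def sweepCell (op : Y.Op) (g : Y.Cell) (k : Option Y.GameSymbol) (p : Y.Pick) :
    Outcome Y.GameState Y.GameSymbol :=
  match op with
  | .guess x _ _ =>
    { state := .sweep op, L := .pop, R := .push (.cell (Function.update g x p.sym)) }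
  | .test o x y pol =>
    { state := .sweep (.test (compareStep o (g x) (g y)) x y pol), L := .pop, R := .push (.cell g) }
  | .call _ x y _ =>
    { state := .sweep op, L := .pop, R := .push (.cell (Y.argCell (g x) (g y))) }
  | .load _ _ =>
    match k with
    | some (.cell e) =>
      { state := .sweep op, L := .pop, R := .push (.cell (Y.mergeCell g e)), K := .pop }
    | _ => { state := .go (.verdict false) }
  | .block _ => { state := .sweep op, L := .pop, R := .push (.cell g), K := .push (.cell p.cell) }

def letter : InputSymbol α → Option α
  | .letter a => some a
  | _ => none

/-- Negation flips the polarity, a conjunction is replaced by one of its parts, and a relation is a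
tail call. Thus no return information is kept, and the blocks removed from the third stack are never
needed again in the same play. -/
noncomputable def evalTrans (φ : Form Y.Var Y.Kind) (pol : Bool) (p : Y.Pick) : Y.GameState :=
  match φ with
  | .fls => .go (.verdict !pol)
  | .rel k x y => .sweep (.call k x y pol)
  | .lt x y => .sweep (.test none x y pol)
  | .not φ => .go (.eval (Y.clip φ) !pol)
  | .and φ ψ => .go (.eval (Y.clip (if p.side then φ else ψ)) pol)
  | .ex x φ => .sweep (.guess x (Y.clip φ) pol)

/-- The first stack holds the current words, one letter for each variable in a cell, and the third
one the blocks of the lower levels. A sweep treats the cells one after the other while moving them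
to the second stack, and `back` returns them. -/
noncomputable def trans (q : Y.GameState) (s : InputSymbol α) (tl tr tk : Option Y.GameSymbol)
    (more : Bool) (p : Y.Pick) : Outcome Y.GameState Y.GameSymbol :=
  match q with
  | .go (.eval φ pol) => { state := Y.evalTrans φ.1 pol p }
  | .go (.enter k pol) =>
    match tl, tk with
    | none, _ => { state := .go (.verdict (Y.base k == pol)) }
    | some (.cell g), some (.hdr h a) =>
      { state := .sweep (.load (Y.clip (Y.rule k (g Y.arg₁) (g Y.arg₂) h a)) pol)
        L := .pop
        K := .pop }
    | _, _ => { state := .go (.verdict false) }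
  | .go (.header b) =>
    { state := .grow b
      move := if Y.reads p.hdr then .right else .stay
      K := .push (.hdr p.hdr (letter s)) }
  | .go (.verdict v) => { state := .go (.verdict v) }
  | .sweep op =>
    match tl with
    | some (.cell g) => Y.sweepCell op g tk p
    | _ => { state := .back op.finish }
  | .back t =>
    match tr with
    | some g => { state := .back t, L := .push g, R := .pop }
    | none => { state := .go t }
  | .setup b =>
    if more then { state := .sweep (.block b), adv := true }
    else { state := .go (.eval (Y.clip (Y.final b)) true) }
  -- Words get longer by one letter with each block; their content is irrelevant until the final
  -- formula, which starts with zeros.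
  | .grow b => { state := .setup b, L := .push (.cell fun _ => 0) }
  -- Leaves the left end marker, so that the head always stands on the next symbol to be read.
  | .begin b => { state := .setup b, move := .right }

/-- The machine with choices that evaluates the recursive relations: one player defends the truth of
a formula, the other one its falsity. -/
noncomputable abbrev game [Finite α] : ChoiceMachine α where
  State := Y.GameState
  Symbol := Y.GameSymbol
  finState := inferInstance
  finSymbol := inferInstance
  branch := Y.picks
  start := .begin
  status := Y.status
  trans := fun q s tl tr tk more a => Y.trans q s tl tr tk more (Y.pick a)

end System

end OfflineTM

/-! ### Values of the game during the sweeps. -/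

namespace OfflineTM

lemma ChoiceMachine.Val.mono {α : Type} {G : ChoiceMachine α} {w : List α} {S T n m : ℕ}
    {c : G.Config} {v : Bool} (h : G.Val w S T n c v) (hm : n ≤ m) : G.Val w S T m c v := by
  induction h generalizing m with
  | verdict hf h => exact .verdict hf h
  | det hf h _ ih => exact .det hf h (ih hm)
  | choose hf h _ ih =>
    obtain ⟨k, rfl⟩ := Nat.exists_eq_add_of_le' (show 1 ≤ m by omega)
    exact .choose hf h fun a => ih a (by omega)

lemma ChoiceMachine.Config.ext' {α : Type} {G : ChoiceMachine α} {c c' : G.Config}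
    (h1 : c.state = c'.state) (h2 : c.pos = c'.pos) (h3 : c.L = c'.L) (h4 : c.R = c'.R)
    (h5 : c.K = c'.K) (h6 : c.rem = c'.rem) (h7 : c.used = c'.used) : c = c' := by
  cases c; cases c'; simp_all

namespace System

variable {α : Type} {Y : System α}

/-- The part of a configuration that is not changed by a sweep. -/
structure Frame (w : List α) (T : ℕ) where
  pos : ℕ
  rem : ℕ
  used : ℕ
  pos_le : pos ≤ w.length + 1
  count : rem + used = T

variable {w : List α} {S T : ℕ}

def cells (l : List Y.Cell) : List Y.GameSymbol := l.map .cell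

@[simp] lemma length_cells (l : List Y.Cell) : (cells l).length = l.length := List.length_map _

variable [Finite α]

def cfg (F : Frame w T) (q : Y.GameState) (l r : List Y.Cell) (K : List Y.GameSymbol) :
    Y.game.Config :=
  ⟨q, F.pos, cells l, cells r, K, F.rem, F.used⟩

lemma cfg_fits (F : Frame w T) {q : Y.GameState} {l r : List Y.Cell} {K : List Y.GameSymbol}
    (h : l.length + r.length ≤ S) (hK : K.length ≤ S) : (cfg F q l r K).Fits w S T :=
  ⟨F.pos_le, (length_cells l).trans_le (by omega), (length_cells r).trans_le (by omega), hK,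
    F.count⟩

lemma next_cfg (F : Frame w T) {q q' : Y.GameState} {l r l' r' : List Y.Cell}
    {K K' : List Y.GameSymbol} {A B C : StackAct Y.GameSymbol} {a : Fin (Y.picks + 1)}
    (h : Y.trans q (Machine.inputAt w F.pos) (cells l).head? (cells r).head? K.head?
      (decide (0 < F.rem)) (Y.pick a) = { state := q', L := A, R := B, K := C })
    (hA : A.apply (cells l) = cells l') (hB : B.apply (cells r) = cells r')
    (hC : C.apply K = K') :
    Y.game.next w (cfg F q l r K) a = cfg F q' l' r' K' := by
  have h' : Y.game.outcome w (cfg F q l r K) a = { state := q', L := A, R := B, K := C } := h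
  rw [ChoiceMachine.next, h']
  exact ChoiceMachine.Config.ext' rfl (min_eq_left F.pos_le) hA hB hC rfl rfl

lemma val_det (F : Frame w T) {n : ℕ} {q q' : Y.GameState} {l r l' r' : List Y.Cell} {v : Bool}
    {K K' : List Y.GameSymbol} {A B C : StackAct Y.GameSymbol} (hs : Y.status q = .det)
    (hl : l.length + r.length ≤ S) (hK : K.length ≤ S)
    (h : ∀ p, Y.trans q (Machine.inputAt w F.pos) (cells l).head? (cells r).head? K.head?
      (decide (0 < F.rem)) p = { state := q', L := A, R := B, K := C })
    (hA : A.apply (cells l) = cells l') (hB : B.apply (cells r) = cells r')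
    (hC : C.apply K = K') (hv : Y.game.Val w S T n (cfg F q' l' r' K') v) :
    Y.game.Val w S T n (cfg F q l r K) v := by
  refine .det (cfg_fits F hl hK) hs ?_
  rw [next_cfg F (h _) hA hB hC]
  exact hv

open Classical in
-- One statement serves both players: if `pol` is false, the options have the negated values and the
-- choice is universal, which gives the negation of the existential statement.
lemma val_choose (F : Frame w T) {n : ℕ} {q : Y.GameState} {l r : List Y.Cell} {pol : Bool}
    {K : List Y.GameSymbol} (hs : Y.status q = .choose pol)
    (hl : l.length + r.length ≤ S) (hK : K.length ≤ S) (P : Y.Pick → Prop)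
    (h : ∀ a, Y.game.Val w S T n (Y.game.next w (cfg F q l r K) a) (decide (P (Y.pick a)) == pol)) :
    Y.game.Val w S T (n + 1) (cfg F q l r K) (decide (∃ p, P p) == pol) := by
  have := ChoiceMachine.Val.choose (cfg_fits F hl hK) hs h
  convert this using 1
  rw [Bool.eq_iff_iff]
  cases pol <;> simp [Y.pick_surjective.exists]

lemma val_back (F : Frame w T) {n : ℕ} {t : Y.Goal} {l r : List Y.Cell} {K : List Y.GameSymbol}
    {v : Bool} (hl : l.length + r.length ≤ S) (hK : K.length ≤ S)
    (h : Y.game.Val w S T n (cfg F (.go t) (r.reverse ++ l) [] K) v) :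
    Y.game.Val w S T n (cfg F (.back t) l r K) v := by
  induction r generalizing l with
  | nil => exact val_det F rfl hl hK (fun p => rfl) rfl rfl rfl h
  | cons g r ih =>
    refine val_det F (A := .push (.cell g)) (l' := g :: l) (B := .pop) (r' := r) rfl hl hK
      (fun p => rfl) rfl rfl rfl (ih ?_ ?_)
    · simp at hl ⊢; omega
    · simpa using h

/-- The result of replacing a track of a list of cells by a word. -/
noncomputable def setTrack (x : Y.Var) (l : List Y.Cell) (u : List Y.Sym) : List Y.Cell :=
  open Classical in List.zipWith (fun g s => Function.update g x s) l u

open Classical in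
-- A quantifier over words is a sequence of choices of letters by the same player. The extra choice
-- in the budget is a dummy one at the end of the list, where the state still belongs to a player.
lemma val_guess (F : Frame w T) {n : ℕ} {x : Y.Var} {φ : Y.formulas} {pol : Bool}
    {l r : List Y.Cell} {K : List Y.GameSymbol} (hl : l.length + r.length ≤ S) (hK : K.length ≤ S)
    (P : List Y.Sym → Prop)
    (h : ∀ u : List Y.Sym, u.length = l.length → Y.game.Val w S T n
      (cfg F (.go (.eval φ pol)) (r.reverse ++ setTrack x l u) [] K) (decide (P u) == pol)) :
    Y.game.Val w S T (n + l.length + 1) (cfg F (.sweep (.guess x φ pol)) l r K)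
      (decide (∃ u, u.length = l.length ∧ P u) == pol) := by
  induction l generalizing r P with
  | nil =>
    -- The dummy choice: the statement does not depend on the pick, and picks exist.
    have e : (∃ u : List Y.Sym, u.length = ([] : List Y.Cell).length ∧ P u) ↔
        ∃ _p : Y.Pick, P [] := by
      simp only [List.length_nil, List.length_eq_zero_iff, exists_eq_left, exists_const_iff]
      exact ⟨fun h => ⟨⟨⟨true, 0, fun _ => 0, Y.hdr⟩⟩, h⟩, fun h => h.2⟩
    simp only [e]
    refine val_choose F (by rfl) hl hK (fun _ => P []) fun a => ?_
    rw [next_cfg F (q' := .back (.eval φ pol)) (A := .keep) (B := .keep) (C := .keep) rfl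
      (l' := []) rfl (r' := r) rfl (K' := K) rfl]
    refine val_back F hl hK ?_
    simpa [setTrack] using h [] rfl
  | cons g l ih =>
    have e : (∃ u : List Y.Sym, u.length = (g :: l).length ∧ P u) ↔
        ∃ p : Y.Pick, ∃ u, u.length = l.length ∧ P (p.sym :: u) := by
      constructor
      · rintro ⟨_ | ⟨s, u⟩, h1, h2⟩
        · simp at h1
        · exact ⟨⟨true, s, fun _ => 0, Y.hdr⟩, u, by simpa using h1, h2⟩
      · rintro ⟨p, u, h1, h2⟩
        exact ⟨p.sym :: u, by simpa using h1, h2⟩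
    simp only [e]
    refine val_choose (n := n + l.length + 1) (q := .sweep (.guess x φ pol)) F rfl hl hK
      (fun p => ∃ u, u.length = l.length ∧ P (p.sym :: u)) fun a => ?_
    rw [next_cfg F (q' := .sweep (.guess x φ pol)) (A := .pop)
      (B := .push (.cell (Function.update g x (Y.pick a).sym))) (C := .keep) rfl
      (l' := l) rfl (r' := Function.update g x (Y.pick a).sym :: r) rfl rfl]
    refine ih (by simp at hl ⊢; omega) (fun u => P ((Y.pick a).sym :: u)) fun u hu => ?_
    simpa [setTrack] using h ((Y.pick a).sym :: u) (by simpa using hu)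

open Classical in
-- The first difference decides a lexicographic comparison; `o` remembers it. If there is none, the
-- words are equal and the default is `false`.
lemma val_test (F : Frame w T) {n : ℕ} {o : Option Bool} {x y : Y.Var} {pol : Bool}
    {l r : List Y.Cell} {K : List Y.GameSymbol} (hl : l.length + r.length ≤ S) (hK : K.length ≤ S) :
    Y.game.Val w S T n (cfg F (.sweep (.test o x y pol)) l r K)
      (o.getD (decide (Y.track l x < Y.track l y)) == pol) := by
  induction l generalizing r o with
  | nil =>
    refine val_det F rfl hl hK (fun p => rfl) (l' := []) rfl (r' := r) rfl (K' := K) rfl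
      (val_back F hl hK (.verdict (cfg_fits F (by simpa using hl) hK) ?_))
    cases o <;> rfl
  | cons g l ih =>
    refine val_det F rfl hl hK (fun p => rfl) (l' := l) rfl (r' := g :: r) rfl rfl ?_
    have : o.getD (decide (Y.track (g :: l) x < Y.track (g :: l) y)) =
        (compareStep o (g x) (g y)).getD (decide (Y.track l x < Y.track l y)) := by
      cases o with
      | some v => rfl
      | none =>
        simp only [track, List.map_cons, List.cons_lt_cons_iff, Option.getD_none, compareStep]
        rcases lt_trichotomy (g x) (g y) with h | h | h
        · simp [h]
        · simp [h]
          rfl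
        · simp [h, h.not_gt, h.ne']
    rw [this]
    exact ih (by simp at hl ⊢; omega)

lemma val_call (F : Frame w T) {n : ℕ} {k : Y.Kind} {x y : Y.Var} {pol v : Bool}
    {l r : List Y.Cell} {K : List Y.GameSymbol} (hl : l.length + r.length ≤ S) (hK : K.length ≤ S)
    (h : Y.game.Val w S T n (cfg F (.go (.enter k pol))
      (r.reverse ++ l.map fun g => Y.argCell (g x) (g y)) [] K) v) :
    Y.game.Val w S T n (cfg F (.sweep (.call k x y pol)) l r K) v := by
  induction l generalizing r with
  | nil =>
    exact val_det F rfl hl hK (fun p => rfl) (l' := []) rfl (r' := r) rfl (K' := K) rfl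
      (val_back F hl hK (by simpa [Op.finish] using h))
  | cons g l ih =>
    exact val_det F rfl hl hK (fun p => rfl) (l' := l) rfl (r' := Y.argCell (g x) (g y) :: r)
      rfl rfl (ih (by simp at hl ⊢; omega) (by simpa using h))

lemma val_load (F : Frame w T) {n : ℕ} {φ : Y.formulas} {pol v : Bool}
    {l r e : List Y.Cell} {K : List Y.GameSymbol} (hl : l.length + r.length ≤ S)
    (he : e.length = l.length) (hK : (cells e ++ K).length ≤ S)
    (h : Y.game.Val w S T n (cfg F (.go (.eval φ pol))
      (r.reverse ++ List.zipWith Y.mergeCell l e) [] K) v) :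
    Y.game.Val w S T n (cfg F (.sweep (.load φ pol)) l r (cells e ++ K)) v := by
  induction l generalizing r e with
  | nil =>
    obtain rfl : e = [] := by simpa using he
    exact val_det F rfl hl hK (fun p => rfl) (l' := []) rfl (r' := r) rfl (K' := K) rfl
      (val_back F hl hK (by simpa [Op.finish] using h))
  | cons g l ih =>
    obtain _ | ⟨f, e⟩ := e
    · simp at he
    exact val_det F rfl hl hK (fun p => rfl) (l' := l) rfl (r' := Y.mergeCell g f :: r)
      rfl rfl (ih (by simp at hl ⊢; omega) (by simpa using he) (by simp at hK ⊢; omega)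
        (by simpa using h))

open Classical in
-- As in `val_guess`, but the chosen cells are pushed on the third stack, where they end up in
-- reverse order.
lemma val_block (F : Frame w T) {n : ℕ} {b : Bool}
    {l r : List Y.Cell} {K : List Y.GameSymbol} (hl : l.length + r.length ≤ S)
    (hK : K.length + l.length ≤ S) (P : List Y.Cell → Prop)
    (h : ∀ e : List Y.Cell, e.length = l.length → Y.game.Val w S T n
      (cfg F (.go (.header b)) (r.reverse ++ l) [] (cells e.reverse ++ K)) (decide (P e) == true)) :
    Y.game.Val w S T (n + l.length + 1) (cfg F (.sweep (.block b)) l r K)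
      (decide (∃ e, e.length = l.length ∧ P e) == true) := by
  induction l generalizing r K P with
  | nil =>
    have e : (∃ u : List Y.Cell, u.length = ([] : List Y.Cell).length ∧ P u) ↔
        ∃ _p : Y.Pick, P [] := by
      simp only [List.length_nil, List.length_eq_zero_iff, exists_eq_left, exists_const_iff]
      exact ⟨fun h => ⟨⟨⟨true, 0, fun _ => 0, Y.hdr⟩⟩, h⟩, fun h => h.2⟩
    simp only [e]
    refine val_choose F (by rfl) hl hK (fun _ => P []) fun a => ?_
    rw [next_cfg F (q' := .back (.header b)) (A := .keep) (B := .keep) (C := .keep) rfl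
      (l' := []) rfl (r' := r) rfl (K' := K) rfl]
    refine val_back F hl hK ?_
    simpa [cells] using h [] rfl
  | cons g l ih =>
    have e : (∃ u : List Y.Cell, u.length = (g :: l).length ∧ P u) ↔
        ∃ p : Y.Pick, ∃ u, u.length = l.length ∧ P (p.cell :: u) := by
      constructor
      · rintro ⟨_ | ⟨s, u⟩, h1, h2⟩
        · simp at h1
        · exact ⟨⟨true, 0, s, Y.hdr⟩, u, by simpa using h1, h2⟩
      · rintro ⟨p, u, h1, h2⟩
        exact ⟨p.cell :: u, by simpa using h1, h2⟩
    simp only [e]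
    refine val_choose (n := n + l.length + 1) (q := .sweep (.block b)) (K := K) F rfl hl (by omega)
      (fun p => ∃ u, u.length = l.length ∧ P (p.cell :: u)) fun a => ?_
    rw [next_cfg F (q' := .sweep (.block b)) (A := .pop)
      (B := .push (.cell g)) (C := .push (.cell (Y.pick a).cell)) rfl
      (l' := l) rfl (r' := g :: r) rfl
      (K' := .cell (Y.pick a).cell :: K) rfl]
    refine ih (by simp at hl ⊢; omega) (by simp at hK ⊢; omega)
      (fun u => P ((Y.pick a).cell :: u)) fun u hu => ?_
    simpa [cells] using h ((Y.pick a).cell :: u) (by simpa using hu)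

end System

end OfflineTM

/-! ### The value of the game for a formula, by recursion on the blocks. -/

namespace OfflineTM

namespace System

variable {α : Type} {Y : System α}

/-- The content of the third stack. -/
def encode : List Y.Block → List Y.GameSymbol
  | [] => []
  | c :: B => .hdr c.hdr c.letter :: (cells c.cells ++ encode B)

def Sized : List Y.Block → Prop
  | [] => True
  | c :: B => c.cells.length = B.length ∧ Sized B

lemma Valid.sized {w : List α} {B : List Y.Block} (h : Y.Valid w B) : Sized B := by
  induction B with
  | nil => trivial
  | cons c B ih => exact ⟨h.2.1, ih h.2.2⟩

lemma Valid.of_append {w : List α} {B B' : List Y.Block} (h : Y.Valid w (B' ++ B)) :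
    Y.Valid w B := by
  induction B' with
  | nil => exact h
  | cons c B' ih => exact ih h.2.2

/-- The block above `i` others takes `i + 1` symbols; this sum is the reason for the quadratic space
bound on the third stack. -/
lemma length_encode {B : List Y.Block} (h : Sized B) : (encode B).length ≤ B.length ^ 2 := by
  induction B with
  | nil => simp [encode]
  | cons c B ih =>
    have := ih h.2
    have := h.1
    simp only [encode, List.length_cons, List.length_append, length_cells]
    nlinarith

open Classical in
lemma track_setTrack (x : Y.Var) (l : List Y.Cell) (u : List Y.Sym) (h : u.length = l.length) :
    Y.track (setTrack x l u) = Function.update (Y.track l) x u := by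
  funext v
  by_cases hv : v = x
  · subst hv
    rw [Function.update_self]
    apply List.ext_getElem
    · simp [track, setTrack, h]
    · intro i h1 h2
      simp [track, setTrack]
  · rw [Function.update_of_ne hv]
    apply List.ext_getElem
    · simp [track, setTrack, h]
    · intro i h1 h2
      simp [track, setTrack, hv]

/-- The sweeps `call` and `load` together produce exactly the assignment with which `Rel` evaluates
the rule one level below. -/
lemma track_merge (x y : Y.Var) (l e : List Y.Cell) (h : e.length = l.length) :
    Y.track (List.zipWith Y.mergeCell (l.map fun g => Y.argCell (g x) (g y)) e) =
      Y.env e (Y.track l x) (Y.track l y) := by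
  have hne := Y.arg_ne
  funext v
  apply List.ext_getElem
  · by_cases h2 : v = Y.arg₂
    · simp [track, env, h, h2]
    · by_cases h1 : v = Y.arg₁
      · simp [track, env, h, h1, hne]
      · simp [track, env, h, h1, h2]
  · intro i h1 h2
    by_cases h2 : v = Y.arg₂
    · simp [track, env, h2, mergeCell, argCell]
    · by_cases h1 : v = Y.arg₁
      · simp [track, env, h1, hne, mergeCell, argCell]
      · simp [track, env, h1, h2, mergeCell]

variable [Finite α] {w : List α} {S T : ℕ}

lemma val_enter (F : Frame w T) {n : ℕ} {k : Y.Kind} {x y : Y.Var} {pol v : Bool} {g : Y.Cell}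
    {l : List Y.Cell} {c : Y.Block} {B : List Y.Block} (hl : l.length + 1 ≤ S)
    (hK : (encode (c :: B)).length ≤ S) (hc : c.cells.length = l.length)
    (h : Y.game.Val w S T n (cfg F (.go (.eval (Y.clip (Y.rule k (g x) (g y) c.hdr c.letter)) pol))
      (List.zipWith Y.mergeCell (l.map fun g => Y.argCell (g x) (g y)) c.cells) [] (encode B)) v) :
    Y.game.Val w S T n (cfg F (.go (.enter k pol))
      (Y.argCell (g x) (g y) :: l.map fun g => Y.argCell (g x) (g y)) [] (encode (c :: B))) v := by
  have hx : Y.argCell (g x) (g y) Y.arg₁ = g x := by simp [argCell, Y.arg_ne]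
  have hy : Y.argCell (g x) (g y) Y.arg₂ = g y := by simp [argCell]
  refine val_det F (q' := .sweep (.load (Y.clip (Y.rule k (g x) (g y) c.hdr c.letter)) pol))
    (l' := l.map fun g => Y.argCell (g x) (g y)) (r' := []) (K' := cells c.cells ++ encode B)
    (A := .pop) (B := .keep) (C := .pop) rfl (by simpa using hl) hK (fun p => ?_) rfl rfl rfl ?_
  · simp [trans, encode, cells, hx, hy]
  · refine val_load F (by simp; omega) (by simpa using hc) ?_ (by simpa using h)
    simp [encode] at hK ⊢
    omega

open Classical in
-- The evaluation at one level, relative to the games for atomic relations, which take at most `D`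
-- choices. A quantifier costs `n + 1` choices and a conjunction one, so `n + 2` for each symbol of
-- the formula suffices.
lemma val_formula (F : Frame w T) {n D : ℕ} {R : Y.Kind → List Y.Sym → List Y.Sym → Prop}
    {K : List Y.GameSymbol} (hS : n ≤ S) (hK : K.length ≤ S)
    (hrel : ∀ k x y pol l, l.length = n → Y.game.Val w S T D
      (cfg F (.sweep (.call k x y pol)) l [] K) (decide (R k (Y.track l x) (Y.track l y)) == pol))
    (φ : Form Y.Var Y.Kind) (hφ : φ.subs ⊆ Y.formulas) (pol : Bool) (l : List Y.Cell)
    (hl : l.length = n) :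
    Y.game.Val w S T (φ.size * (n + 2) + D) (cfg F (.go (.eval (Y.clip φ) pol)) l [] K)
      (decide (φ.Holds n R (Y.track l)) == pol) := by
  have hl' : l.length + ([] : List Y.Cell).length ≤ S := by simpa [hl] using hS
  have hc : (Y.clip φ).1 = φ := Y.clip_val (hφ φ.mem_subs)
  induction φ generalizing pol l with
  | rel k x y =>
    refine val_det F (q' := .sweep (.call k x y pol)) (l' := l) (r' := []) (K' := K)
      (A := .keep) (B := .keep) (C := .keep) ?_ hl' hK (fun p => ?_) rfl rfl rfl
      ((hrel k x y pol l hl).mono (by omega))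
    · simp [status, hc]
    · simp [trans, evalTrans, hc]
  | lt x y =>
    refine val_det F (q' := .sweep (.test none x y pol)) (l' := l) (r' := []) (K' := K)
      (A := .keep) (B := .keep) (C := .keep) ?_ hl' hK (fun p => ?_) rfl rfl rfl
      ?_
    · simp [status, hc]
    · simp [trans, evalTrans, hc]
    · convert val_test F (o := none) (x := x) (y := y) (pol := pol) hl' hK using 1
      exact congrArg (· == pol) (decide_eq_decide.mpr Iff.rfl)
  | fls =>
    refine val_det F (q' := .go (.verdict !pol)) (l' := l) (r' := []) (K' := K)
      (A := .keep) (B := .keep) (C := .keep) ?_ hl' hK (fun p => ?_) rfl rfl rfl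
      (.verdict (cfg_fits F hl' hK) ?_)
    · simp [status, hc]
    · simp [trans, evalTrans, hc]
    · rw [decide_eq_false (show ¬ Form.fls.Holds n R (Y.track l) from id)]
      cases pol <;> rfl
  | not φ ih =>
    have hsub : φ.subs ⊆ Y.formulas := (Set.subset_insert _ _).trans hφ
    have := ih hsub (!pol) l hl hl' (Y.clip_val (hsub φ.mem_subs))
    refine val_det F (q' := .go (.eval (Y.clip φ) !pol)) (l' := l) (r' := []) (K' := K)
      (A := .keep) (B := .keep) (C := .keep) ?_ hl' hK (fun p => ?_) rfl rfl rfl ?_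
    · simp [status, hc]
    · simp [trans, evalTrans, hc]
    · convert this.mono (m := (Form.not φ).size * (n + 2) + D) ?_ using 1
      · simp only [Form.Holds]
        by_cases h : φ.Holds n R (Y.track l) <;> cases pol <;> simp [h]
      · simp only [Form.size]
        nlinarith
  | and φ ψ ih₁ ih₂ =>
    have hsub : φ.subs ∪ ψ.subs ⊆ Y.formulas := (Set.subset_insert _ _).trans hφ
    have hsub₁ : φ.subs ⊆ Y.formulas := Set.subset_union_left.trans hsub
    have hsub₂ : ψ.subs ⊆ Y.formulas := Set.subset_union_right.trans hsub
    have h₁ := ih₁ hsub₁ pol l hl hl' (Y.clip_val (hsub₁ φ.mem_subs))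
    have h₂ := ih₂ hsub₂ pol l hl hl' (Y.clip_val (hsub₂ ψ.mem_subs))
    -- A conjunction is the negation of "some part fails", so `val_choose` applies with the opposite
    -- polarity.
    have key := val_choose (n := φ.size * (n + 2) + ψ.size * (n + 2) + D) F
      (q := .go (.eval (Y.clip (.and φ ψ)) pol)) (pol := !pol) (l := l) (r := []) (K := K)
      (by simp [status, hc]) hl' hK
      (fun p => ¬ (if p.side then φ else ψ).Holds n R (Y.track l)) fun a => ?_
    · convert key.mono (m := (Form.and φ ψ).size * (n + 2) + D) ?_ using 1
      · have : (∃ p : Y.Pick, ¬ (if p.side then φ else ψ).Holds n R (Y.track l)) ↔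
            ¬ (φ.and ψ).Holds n R (Y.track l) := by
          simp only [Form.Holds, not_and_or]
          constructor
          · rintro ⟨⟨_ | _, _, _, _⟩, h⟩
            · exact Or.inr (by simpa using h)
            · exact Or.inl (by simpa using h)
          · rintro (h | h)
            · exact ⟨⟨true, 0, fun _ => 0, Y.hdr⟩, by simpa using h⟩
            · exact ⟨⟨false, 0, fun _ => 0, Y.hdr⟩, by simpa using h⟩
        simp only [this]
        rw [Bool.eq_iff_iff]
        cases pol <;> simp
      · simp only [Form.size]
        nlinarith
    · rw [next_cfg F (q' := .go (.eval (Y.clip (if (Y.pick a).side then φ else ψ)) pol))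
        (A := .keep) (B := .keep) (C := .keep) (by simp [trans, evalTrans, hc])
        (l' := l) rfl (r' := []) rfl (K' := K) rfl]
      cases (Y.pick a).side
      · convert h₂.mono (m := φ.size * (n + 2) + ψ.size * (n + 2) + D) (by omega) using 1
        · simp
        · rw [Bool.eq_iff_iff]
          cases pol <;> simp
      · convert h₁.mono (m := φ.size * (n + 2) + ψ.size * (n + 2) + D) (by omega) using 1
        · simp
        · rw [Bool.eq_iff_iff]
          cases pol <;> simp
  | ex x φ ih =>
    have hsub : φ.subs ⊆ Y.formulas := (Set.subset_insert _ _).trans hφ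
    refine val_det F (q' := .sweep (.guess x (Y.clip φ) pol)) (l' := l) (r' := []) (K' := K)
      (A := .keep) (B := .keep) (C := .keep) ?_ hl' hK (fun p => ?_) rfl rfl rfl ?_
    · simp [status, hc]
    · simp [trans, evalTrans, hc]
    · have key := val_guess F (n := φ.size * (n + 2) + D) (x := x) (φ := Y.clip φ) (pol := pol) hl' hK
        (fun u => φ.Holds n R (Function.update (Y.track l) x u)) fun u hu => ?_
      · rw [hl] at key
        exact key.mono (by simp only [Form.size]; nlinarith)
      · have hlen : (setTrack x l u).length = n := by simp [setTrack, hu, hl]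
        have := ih hsub pol (setTrack x l u) hlen (by simpa [hlen] using hS)
          (Y.clip_val (hsub φ.mem_subs))
        rwa [track_setTrack x l u hu] at this

open Classical in
/-- The game for a formula has the right value. -/
theorem val_eval (F : Frame w T) {M : ℕ} (hM : ∀ φ ∈ Y.formulas, φ.size ≤ M) (B : List Y.Block)
    (hB : Sized B) (hS : B.length ≤ S) (hK : (encode B).length ≤ S) (φ : Form Y.Var Y.Kind)
    (hφ : φ.subs ⊆ Y.formulas) (pol : Bool) (l : List Y.Cell) (hl : l.length = B.length) :
    Y.game.Val w S T (φ.size * (B.length + 2) + M * (B.length + 1) ^ 2)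
      (cfg F (.go (.eval (Y.clip φ) pol)) l [] (encode B))
      (decide (φ.Holds B.length (Y.Rel B) (Y.track l)) == pol) := by
  induction B generalizing φ pol l with
  | nil =>
    refine val_formula F hS hK (fun k x y pol l hl => ?_) φ hφ pol l hl
    obtain rfl : l = [] := List.eq_nil_of_length_eq_zero hl
    refine val_call F (by simp) hK (val_det F (q' := .go (.verdict (Y.base k == pol))) (l' := [])
      (r' := []) (K' := []) (A := .keep) (B := .keep) (C := .keep) rfl (by simp) hK (fun p => rfl)
      rfl rfl rfl (.verdict (cfg_fits F (by simp) hK) ?_))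
    change Status.verdict _ = Status.verdict _
    congr 1
    rw [Bool.eq_iff_iff]
    cases pol <;> cases h : Y.base k <;> simp [Rel, h]
  | cons c B ih =>
    refine val_formula F hS hK (fun k x y pol l hl => ?_) φ hφ pol l hl
    obtain _ | ⟨g, l⟩ := l
    · simp at hl
    have hl' : l.length = B.length := by simpa using hl
    have hcl : c.cells.length = l.length := by rw [hl', hB.1]
    have hSl : l.length + 1 ≤ S := by simpa [hl'] using hS
    have hsub := Y.rule_subs k (g x) (g y) c.hdr c.letter
    refine val_call F (by simpa using hSl) hK (val_enter F hSl hK hcl ?_)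
    have key := ih hB.2 (by omega) (by simp [encode] at hK; omega) _ hsub pol
      (List.zipWith Y.mergeCell (l.map fun g => Y.argCell (g x) (g y)) c.cells)
      (by simp [hcl, hl'])
    rw [track_merge x y l c.cells hcl] at key
    -- With `b` blocks below, the rule costs at most `M * (b + 2)` choices and the lower levels `M *
    -- (b + 1) ^ 2`; the sum is at most `M * (b + 2) ^ 2`.
    refine key.mono ?_
    have := hM _ (hsub (Form.mem_subs _))
    simp only [List.length_cons]
    nlinarith

end System

end OfflineTM

/-! ### The choice of the blocks, and the value of the whole game. -/

namespace OfflineTM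

namespace System

variable {α : Type} {Y : System α} 

/-- The head is one cell ahead of the number of symbols read. When the input is exhausted it stays
on the right end marker while the count may go on, and both sides are `none`. -/
lemma letter_inputAt (w : List α) (i : ℕ) :
    letter (Machine.inputAt w (min (i + 1) (w.length + 1))) = w[i]? := by
  rw [Nat.add_min_add_right]
  simp only [Machine.inputAt]
  rcases Nat.lt_or_ge i w.length with h | h
  · rw [min_eq_left h.le, List.getElem?_eq_getElem h]
    rfl
  · rw [min_eq_right h, List.getElem?_eq_none le_rfl, List.getElem?_eq_none h]
    rfl

variable [Finite α] {w : List α} {S T : ℕ}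

open Classical in
/-- The game that chooses the remaining blocks has the right value. -/
lemma val_setup {M : ℕ} (hM : ∀ φ ∈ Y.formulas, φ.size ≤ M) (b : Bool) (hT : T ≤ S)
    (hT' : T ^ 2 ≤ S) (r : ℕ) (F : Frame w T) (hr : F.rem = r) (B : List Y.Block)
    (hB : B.length = F.used) (hv : Y.Valid w B)
    (hpos : F.pos = min (Y.position B + 1) (w.length + 1)) :
    Y.game.Val w S T (r * (T + 3) + ((Y.final b).size * (T + 2) + M * (T + 1) ^ 2))
      (cfg F (.setup b) (List.replicate B.length fun _ => 0) [] (encode B))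
      (decide (∃ B', B'.length = r ∧ Y.Valid w (B' ++ B) ∧
        (Y.final b).Holds T (Y.Rel (B' ++ B)) fun _ => List.replicate T 0)) := by
  induction r generalizing F B with
  | zero =>
    have hBT : B.length = T := by have := F.count; omega
    have hK : (encode B).length ≤ S := (length_encode hv.sized).trans (by rwa [hBT])
    refine val_det F (q' := .go (.eval (Y.clip (Y.final b)) true))
      (l' := List.replicate B.length fun _ => 0) (r' := []) (K' := encode B)
      (A := .keep) (B := .keep) (C := .keep) rfl (by simp; omega) hK (fun p => ?_) rfl rfl rfl ?_
    · simp [trans, hr]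
    · have key := val_eval F hM B hv.sized (by omega) hK (Y.final b) (Y.final_subs b) true
        (List.replicate B.length fun _ => 0) (by simp)
      convert key.mono (m := 0 * (T + 3) + ((Y.final b).size * (T + 2) + M * (T + 1) ^ 2)) ?_ using 1
      · rw [Bool.eq_iff_iff]
        simp only [beq_true, decide_eq_true_eq]
        have : Y.track (List.replicate B.length fun _ => 0) = fun _ => List.replicate T 0 := by
          funext v
          simp [track, hBT]
        rw [this, hBT]
        constructor
        · rintro ⟨B', h1, h2, h3⟩
          obtain rfl : B' = [] := List.eq_nil_of_length_eq_zero h1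
          exact h3
        · exact fun h => ⟨[], rfl, hv, h⟩
      · rw [hBT]; omega
  | succ r ih =>
    have hcount := F.count
    have hBT : B.length + r + 1 = T := by omega
    have hKB := length_encode hv.sized
    have hKS : (B.length + 1) ^ 2 ≤ S := (Nat.pow_le_pow_left (by omega) 2).trans hT'
    have hKS' : (encode B).length + B.length + 1 ≤ S := by nlinarith
    let F₁ : Frame w T := ⟨F.pos, r, F.used + 1, F.pos_le, by omega⟩
    have e₁ : Y.game.next w (cfg F (.setup b) (List.replicate B.length fun _ => 0) [] (encode B)) 0 =
        cfg F₁ (.sweep (.block b)) (List.replicate B.length fun _ => 0) [] (encode B) := by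
      have h' : Y.game.outcome w
          (cfg F (.setup b) (List.replicate B.length fun _ => 0) [] (encode B)) 0 =
          { state := .sweep (.block b), adv := true } := by
        simp [ChoiceMachine.outcome, trans, cfg, hr]
      rw [ChoiceMachine.next, h']
      have hpos : 0 < F.rem := by omega
      refine ChoiceMachine.Config.ext' rfl (min_eq_left F.pos_le) rfl rfl rfl ?_ ?_
      · simp [cfg, F₁, hr]
      · simp [cfg, hpos, F₁]
    refine .det (cfg_fits F (by simp; omega) (by omega)) rfl ?_
    rw [e₁]
    let Q : Y.Block → Prop := fun c => ∃ B', B'.length = r ∧ Y.Valid w (B' ++ c :: B) ∧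
        (Y.final b).Holds T (Y.Rel (B' ++ c :: B)) fun _ => List.replicate T 0
    -- Choosing a block means choosing its cells, which are stacked in reverse, and then its header,
    -- for which one choice is reserved; the input symbol is determined.
    have key := val_block (S := S) (n := r * (T + 3) + ((Y.final b).size * (T + 2) + M * (T + 1) ^ 2) + 1)
      F₁ (b := b) (l := List.replicate B.length fun _ => 0) (r := []) (K := encode B)
      (by simp; omega) (by simp; omega)
      (fun e => ∃ p : Y.Pick, Q ⟨p.hdr, w[Y.position B]?, e.reverse⟩) fun e he => ?_
    · convert key.mono
        (m := (r + 1) * (T + 3) + ((Y.final b).size * (T + 2) + M * (T + 1) ^ 2)) ?_ using 1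
      · rw [Bool.eq_iff_iff]
        simp only [beq_true, decide_eq_true_eq, List.length_replicate]
        constructor
        -- Later blocks are put in front, so the block that is chosen now is the last entry of `B'`.
        · rintro ⟨B', h1, h2, h3⟩
          obtain ⟨B'', c, rfl⟩ : ∃ B'' c, B' = B'' ++ [c] :=
            (List.eq_nil_or_concat' B').resolve_left (by rintro rfl; simp at h1)
          rw [List.append_assoc, List.singleton_append] at h2 h3
          obtain ⟨h4, h5, -⟩ := h2.of_append
          refine ⟨c.cells.reverse, by simpa using h5, ⟨true, 0, fun _ => 0, c.hdr⟩, B'',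
            by simpa using h1, ?_⟩
          rw [List.reverse_reverse, ← h4]
          exact ⟨h2, h3⟩
        · rintro ⟨e, h1, p, B'', h2, h3, h4⟩
          refine ⟨B'' ++ [⟨p.hdr, w[Y.position B]?, e.reverse⟩], by simp [h2], ?_⟩
          rw [List.append_assoc, List.singleton_append]
          exact ⟨h3, h4⟩
      · simp only [List.length_replicate]
        nlinarith
    · have he' : e.length = B.length := by simpa using he
      refine val_choose F₁ rfl ?_ ?_
        (fun p => Q ⟨p.hdr, w[Y.position B]?, e.reverse⟩) fun a => ?_
      · simp; omega
      · simp; omega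
      set c : Y.Block := ⟨(Y.pick a).hdr, w[Y.position B]?, e.reverse⟩ with hc
      have hvc : Y.Valid w (c :: B) := ⟨rfl, by simp [hc, he'], hv⟩
      let F₂ : Frame w T := ⟨min (Y.position (c :: B) + 1) (w.length + 1), r, F.used + 1,
        min_le_right _ _, by omega⟩
      have e₂ : Y.game.next w (cfg F₁ (.go (.header b))
          (([] : List Y.Cell).reverse ++ List.replicate B.length fun _ => 0) []
          (cells e.reverse ++ encode B)) a =
          cfg F₂ (.grow b) (List.replicate B.length fun _ => 0) [] (encode (c :: B)) := by
        refine ChoiceMachine.Config.ext' rfl ?_ rfl rfl ?_ rfl rfl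
        · change min (Move.apply (if Y.reads (Y.pick a).hdr then .right else .stay) F.pos)
            (w.length + 1) = min (Y.position (c :: B) + 1) (w.length + 1)
          rw [hpos]
          simp only [position, hc]
          split_ifs
          · simp only [Move.apply]; omega
          · simp only [Move.apply]; omega
        · change GameSymbol.hdr (Y.pick a).hdr (letter (Machine.inputAt w F.pos)) :: _ = _
          rw [hpos, letter_inputAt]
          rfl
      rw [e₂]
      have key := ih F₂ rfl (c :: B) (by simp [F₂, hB]) hvc rfl
      have hKc : (encode (c :: B)).length ≤ S :=
        (length_encode hvc.sized).trans (by simpa using hKS)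
      refine val_det F₂ (q' := .setup b) (l' := List.replicate (B.length + 1) fun _ => 0)
        (r' := []) (K' := encode (c :: B))
        (A := .push (.cell fun _ => 0)) (B := .keep) (C := .keep) rfl (by simp; omega) hKc
        (fun p => rfl) ?_ rfl rfl ?_
      · simp [StackAct.apply, cells, List.replicate_succ]
      · rw [List.length_cons] at key
        convert key using 1
        rw [Bool.eq_iff_iff]
        simp [Q]

open Classical in
/-- The two games of the machine with choices have the right values. -/
theorem val_game {M : ℕ} (hM : ∀ φ ∈ Y.formulas, φ.size ≤ M) (w : List α) (b : Bool) (T : ℕ) :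
    Y.game.Val w ((3 * M + 4) * (T + 1) ^ 2) T ((3 * M + 4) * (T + 1) ^ 2) (Y.game.init b T)
      (decide (Y.Value w b T)) := by
  -- The situation after `begin`: the head is at position `1`, and no token has been used.
  let F : Frame w T := ⟨1, T, 0, by omega, rfl⟩
  have h1 : (T + 1) ^ 2 ≤ (3 * M + 4) * (T + 1) ^ 2 := Nat.le_mul_of_pos_left _ (by omega)
  have key := val_setup (S := (3 * M + 4) * (T + 1) ^ 2) hM b
    (le_trans (by nlinarith) h1) (le_trans (Nat.pow_le_pow_left (by omega) 2) h1) T F rfl [] rfl trivial (by simp [F, position])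
  have hsize := hM _ (Y.final_subs b (Form.mem_subs _))
  refine .det ⟨by simp [ChoiceMachine.init], by simp [ChoiceMachine.init],
    by simp [ChoiceMachine.init], by simp [ChoiceMachine.init], rfl⟩ rfl ?_
  have e : Y.game.next w (Y.game.init b T) 0 = cfg F (.setup b) [] [] (encode []) := by
    refine ChoiceMachine.Config.ext' rfl ?_ rfl rfl rfl rfl rfl
    change min 1 (w.length + 1) = 1
    omega
  rw [e]
  -- The constant `3 * M + 4` is the sum of `2 * M` for the final formula, `M` for the lower levels,
  -- and `4` for the choice of the blocks.
  have h2 : (Y.final b).size * (T + 2) ≤ M * (2 * (T + 1) ^ 2) :=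
    Nat.mul_le_mul hsize (by nlinarith)
  have h3 : T * (T + 3) ≤ 4 * (T + 1) ^ 2 := by nlinarith
  have h4 := key.mono (m := (3 * M + 4) * (T + 1) ^ 2) (by linarith)
  convert h4 using 1
  · rfl
  · rw [Bool.eq_iff_iff, decide_eq_true_eq, decide_eq_true_eq]
    simp [Value]

end System

end OfflineTM

/-! ### A clock as the second game. -/

namespace OfflineTM

namespace ChoiceMachine

variable {α : Type}

/-- The states of a clock that compares the value `T` of the counter with a polynomial in the length
`n` of the input: it divides `T` by `n + 1` for `k` times, and compares the result with `d`. -/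
inductive ClockState (k d : ℕ) where
  | fill
  | div (i : Fin (k + 1))
  | ret (i : Fin (k + 1))
  | next (i : Fin (k + 1))
  | check (j : Fin (d + 1))
  | verdict (v : Bool)

instance {k d : ℕ} : Finite (ClockState k d) := by
  refine Finite.of_injective
    (fun t : ClockState k d => match t with
      | .fill => (Sum.inl () : Unit ⊕ Fin (k + 1) ⊕ Fin (k + 1) ⊕ Fin (k + 1) ⊕ Fin (d + 1) ⊕ Bool)
      | .div i => Sum.inr (Sum.inl i)
      | .ret i => Sum.inr (Sum.inr (Sum.inl i))
      | .next i => Sum.inr (Sum.inr (Sum.inr (Sum.inl i)))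
      | .check j => Sum.inr (Sum.inr (Sum.inr (Sum.inr (Sum.inl j))))
      | .verdict v => Sum.inr (Sum.inr (Sum.inr (Sum.inr (Sum.inr v))))) ?_
  rintro (_ | _ | _ | _ | _ | _) (_ | _ | _ | _ | _ | _) h <;> simp_all

/-- The first stack is filled with `T` symbols. A division lets the input head run from the left to
the right end marker again and again and removes a symbol with each move, i.e. `n + 1` symbols in a
complete run; complete runs are counted on the second stack, which becomes the next dividend. -/
def clockTrans {Γ : Type} (g₀ : Γ) {k d : ℕ} (q : ClockState k d) (s : InputSymbol α)
    (tl tr : Option Γ) (more : Bool) : Outcome (ClockState k d) Γ :=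
  match q with
  | .fill =>
    if more then { state := .fill, L := .push g₀, adv := true }
    else { state := .next (Fin.last k) }
  | .div i =>
    match s, tl with
    | .rightEnd, _ => { state := .ret i, R := .push g₀ }
    | _, none => { state := .next i }
    | _, some _ => { state := .div i, L := .pop, move := .right }
  | .ret i =>
    match s with
    | .leftEnd => { state := .div i }
    | _ => { state := .ret i, move := .left }
  | .next i =>
    match s, tr with
    | _, some g => { state := .next i, L := .push g, R := .pop }
    | .leftEnd, none =>
      { state := if (i : ℕ) = 0 then .check (Fin.last d) else .div ⟨i - 1, by omega⟩ }
    | _, none => { state := .next i, move := .left }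
  | .check j =>
    match tl with
    | none => { state := .verdict true }
    | some _ =>
      if (j : ℕ) = 0 then { state := .verdict false }
      else { state := .check ⟨j - 1, by omega⟩, L := .pop }
  | .verdict v => { state := .verdict v }

def Outcome.map {Q Q' Γ : Type} (f : Q → Q') (r : Outcome Q Γ) : Outcome Q' Γ :=
  { r with state := f r.state }

variable (G : ChoiceMachine α)

/-- The machine with choices whose second game is replaced by a clock. -/
abbrev withClock (g₀ : G.Symbol) (k d : ℕ) : ChoiceMachine α where
  State := G.State ⊕ ClockState k d
  Symbol := G.Symbol
  finState := have := G.finState; inferInstance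
  finSymbol := G.finSymbol
  branch := G.branch
  start := fun b => if b then .inl (G.start true) else .inr .fill
  status := fun q => match q with
    | .inl q => G.status q
    | .inr (.verdict v) => .verdict v
    | .inr _ => .det
  trans := fun q s tl tr tk more a => match q with
    | .inl q => Outcome.map .inl (G.trans q s tl tr tk more a)
    | .inr q => Outcome.map .inr (clockTrans g₀ q s tl tr more)

variable {G} {g₀ : G.Symbol} {k d : ℕ} {w : List α} {S T : ℕ}

variable (g₀ k d) in
/-- A configuration of the first game of a machine with a clock. -/
def liftConf (c : G.Config) : (G.withClock g₀ k d).Config :=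
  ⟨.inl c.state, c.pos, c.L, c.R, c.K, c.rem, c.used⟩

/-- The first game never enters a state of the clock, so its plays are unchanged. -/
lemma Val.liftConf {n : ℕ} {c : G.Config} {v : Bool} (h : G.Val w S T n c v) :
    (G.withClock g₀ k d).Val w S T n (liftConf g₀ k d c) v := by
  induction h with
  | verdict hf h => exact .verdict ⟨hf.pos, hf.L, hf.R, hf.K, hf.count⟩ h
  | det hf h _ ih => exact .det ⟨hf.pos, hf.L, hf.R, hf.K, hf.count⟩ h ih
  | @choose n c o f hf h _ ih => 
    exact Val.choose (G := G.withClock g₀ k d) (f := f) ⟨hf.pos, hf.L, hf.R, hf.K, hf.count⟩ h ih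

/-- A configuration of the clock. -/
def clockConf (g₀ : G.Symbol) (q : ClockState k d) (pos l r rem used : ℕ) :
    (G.withClock g₀ k d).Config :=
  ⟨.inr q, pos, List.replicate l g₀, List.replicate r g₀, [], rem, used⟩

lemma clockConf_fits {q : ClockState k d} {pos l r rem used : ℕ} (hp : pos ≤ w.length + 1)
    (hl : l ≤ S) (hr : r ≤ S) (hT : rem + used = T) :
    (clockConf g₀ q pos l r rem used).Fits w S T :=
  ⟨hp, List.length_replicate.trans_le hl, List.length_replicate.trans_le hr, by simp [clockConf], hT⟩

lemma clock_det {q q' : ClockState k d} {pos l r rem used pos' l' r' : ℕ} {v : Bool}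
    {m : Move} {A B : StackAct G.Symbol}
    (hp : pos ≤ w.length + 1) (hl : l ≤ S) (hr : r ≤ S) (hT : rem + used = T)
    (hs : (G.withClock g₀ k d).status (.inr q) = .det)
    (ht : clockTrans g₀ q (Machine.inputAt w pos) (List.replicate l g₀).head?
      (List.replicate r g₀).head? (decide (0 < rem)) = { state := q', move := m, L := A, R := B })
    (hm : min (m.apply pos) (w.length + 1) = pos')
    (hA : A.apply (List.replicate l g₀) = List.replicate l' g₀)
    (hB : B.apply (List.replicate r g₀) = List.replicate r' g₀)
    (h : (G.withClock g₀ k d).Val w S T 0 (clockConf g₀ q' pos' l' r' rem used) v) :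
    (G.withClock g₀ k d).Val w S T 0 (clockConf g₀ q pos l r rem used) v := by
  refine .det (clockConf_fits hp hl hr hT) hs ?_
  have e : (G.withClock g₀ k d).outcome w (clockConf g₀ q pos l r rem used) 0 =
      { state := .inr q', move := m, L := A, R := B } :=
    congrArg (Outcome.map Sum.inr) ht
  have e' : (G.withClock g₀ k d).next w (clockConf g₀ q pos l r rem used) 0 =
      clockConf g₀ q' pos' l' r' rem used := by
    rw [next, e]
    exact Config.ext' rfl hm hA hB rfl rfl rfl
  rw [e']
  exact h

lemma inputAt_cases (w : List α) {pos : ℕ} (hp : pos ≤ w.length + 1) :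
    (pos = 0 ∧ Machine.inputAt w pos = .leftEnd) ∨
    (pos = w.length + 1 ∧ Machine.inputAt w pos = .rightEnd) ∨
    (0 < pos ∧ pos ≤ w.length ∧ ∃ a, Machine.inputAt w pos = .letter a) := by
  rcases pos with _ | i
  · exact Or.inl ⟨rfl, rfl⟩
  · rcases Nat.lt_or_ge i w.length with h | h
    · refine Or.inr (Or.inr ⟨by omega, h, w[i], ?_⟩)
      simp [Machine.inputAt, h]
    · refine Or.inr (Or.inl ⟨by omega, ?_⟩)
      simp [Machine.inputAt, h]

lemma val_check {j : Fin (d + 1)} {pos l r rem used : ℕ}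
    (hp : pos ≤ w.length + 1) (hl : l ≤ S) (hr : r ≤ S) (hT : rem + used = T) :
    (G.withClock g₀ k d).Val w S T 0 (clockConf g₀ (.check j) pos l r rem used)
      (decide (l ≤ j)) := by
  induction l generalizing j with
  | zero =>
    exact clock_det hp hl hr hT rfl (q' := .verdict true) (l' := 0) rfl (min_eq_left hp) rfl rfl
      (.verdict (clockConf_fits hp hl hr hT) (by simp [clockConf]))
  | succ l ih =>
    by_cases hj : (j : ℕ) = 0
    · refine clock_det hp hl hr hT rfl (q' := .verdict false) (m := .stay) (A := .keep) (B := .keep)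
        (l' := l + 1) ?_ (min_eq_left hp) rfl rfl
        (.verdict (clockConf_fits hp hl hr hT) (by simp [clockConf, hj]))
      simp [clockTrans, List.replicate_succ, hj]
    · refine clock_det hp hl hr hT rfl (q' := .check ⟨j - 1, by omega⟩) (m := .stay) (A := .pop)
        (B := .keep) (l' := l) ?_ (min_eq_left hp) rfl rfl ?_
      · simp [clockTrans, List.replicate_succ, hj]
      · rw [show decide (l + 1 ≤ (j : ℕ)) = decide (l ≤ (j : ℕ) - 1) from
          decide_eq_decide.mpr (by omega)]
        exact ih (j := ⟨j - 1, by omega⟩) (by omega)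

lemma val_ret {i : Fin (k + 1)} {pos l r rem used : ℕ} {v : Bool}
    (hp : pos ≤ w.length + 1) (hl : l ≤ S) (hr : r ≤ S) (hT : rem + used = T)
    (h : (G.withClock g₀ k d).Val w S T 0 (clockConf g₀ (.div i) 0 l r rem used) v) :
    (G.withClock g₀ k d).Val w S T 0 (clockConf g₀ (.ret i) pos l r rem used) v := by
  induction pos with
  | zero => exact clock_det hp hl hr hT rfl rfl (min_eq_left hp) rfl rfl h
  | succ p ih =>
    refine clock_det hp hl hr hT rfl (q' := .ret i) (m := .left) (A := .keep) (B := .keep) ?_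
      (min_eq_left (by simp [Move.apply]; omega)) rfl rfl (ih (by omega))
    rcases inputAt_cases w hp with ⟨h, -⟩ | ⟨-, h⟩ | ⟨-, -, a, h⟩
    · omega
    · simp [clockTrans, h]
    · simp [clockTrans, h]

lemma val_next {i : Fin (k + 1)} {pos l r rem used : ℕ} {v : Bool}
    (hp : pos ≤ w.length + 1) (hl : l + r ≤ S) (hT : rem + used = T)
    (h : (G.withClock g₀ k d).Val w S T 0 (clockConf g₀
      (if (i : ℕ) = 0 then .check (Fin.last d) else .div ⟨i - 1, by omega⟩) 0 (l + r) 0 rem used) v) :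
    (G.withClock g₀ k d).Val w S T 0 (clockConf g₀ (.next i) pos l r rem used) v := by
  induction r generalizing l with
  | succ r ih =>
    refine clock_det hp (by omega) (by omega) hT rfl (q' := .next i) (m := .stay) (A := .push g₀)
      (B := .pop) (l' := l + 1) (r' := r) ?_ (min_eq_left hp) rfl rfl (ih (by omega) ?_)
    · rcases inputAt_cases w hp with ⟨-, h⟩ | ⟨-, h⟩ | ⟨-, -, a, h⟩ <;>
        simp [clockTrans, h, List.replicate_succ]
    · rwa [show l + 1 + r = l + (r + 1) by ring]
  | zero =>
    induction pos with
    | zero => exact clock_det hp (by omega) (by omega) hT rfl rfl (min_eq_left hp) rfl rfl h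
    | succ p ih =>
      refine clock_det hp (by omega) (by omega) hT rfl (q' := .next i) (m := .left) (A := .keep)
        (B := .keep) ?_ (min_eq_left (by simp [Move.apply]; omega)) rfl rfl (ih (by omega) h)
      rcases inputAt_cases w hp with ⟨h, -⟩ | ⟨-, h⟩ | ⟨-, -, a, h⟩
      · omega
      · simp [clockTrans, h]
      · simp [clockTrans, h]

/-- The invariant is `r + (pos + l) / (n + 1)`: the head position counts the symbols removed in the
current run, and a return from the right end turns `n + 1` of them into one symbol of the second
stack. -/
lemma val_div {i : Fin (k + 1)} {pos l r rem used : ℕ} {v : Bool}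
    (hp : pos ≤ w.length + 1) (hl : l ≤ S) (hr : r + (pos + l) / (w.length + 1) ≤ S)
    (hT : rem + used = T)
    (h : ∀ pos' ≤ w.length + 1, (G.withClock g₀ k d).Val w S T 0
      (clockConf g₀ (.next i) pos' 0 (r + (pos + l) / (w.length + 1)) rem used) v) :
    (G.withClock g₀ k d).Val w S T 0 (clockConf g₀ (.div i) pos l r rem used) v := by
  -- A return to the left end removes no symbol of the first stack; the second summand pays for it.
  induction hm : 2 * l + (if pos = w.length + 1 then 1 else 0) using Nat.strong_induction_on
    generalizing pos l r with
  | _ m ih =>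
  have hr' : r ≤ S := (Nat.le_add_right _ _).trans hr
  by_cases hpos : pos = w.length + 1
  · have hin : Machine.inputAt w pos = .rightEnd := by
      rcases inputAt_cases w hp with ⟨h, -⟩ | ⟨-, h⟩ | ⟨-, h, -⟩
      · omega
      · exact h
      · omega
    have hdiv : (pos + l) / (w.length + 1) = (0 + l) / (w.length + 1) + 1 := by
      rw [hpos, zero_add, Nat.add_div_left _ (by omega)]
    have hr₁ : r + 1 + (0 + l) / (w.length + 1) ≤ S := by
      rw [hdiv] at hr
      linarith
    refine clock_det hp hl hr' hT rfl (q' := .ret i) (m := .stay) (A := .keep)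
      (B := .push g₀) (l' := l) (r' := r + 1) ?_ (min_eq_left hp) rfl rfl ?_
    · simp [clockTrans, hin]
    · refine val_ret hp hl ((Nat.le_add_right _ _).trans hr₁) hT
        (ih _ ?_ (by omega) hl hr₁ ?_ rfl)
      · rw [← hm, if_pos hpos, if_neg (by omega)]
        omega
      · intro pos' hp'
        have := h pos' hp'
        rwa [hdiv, show r + ((0 + l) / (w.length + 1) + 1) = r + 1 + (0 + l) / (w.length + 1) by
          ring] at this
  · obtain _ | l := l
    · refine clock_det hp hl hr' hT rfl (q' := .next i) (m := .stay) (A := .keep)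
        (B := .keep) (pos' := pos) (l' := 0) (r' := r) ?_ (min_eq_left hp) rfl rfl ?_
      · rcases inputAt_cases w hp with ⟨-, h⟩ | ⟨h, -⟩ | ⟨-, -, a, h⟩
        · simp [clockTrans, h]
        · omega
        · simp [clockTrans, h]
      · simpa [Nat.div_eq_of_lt (show pos < w.length + 1 by omega)] using h pos hp
    · refine clock_det hp hl hr' hT rfl (q' := .div i) (m := .right) (A := .pop)
        (B := .keep) (pos' := pos + 1) (l' := l) (r' := r) ?_
        (min_eq_left (by simp [Move.apply]; omega)) rfl rfl ?_
      · rcases inputAt_cases w hp with ⟨-, h⟩ | ⟨h, -⟩ | ⟨-, -, a, h⟩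
        · simp [clockTrans, h, List.replicate_succ]
        · omega
        · simp [clockTrans, h, List.replicate_succ]
      · rw [show pos + (l + 1) = pos + 1 + l by ring] at h hr
        refine ih _ ?_ (by omega) (by omega) hr h rfl
        rw [← hm]
        split_ifs <;> omega

/-- Repeated rounded division by `n + 1` is a single rounded division by the power. -/
lemma val_pass {m : ℕ} {i : Fin (k + 1)} (hi : (i : ℕ) = m) {pos l r rem used : ℕ}
    (hp : pos ≤ w.length + 1) (hl : l + r ≤ S) (hT : rem + used = T) :
    (G.withClock g₀ k d).Val w S T 0 (clockConf g₀ (.next i) pos l r rem used)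
      (decide ((l + r) / (w.length + 1) ^ m ≤ d)) := by
  induction m generalizing i pos l r with
  | zero =>
    refine val_next hp hl hT ?_
    rw [if_pos hi]
    simpa using val_check (j := Fin.last d) (Nat.zero_le _) hl (Nat.zero_le _) hT
  | succ m ih =>
    refine val_next hp hl hT ?_
    rw [if_neg (by omega)]
    have hq : (l + r) / (w.length + 1) ≤ S := (Nat.div_le_self _ _).trans hl
    refine val_div (Nat.zero_le _) hl (by simpa using hq) hT fun pos' hp' => ?_
    convert ih (i := ⟨i - 1, by omega⟩) (by simp; omega) hp' (l := 0)
      (r := 0 + (0 + (l + r)) / (w.length + 1)) (by simpa using hq) using 2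
    rw [Nat.zero_add, Nat.zero_add, Nat.zero_add, Nat.div_div_eq_div_mul, pow_succ']

/-- The clock compares the value of the counter with a polynomial. -/
lemma val_clock (hT : T ≤ S) :
    (G.withClock g₀ k d).Val w S T 0 ((G.withClock g₀ k d).init false T)
      (decide (T / (w.length + 1) ^ k ≤ d)) := by
  suffices h : ∀ rem used, rem + used = T → (G.withClock g₀ k d).Val w S T 0
      (clockConf g₀ .fill 0 used 0 rem used) (decide (T / (w.length + 1) ^ k ≤ d)) from h T 0 rfl
  intro rem
  induction rem with
  | zero =>
    intro used hu
    refine clock_det (Nat.zero_le _) (by omega) (Nat.zero_le _) hu rfl (q' := .next (Fin.last k))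
      (l' := used) (r' := 0) rfl (min_eq_left (Nat.zero_le _)) rfl rfl ?_
    have := val_pass (G := G) (g₀ := g₀) (d := d) (w := w) (i := Fin.last k) rfl (Nat.zero_le _)
      (l := used) (r := 0) (S := S) (by omega) hu
    rwa [show used + 0 = T by omega] at this
  | succ rem ih =>
    intro used hu
    refine .det (clockConf_fits (Nat.zero_le _) (by omega) (Nat.zero_le _) hu) rfl ?_
    have e : (G.withClock g₀ k d).next w (clockConf g₀ .fill 0 used 0 (rem + 1) used) 0 =
        clockConf g₀ .fill 0 (used + 1) 0 rem (used + 1) := by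
      have e' : (G.withClock g₀ k d).outcome w (clockConf g₀ .fill 0 used 0 (rem + 1) used) 0 =
          { state := .inr .fill, L := .push g₀, adv := true } := by
        simp [outcome, clockConf, clockTrans, Outcome.map]
      rw [next, e']
      exact Config.ext' rfl (min_eq_left (Nat.zero_le _)) rfl rfl rfl rfl rfl
    rw [e]
    exact ih (used + 1) (by omega)

end ChoiceMachine

end OfflineTM

/-! ### Derived connectives. -/

namespace OfflineTM.Form

variable {V K : Type}

def tru : Form V K := not fls

def or (φ ψ : Form V K) : Form V K := not (and (not φ) (not ψ))

def eq (x y : V) : Form V K := and (not (lt x y)) (not (lt y x))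

def disj (l : List (Form V K)) : Form V K := l.foldr or fls

def conj (l : List (Form V K)) : Form V K := l.foldr and tru

/-- For conditions on letters, headers and program lines, which are settled when the formula is
written down and not by the game. -/
def guard (p : Prop) [Decidable p] (φ : Form V K) : Form V K := if p then φ else fls

variable {m n : ℕ} {R : K → List (Fin m) → List (Fin m) → Prop} {e : V → List (Fin m)}

@[simp] lemma holds_fls : (fls : Form V K).Holds n R e ↔ False := Iff.rfl

@[simp] lemma holds_lt {x y : V} : (lt x y : Form V K).Holds n R e ↔ e x < e y := Iff.rfl

@[simp] lemma holds_not {φ : Form V K} : φ.not.Holds n R e ↔ ¬ φ.Holds n R e := Iff.rfl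

@[simp] lemma holds_and {φ ψ : Form V K} :
    (φ.and ψ).Holds n R e ↔ φ.Holds n R e ∧ ψ.Holds n R e := Iff.rfl

open Classical in
@[simp] lemma holds_ex {x : V} {φ : Form V K} :
    (ex x φ).Holds n R e ↔ ∃ u, u.length = n ∧ φ.Holds n R (Function.update e x u) := Iff.rfl

@[simp] lemma holds_tru : (tru : Form V K).Holds n R e ↔ True := by simp [tru]

@[simp] lemma holds_or {φ ψ : Form V K} :
    (φ.or ψ).Holds n R e ↔ φ.Holds n R e ∨ ψ.Holds n R e := by
  simp only [or, holds_not, holds_and]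
  tauto

@[simp] lemma holds_eq {x y : V} : (eq x y : Form V K).Holds n R e ↔ e x = e y := by
  simp only [eq, holds_and, holds_not, holds_lt, not_lt]
  exact ⟨fun h => le_antisymm h.2 h.1, fun h => ⟨h.ge, h.le⟩⟩

@[simp] lemma holds_disj {l : List (Form V K)} :
    (disj l).Holds n R e ↔ ∃ φ ∈ l, φ.Holds n R e := by
  induction l with
  | nil => simp [disj]
  | cons φ l ih =>
    have : (disj (φ :: l)).Holds n R e ↔ φ.Holds n R e ∨ (disj l).Holds n R e := holds_or
    simp [this, ih]

@[simp] lemma holds_conj {l : List (Form V K)} :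
    (conj l).Holds n R e ↔ ∀ φ ∈ l, φ.Holds n R e := by
  induction l with
  | nil => simp [conj]
  | cons φ l ih =>
    have : (conj (φ :: l)).Holds n R e ↔ φ.Holds n R e ∧ (conj l).Holds n R e := holds_and
    simp [this, ih]

@[simp] lemma holds_guard {p : Prop} [Decidable p] {φ : Form V K} :
    (guard p φ).Holds n R e ↔ p ∧ φ.Holds n R e := by
  by_cases h : p <;> simp [guard, h]

end OfflineTM.Form

/-! ### Formulas that describe a step of a storage modification machine. -/

namespace MWSMM

open OfflineTM (Form System)

/-- The variables of the formulas: some auxiliary ones, and for each line the node that is chosen by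
a non-deterministic `match` at this line. -/
inductive Var (n : ℕ) where
  | loc (i : Fin 8)
  | sel (l : Fin n)

/-- The relations that describe a configuration: the nodes, the edges, the executions with their
lines and centers, the center of the machine, and the correctness of the choices made so far. -/
inductive Kind (n k : ℕ) where
  | node
  | ptr (d : Fin k)
  | thr (q : Fin (n + 1))
  | center
  | good

instance {n : ℕ} : Finite (Var n) := by
  refine Finite.of_injective
    (fun t : Var n => match t with
      | .loc i => (Sum.inl i : Fin 8 ⊕ Fin n)
      | .sel l => Sum.inr l) ?_
  rintro (_ | _) (_ | _) h <;> simp_all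

instance {n k : ℕ} : Finite (Kind n k) := by
  refine Finite.of_injective
    (fun t : Kind n k => match t with
      | .ptr d => (Sum.inl d : Fin k ⊕ Fin (n + 1) ⊕ Fin 3)
      | .thr q => Sum.inr (Sum.inl q)
      | .node => Sum.inr (Sum.inr 0)
      | .center => Sum.inr (Sum.inr 1)
      | .good => Sum.inr (Sum.inr 2)) ?_
  rintro (_ | _ | _ | _ | _) (_ | _ | _ | _ | _) h <;> simp_all

namespace Machine

variable {α : Type} (M : Machine α)

abbrev Fm := Form (Var M.prog.length) (Kind M.prog.length M.dirs)

abbrev V := Var M.prog.length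

/-- The line number, where all lines that do not exist are identified. -/
def line (n : ℕ) : Fin (M.prog.length + 1) := ⟨min n M.prog.length, by omega⟩

def lines (f : ℕ → M.Fm) : M.Fm := .disj ((List.range M.prog.length).map f)

def nodeF (x : M.V) : M.Fm := .rel .node x x

/-- The path `p` leads from `x` to `y`; the variables `a` and `b` are auxiliary. -/
def walkF (a b x : M.V) : List (Fin M.dirs) → M.V → M.Fm
  | [], y => .and (M.nodeF x) (.eq x y)
  -- The auxiliary variables change roles: `a` now holds the current node, and `b` is free for the
  -- next one. So two variables suffice for paths of any length.
  | d :: p, y => .ex a (.and (.rel (.ptr d) x a) (walkF b a a p y))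

def boolF (v : M.V) : BoolExpr M.dirs → M.Fm
  | .eq p q => .ex (.loc 7) (.and (M.walkF (.loc 5) (.loc 6) v p (.loc 7))
      (M.walkF (.loc 5) (.loc 6) v q (.loc 7)))
  | .not b => .not (boolF v b)
  | .and b c => .and (boolF v b) (boolF v c)
  | .or b c => .or (boolF v b) (boolF v c)

/-- The node `v` matches at the line `ℓ`. -/
def matchF (ℓ : ℕ) (v : M.V) : M.Fm :=
  match M.prog[ℓ]? with
  | some (.select _ b) => .and (M.nodeF v) (M.boolF v b)
  | _ => .fls

/-- If the `match` at line `ℓ` is non-deterministic, `v` is the chosen node. -/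
def chosenF (ℓ : ℕ) (v : M.V) : M.Fm :=
  match M.prog[ℓ]? with
  | some (.select .nondet _) => if h : ℓ < M.prog.length then .eq v (.sel ⟨ℓ, h⟩) else .fls
  | _ => .tru

def selectedF (ℓ : ℕ) (v : M.V) : M.Fm := .and (M.matchF ℓ v) (M.chosenF ℓ v)

/-- The execution `x` is at line `n`, with the center `y`. -/
def atF (n : ℕ) (x y : M.V) : M.Fm := .rel (.thr (M.line n)) x y

def hitF (n : ℕ) : M.Fm := .ex (.loc 2) (.ex (.loc 3) (M.atF n (.loc 2) (.loc 3)))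

def anyF : M.Fm := .disj ((List.range (M.prog.length + 1)).map M.hitF)

/-- The execution `x` redirects the `d` edge of `v`. -/
def setF (d : Fin M.dirs) (x v : M.V) : M.Fm :=
  M.lines fun n => match M.prog[n]? with
    | some (.set p d' _) => .guard (d' = d)
        (.ex (.loc 3) (.and (M.atF n x (.loc 3)) (M.walkF (.loc 5) (.loc 6) (.loc 3) p v)))
    | _ => .fls

/-- The execution `x` redirects the `d` edge of `v` to `u`. -/
def setToF (d : Fin M.dirs) (x v u : M.V) : M.Fm :=
  M.lines fun n => match M.prog[n]? with
    | some (.set p d' q) => .guard (d' = d)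
        (.ex (.loc 3) (.and (M.atF n x (.loc 3)) (.and (M.walkF (.loc 5) (.loc 6) (.loc 3) p v)
          (M.walkF (.loc 5) (.loc 6) (.loc 3) q u))))
    | _ => .fls

/-- After the step, the `d` edge of the old node `v` points to the old node `u`. -/
def ptrF (d : Fin M.dirs) (v u : M.V) : M.Fm :=
  .or (.ex (.loc 2) (.and (M.setToF d (.loc 2) v u)
      (.not (.ex (.loc 4) (.and (.lt (.loc 2) (.loc 4)) (M.setF d (.loc 4) v))))))
    (.and (.not (.ex (.loc 2) (M.setF d (.loc 2) v))) (.rel (.ptr d) v u))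

/-- The execution `x` creates a node, which points to `y`. -/
def newF (x y : M.V) : M.Fm :=
  M.lines fun n => match M.prog[n]? with
    | some .new => M.atF n x y
    | _ => .fls

/-- After the step, the old execution `x` is at the line `q`, with a center that is the node `y` if
`h = 0`, and the node created by `y` if `h = 1`. -/
def contF (q : Fin (M.prog.length + 1)) (h : ℕ) (a : Option α) (x y : M.V) : M.Fm :=
  M.lines fun n => match M.prog[n]? with
    | some .new => .guard (h = 1 ∧ M.line (n + 1) = q)
        (.and (.eq x y) (.ex (.loc 3) (M.atF n x (.loc 3))))
    | some (.set _ _ _) => .guard (h = 0 ∧ M.line (n + 1) = q) (M.atF n x y)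
    | some (.center p) => .guard (h = 0 ∧ M.line (n + 1) = q)
        (.ex (.loc 3) (.and (M.atF n x (.loc 3)) (M.walkF (.loc 5) (.loc 6) (.loc 3) p y)))
    | some (.ifEq p p' ln) => .guard (h = 0) (.and (M.atF n x y)
        (.or (.and (M.boolF y (.eq p p')) (.guard (M.line ln = q) .tru))
          (.and (.not (M.boolF y (.eq p p'))) (.guard (M.line (n + 1) = q) .tru))))
    | some (.input ln) => .guard (h = 0 ∧ M.line (a.elim (n + 1) ln) = q) (M.atF n x y)
    | _ => .fls

/-- The execution `x` goes on. -/
def aliveF (x : M.V) : M.Fm :=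
  M.lines fun n => match M.prog[n]? with
    | some .halt => .fls
    | some (.select _ _) => .fls
    | _ => .ex (.loc 3) (M.atF n x (.loc 3))

/-- The word `x` consists of zeros; it is the name of the prologue. -/
def rootF (x : M.V) : M.Fm := .not (.ex (.loc 4) (.lt (.loc 4) x))

/-- The kind of a step, i.e. an ordinary one or a round with the given alternative, and a flag that
says whether an input symbol is read. -/
abbrev Hdr := Option (Fin M.topLevel.length) × Bool

/-- The line of the `match` for the executions started with the index `j`. -/
def forkLine (h : M.Hdr) (j : ℕ) : Option ℕ :=
  match h.1 with
  | none => if j < M.prog.length then some j else none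
  | some a => M.topLevel[a][j]?

def forkF (q : Fin (M.prog.length + 1)) (h : M.Hdr) (j : ℕ) (x y : M.V) : M.Fm :=
  match M.forkLine h j with
  | some ℓ => .guard (M.line (ℓ + 1) = q)
      (.and (.eq x y) (.and (M.selectedF ℓ x) (if h.1 = none then M.hitF ℓ else .tru)))
  | none => .fls

/-- The choices for the step are possible ones. -/
def legalF : M.Fm :=
  .conj ((List.range M.prog.length).map fun ℓ =>
    -- A constraint only at a non-deterministic `match`: if some node matches, the chosen name has
    -- to denote a matching node. If none matches, any name will do, as it selects nothing.
    .or (.not (.ex (.loc 2) (M.matchF ℓ (.loc 2)))) (.ex (.loc 2) (M.selectedF ℓ (.loc 2))))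

def readF : M.Fm :=
  M.lines fun n => match M.prog[n]? with
    | some (.input _) => M.hitF n
    | _ => .fls

/-- The header is guessed before the configuration is known, and checked here. In particular its
flag, on which the input position depends, has to agree with what the executions really do. -/
def legitF (h : M.Hdr) : M.Fm :=
  .and M.legalF (match h.1 with
    | none => .and M.anyF (if h.2 then M.readF else .not M.readF)
    | some a => .and (.not M.anyF) (.guard (h.2 = false)
        (.disj (M.topLevel[a].map fun ℓ => .ex (.loc 2) (M.selectedF ℓ (.loc 2))))))

/-- The first letters tell how the named objects came about. Edges end in old nodes, since paths are
followed in the graph before the step, and new executions start on old nodes for the same reason;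
hence the conditions `g' = 0`. No execution has a name that begins with `1`. If the prologue does
not go on, the machine keeps its center. -/
def ruleF (g g' : ℕ) (h : M.Hdr) (a : Option α) : Kind M.prog.length M.dirs → M.Fm
  | .node => match g with
    | 0 => M.nodeF (.loc 0)
    | 1 => .ex (.loc 3) (M.newF (.loc 0) (.loc 3))
    | _ => .fls
  | .ptr d => .guard (g' = 0) (match g with
    | 0 => M.ptrF d (.loc 0) (.loc 1)
    | 1 => M.newF (.loc 0) (.loc 1)
    | _ => .fls)
  | .thr q => match g with
    | 0 => M.contF q g' a (.loc 0) (.loc 1)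
    | 1 => .fls
    | j + 2 => .guard (g' = 0) (M.forkF q h j (.loc 0) (.loc 1))
  | .center =>
    .or (.ex (.loc 2) (.and (M.rootF (.loc 2))
        (.disj ((List.finRange (M.prog.length + 1)).map fun q => M.contF q g a (.loc 2) (.loc 0)))))
      (.guard (g = 0) (.and (.rel .center (.loc 0) (.loc 0))
        (.not (.ex (.loc 2) (.and (M.rootF (.loc 2)) (M.aliveF (.loc 2)))))))
  | .good => .and (.rel .good (.loc 0) (.loc 0)) (M.legitF h)

/-- Some alternative for a round selects a node. -/
def roundF : M.Fm :=
  .disj (M.topLevel.flatten.map fun ℓ => .ex (.loc 2) (M.matchF ℓ (.loc 2)))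

/-- The first game asks for a computation that has stopped and accepts, the second one for any legal
computation. -/
def finalF (b : Bool) : M.Fm :=
  .and (.rel .good (.loc 0) (.loc 0)) (if b then
    .and (.not M.anyF) (.and (.not M.roundF)
      (.ex (.loc 2) (.and (.rel .center (.loc 2) (.loc 2)) (M.boolF (.loc 2) M.accept))))
    else .tru)

/-- A bound for the indices of the executions that are started in a step. -/
def maxFork : ℕ := M.prog.length + M.topLevel.flatten.length

/-- The recursive description of the configurations of the machine. After `s` steps the nodes and
executions have names of length `s`. In a step, old nodes and executions get the new first letter
`0`, the node created by an execution gets its name with the new letter `1`, and an execution that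
is started on a node gets its name with a new letter `j + 2`. -/
abbrev system [Finite α] : System α where
  sym := M.maxFork + 1
  Var := M.V
  Kind := Kind M.prog.length M.dirs
  Hdr := M.Hdr
  finVar := inferInstance
  finKind := inferInstance
  finHdr := inferInstance
  hdr := (none, false)
  arg₁ := .loc 0
  arg₂ := .loc 1
  arg_ne := by simp
  rule := fun k g g' h a => M.ruleF g g' h a k
  -- Before the first step the empty word names the only node, which is the center and has only
  -- loops, and the prologue at line `0`.
  base := fun k => match k with
    | .thr q => decide (q = 0)
    | _ => true
  final := M.finalF
  reads := fun h => h.2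

end Machine

end MWSMM

/-! ### The meaning of the formulas in a configuration with names. -/

namespace MWSMM.Machine

open OfflineTM (Form System)

variable {α : Type} (M : Machine α)

/-- The nodes that match at the line `ℓ`. -/
def matchingAt (g : Memory M.dirs) (ℓ : ℕ) : List ℕ :=
  match M.prog[ℓ]? with
  | some (.select _ b) => g.matching b
  | _ => []

open Classical in
/-- The nodes that are selected at the line `ℓ` if `N` lists the names of the nodes, and `σ` gives
the names of the nodes chosen by the non-deterministic `match` instructions. -/
noncomputable def selection {m : ℕ} (g : Memory M.dirs) (N : List (List (Fin m)))
    (σ : Fin M.prog.length → List (Fin m)) (ℓ : ℕ) : List ℕ :=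
  match M.prog[ℓ]? with
  | some (.select .parallel b) => g.matching b
  | some (.select .nondet b) =>
      (g.matching b).filter fun v => ∃ h : ℓ < M.prog.length, N[v]? = some (σ ⟨ℓ, h⟩)
  | _ => []

/-- The edge that is redirected by an execution, and its new end. -/
def redirection (g : Memory M.dirs) (t : Thread) : Option (ℕ × Fin M.dirs × ℕ) :=
  match M.prog[t.pc]? with
  | some (.set x d y) => some (g.walk t.center x, d, g.walk t.center y)
  | _ => none

def creates (t : Thread) : Bool :=
  match M.prog[t.pc]? with
  | some .new => true
  | _ => false

/-- The execution `t` after the step, if it goes on; `n` is the number of the node that it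
creates. -/
def next (g : Memory M.dirs) (a : Option α) (n : ℕ) (t : Thread) : Option Thread :=
  match M.prog[t.pc]? with
  | some .new => some ⟨t.pc + 1, n, t.main⟩
  | some (.set _ _ _) => some ⟨t.pc + 1, t.center, t.main⟩
  | some (.center x) => some ⟨t.pc + 1, g.walk t.center x, t.main⟩
  | some (.ifEq x y ln) =>
      some ⟨if g.walk t.center x = g.walk t.center y then ln else t.pc + 1, t.center, t.main⟩
  | some (.input ln) => some ⟨a.elim (t.pc + 1) ln, t.center, t.main⟩
  | _ => none

/-- The relations `R` describe the memory `g` and the executions in `θ`, where the nodes have the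
names in `N`, which are words of length `s`. -/
structure Describes {m : ℕ} (s : ℕ)
    (R : Kind M.prog.length M.dirs → List (Fin m) → List (Fin m) → Prop) (g : Memory M.dirs)
    (N : List (List (Fin m))) (θ : List (List (Fin m) × Thread)) : Prop where
  size : N.length = g.size
  len : ∀ x ∈ N, x.length = s
  nodup : N.Nodup
  ptr_lt : ∀ i < g.size, ∀ d, g.ptr i d < g.size
  thr_len : ∀ p ∈ θ, p.1.length = s
  center_lt : ∀ p ∈ θ, p.2.center < g.size
  node : ∀ x, x.length = s → (R .node x x ↔ x ∈ N)
  ptr : ∀ d x y, x.length = s → y.length = s →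
    (R (.ptr d) x y ↔ ∃ i, N[i]? = some x ∧ N[g.ptr i d]? = some y)
  thr : ∀ q x y, x.length = s → y.length = s →
    (R (.thr q) x y ↔ ∃ t, (x, t) ∈ θ ∧ M.line t.pc = q ∧ N[t.center]? = some y)

variable {M}

lemma line_eq_iff {n n' : ℕ} (h : n' < M.prog.length) : M.line n = M.line n' ↔ n = n' := by
  simp only [line, Fin.mk.injEq]
  omega

lemma holds_lines {m s : ℕ}
    {R : Kind M.prog.length M.dirs → List (Fin m) → List (Fin m) → Prop}
    {e : M.V → List (Fin m)} {f : ℕ → M.Fm} :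
    (M.lines f).Holds s R e ↔ ∃ n < M.prog.length, (f n).Holds s R e := by
  simp [lines]

/-- The word of zeros is the least one of its length: at the first other letter, or a later one, a
word can be made smaller. -/
lemma holds_rootF {m s : ℕ}
    {R : Kind M.prog.length M.dirs → List (Fin (m + 1)) → List (Fin (m + 1)) → Prop}
    {e : M.V → List (Fin (m + 1))} {x : M.V} (hx : x ≠ .loc 4) (hl : (e x).length = s) :
    (M.rootF x).Holds s R e ↔ e x = List.replicate s 0 := by
  have key : ∀ u : List (Fin (m + 1)), (¬ ∃ v : List (Fin (m + 1)), v.length = u.length ∧ v < u) ↔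
      u = List.replicate u.length 0 := by
    intro u
    induction u with
    | nil => simp
    | cons a u ih =>
      rw [List.length_cons, List.replicate_succ, List.cons_eq_cons, ← ih]
      constructor
      · intro h
        refine ⟨?_, fun ⟨v, hv, hlt⟩ => h ⟨a :: v, by simp [hv], List.Lex.cons hlt⟩⟩
        by_contra ha
        exact h ⟨0 :: u, by simp, List.Lex.rel (Fin.pos_iff_ne_zero.mpr ha)⟩
      · rintro ⟨rfl, h⟩ ⟨v, hv, hlt⟩
        cases hlt with
        | nil => simp at hv
        | rel h => exact absurd h (Fin.not_lt_zero _)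
        | cons h' => exact h ⟨_, by simpa using hv, h'⟩
  have := key (e x)
  rw [hl] at this
  simpa [rootF, hx] using this

namespace Describes

open scoped Classical

variable {m s : ℕ} {R : Kind M.prog.length M.dirs → List (Fin m) → List (Fin m) → Prop}
  {g : Memory M.dirs} {N : List (List (Fin m))} {θ : List (List (Fin m) × Thread)}
  (D : M.Describes s R g N θ) {e : M.V → List (Fin m)}

include D

lemma lt_size {i : ℕ} {x : List (Fin m)} (h : N[i]? = some x) : i < g.size := by
  rw [← D.size]
  exact (List.getElem?_eq_some_iff.mp h).1

lemma length_eq {i : ℕ} {x : List (Fin m)} (h : N[i]? = some x) : x.length = s :=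
  D.len _ (List.mem_of_getElem? h)

lemma exists_name {i : ℕ} (h : i < g.size) : ∃ x, x.length = s ∧ N[i]? = some x := by
  rw [← D.size] at h
  exact ⟨N[i], D.len _ (List.getElem_mem h), List.getElem?_eq_getElem h⟩

lemma index_inj {i j : ℕ} {x : List (Fin m)} (hi : N[i]? = some x) (hj : N[j]? = some x) :
    i = j :=
  (List.getElem?_inj (List.getElem?_eq_some_iff.mp hi).1 D.nodup).mp (hi.trans hj.symm)

lemma walk_lt {i : ℕ} (h : i < g.size) (p : List (Fin M.dirs)) : g.walk i p < g.size := by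
  induction p generalizing i with
  | nil => exact h
  | cons d p ih => exact ih (D.ptr_lt i h d)

omit D in
lemma update_len [DecidableEq M.V] (he : ∀ v, (e v).length = s) (a : M.V) {u : List (Fin m)}
    (hu : u.length = s) : ∀ v, (Function.update e a u v).length = s := by
  intro v
  by_cases h : v = a
  · subst h
    simpa
  · simpa [h] using he v

lemma holds_nodeF (he : ∀ v, (e v).length = s) {x : M.V} :
    (M.nodeF x).Holds s R e ↔ ∃ i : ℕ, N[i]? = some (e x) := by
  rw [← List.mem_iff_getElem?, ← D.node _ (he x)]
  rfl

/-- Names are unique, so the witness for the intermediate node names the node to which the edge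
leads. The inequalities keep the auxiliary variables from overwriting the ends of the path. -/
lemma holds_walkF (he : ∀ v, (e v).length = s) {a b x y : M.V} {p : List (Fin M.dirs)}
    (hab : a ≠ b) (hxa : x ≠ a) (hya : y ≠ a) (hyb : y ≠ b) :
    (M.walkF a b x p y).Holds s R e ↔
      ∃ i, N[i]? = some (e x) ∧ N[g.walk i p]? = some (e y) := by
  induction p generalizing a b x e with
  | nil =>
    simp only [walkF, Form.holds_and, D.holds_nodeF he, Form.holds_eq, Memory.walk, List.foldl_nil]
    constructor
    · rintro ⟨⟨i, hi⟩, h⟩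
      exact ⟨i, hi, h ▸ hi⟩
    · rintro ⟨i, hi, h⟩
      exact ⟨⟨i, hi⟩, Option.some.inj (hi.symm.trans h)⟩
  | cons d p ih =>
    have hrel : ∀ u : List (Fin m), u.length = s →
        ((Form.rel (.ptr d) x a : M.Fm).Holds s R (Function.update e a u) ↔
          ∃ i, N[i]? = some (e x) ∧ N[g.ptr i d]? = some u) := by
      intro u hu
      rw [← D.ptr d _ _ (he x) hu]
      simp [Form.Holds, hxa]
    simp only [walkF, Form.holds_ex, Form.holds_and]
    constructor
    · rintro ⟨u, hu, h₁, h₂⟩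
      obtain ⟨i, hi, hi'⟩ := (hrel u hu).mp h₁
      obtain ⟨j, hj, hj'⟩ := (ih (update_len he a hu) hab.symm hab hyb hya).mp h₂
      rw [Function.update_self] at hj
      rw [Function.update_of_ne hya] at hj'
      refine ⟨i, hi, ?_⟩
      rw [← D.index_inj hi' hj] at hj'
      exact hj'
    · rintro ⟨i, hi, hi'⟩
      obtain ⟨u, hu, hu'⟩ := D.exists_name (D.ptr_lt i (D.lt_size hi) d)
      refine ⟨u, hu, (hrel u hu).mpr ⟨i, hi, hu'⟩,
        (ih (update_len he a hu) hab.symm hab hyb hya).mpr ⟨g.ptr i d, ?_, ?_⟩⟩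
      · rwa [Function.update_self]
      · rwa [Function.update_of_ne hya]

lemma holds_boolF (he : ∀ v, (e v).length = s) {v : M.V} (h₅ : v ≠ .loc 5)
    (h₇ : v ≠ .loc 7) {i : ℕ} (hi : N[i]? = some (e v)) (b : BoolExpr M.dirs) :
    (M.boolF v b).Holds s R e ↔ b.eval g i = true := by
  induction b with
  | eq p q =>
    simp only [boolF, Form.holds_ex, Form.holds_and, BoolExpr.eval, beq_iff_eq]
    have key : ∀ (r : List (Fin M.dirs)) (u : List (Fin m)), u.length = s →
        ((M.walkF (.loc 5) (.loc 6) v r (.loc 7)).Holds s R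
          (Function.update e (.loc 7) u) ↔ N[g.walk i r]? = some u) := by
      intro r u hu
      rw [D.holds_walkF (update_len he _ hu) (by simp) h₅ (by simp) (by simp)]
      simp only [Function.update_self, Function.update_of_ne h₇]
      constructor
      · rintro ⟨j, hj, hj'⟩
        rwa [D.index_inj hi hj]
      · exact fun h => ⟨i, hi, h⟩
    constructor
    · rintro ⟨u, hu, h₁, h₂⟩
      exact D.index_inj ((key p u hu).mp h₁) ((key q u hu).mp h₂)
    · intro h
      obtain ⟨u, hu, hu'⟩ := D.exists_name (D.walk_lt (D.lt_size hi) p)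
      exact ⟨u, hu, (key p u hu).mpr hu', (key q u hu).mpr (h ▸ hu')⟩
  | not b ih => simp [boolF, ih, BoolExpr.eval]
  | and b c ih₁ ih₂ => simp [boolF, ih₁, ih₂, BoolExpr.eval]
  | or b c ih₁ ih₂ => simp [boolF, ih₁, ih₂, BoolExpr.eval]

lemma holds_matchF (he : ∀ v, (e v).length = s) {v : M.V} (h₅ : v ≠ .loc 5)
    (h₇ : v ≠ .loc 7) {ℓ : ℕ} :
    (M.matchF ℓ v).Holds s R e ↔ ∃ i, N[i]? = some (e v) ∧ i ∈ M.matchingAt g ℓ := by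
  unfold matchF matchingAt
  split
  · rename_i b hp
    simp only [hp, Form.holds_and, D.holds_nodeF he, Memory.matching, List.mem_filter,
      List.mem_range]
    constructor
    · rintro ⟨⟨i, hi⟩, h⟩
      exact ⟨i, hi, D.lt_size hi, (D.holds_boolF he h₅ h₇ hi b).mp h⟩
    · rintro ⟨i, hi, -, h⟩
      exact ⟨⟨i, hi⟩, (D.holds_boolF he h₅ h₇ hi b).mpr h⟩
  · simp

lemma holds_selectedF (he : ∀ v, (e v).length = s) {v : M.V} (h₅ : v ≠ .loc 5)
    (h₇ : v ≠ .loc 7) {σ : Fin M.prog.length → List (Fin m)} (hσ : ∀ l, e (.sel l) = σ l)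
    {ℓ : ℕ} :
    (M.selectedF ℓ v).Holds s R e ↔ ∃ i, N[i]? = some (e v) ∧ i ∈ M.selection g N σ ℓ := by
  rw [selectedF, Form.holds_and, D.holds_matchF he h₅ h₇]
  unfold matchingAt chosenF selection
  rcases hp : M.prog[ℓ]? with _ | (_ | _ | _ | _ | _ | ⟨_ | _, b⟩ | _) <;> simp
  have hℓ : ℓ < M.prog.length := (List.getElem?_eq_some_iff.mp hp).1
  simp only [hℓ, dite_true, Form.holds_eq, hσ, exists_true_left]
  constructor
  · rintro ⟨⟨i, hi, h⟩, h'⟩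
    exact ⟨i, hi, h, h' ▸ hi⟩
  · rintro ⟨i, hi, h, h'⟩
    exact ⟨⟨i, hi, h⟩, Option.some.inj (hi.symm.trans h')⟩

lemma holds_atF (he : ∀ v, (e v).length = s) {n : ℕ} {x y : M.V} (hn : n < M.prog.length) :
    (M.atF n x y).Holds s R e ↔
      ∃ t, (e x, t) ∈ θ ∧ t.pc = n ∧ N[t.center]? = some (e y) := by
  have := D.thr (M.line n) _ _ (he x) (he y)
  simp only [line_eq_iff hn] at this
  exact this

/-- Quantification over the center of an execution. -/
lemma holds_ex_atF (he : ∀ v, (e v).length = s) {n : ℕ} {x y : M.V} (hn : n < M.prog.length)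
    (hxy : x ≠ y) {φ : M.Fm} :
    (Form.ex y (.and (M.atF n x y) φ)).Holds s R e ↔ ∃ t, (e x, t) ∈ θ ∧ t.pc = n ∧
      ∃ u, u.length = s ∧ N[t.center]? = some u ∧ φ.Holds s R (Function.update e y u) := by
  simp only [Form.holds_ex, Form.holds_and]
  constructor
  · rintro ⟨u, hu, h, h'⟩
    obtain ⟨t, ht, hp, hc⟩ := (D.holds_atF (update_len he y hu) hn).mp h
    rw [Function.update_of_ne hxy] at ht
    rw [Function.update_self] at hc
    exact ⟨t, ht, hp, u, hu, hc, h'⟩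
  · rintro ⟨t, ht, hp, u, hu, hc, h'⟩
    refine ⟨u, hu, (D.holds_atF (update_len he y hu) hn).mpr ⟨t, ?_, hp, ?_⟩, h'⟩
    · rwa [Function.update_of_ne hxy]
    · rwa [Function.update_self]

lemma holds_ex_atF' (he : ∀ v, (e v).length = s) {n : ℕ} {x y : M.V} (hn : n < M.prog.length)
    (hxy : x ≠ y) :
    (Form.ex y (M.atF n x y)).Holds s R e ↔ ∃ t, (e x, t) ∈ θ ∧ t.pc = n := by
  have := D.holds_ex_atF he hn hxy (φ := .tru)
  simp only [Form.holds_ex, Form.holds_and, Form.holds_tru, and_true] at this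
  rw [Form.holds_ex, this]
  refine exists_congr fun t => and_congr_right fun ht => and_iff_left ?_
  exact D.exists_name (D.center_lt _ ht)

lemma holds_hitF (he : ∀ v, (e v).length = s) {n : ℕ} (hn : n < M.prog.length) :
    (M.hitF n).Holds s R e ↔ ∃ p ∈ θ, p.2.pc = n := by
  rw [hitF, Form.holds_ex]
  constructor
  · rintro ⟨u, hu, h⟩
    obtain ⟨t, ht, h⟩ := (D.holds_ex_atF' (update_len he _ hu) hn (by simp)).mp h
    exact ⟨_, ht, h⟩
  · rintro ⟨p, hp, h⟩
    refine ⟨p.1, D.thr_len _ hp,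
      (D.holds_ex_atF' (update_len he _ (D.thr_len _ hp)) hn (by simp)).mpr ⟨p.2, ?_, h⟩⟩
    rwa [Function.update_self]

lemma holds_anyF (he : ∀ v, (e v).length = s) : M.anyF.Holds s R e ↔ θ ≠ [] := by
  simp only [anyF, Form.holds_disj, List.mem_map, List.mem_range, exists_exists_and_eq_and, hitF,
    Form.holds_ex]
  constructor
  · rintro ⟨n, hn, u, hu, v, hv, h⟩
    obtain ⟨t, ht, -⟩ := (D.thr (M.line n) _ _ (update_len (update_len he _ hu) _ hv _)
      (update_len (update_len he _ hu) _ hv _)).mp h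
    exact List.ne_nil_of_mem ht
  · intro h
    obtain ⟨p, hp⟩ := List.exists_mem_of_ne_nil _ h
    obtain ⟨v, hv, hv'⟩ := D.exists_name (D.center_lt _ hp)
    -- Executions at non-existing lines count as well; these lines are all identified with the line
    -- `prog.length`.
    refine ⟨min p.2.pc M.prog.length, by omega, p.1, D.thr_len _ hp, v, hv,
      (D.thr _ _ _ (update_len (update_len he _ (D.thr_len _ hp)) _ hv _)
      (update_len (update_len he _ (D.thr_len _ hp)) _ hv _)).mpr ⟨p.2, ?_, ?_, ?_⟩⟩
    · simpa using hp
    · simp [line]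
    · simpa using hv'

lemma holds_newF (he : ∀ v, (e v).length = s) {x y : M.V} :
    (M.newF x y).Holds s R e ↔
      ∃ t, (e x, t) ∈ θ ∧ M.creates t = true ∧ N[t.center]? = some (e y) := by
  rw [newF, holds_lines]
  constructor
  · rintro ⟨n, hn, h⟩
    split at h
    · rename_i hp
      obtain ⟨t, ht, rfl, hc⟩ := (D.holds_atF he hn).mp h
      exact ⟨t, ht, by simp [creates, hp], hc⟩
    · exact h.elim
  · rintro ⟨t, ht, h, hc⟩
    unfold creates at h
    split at h
    · rename_i hp
      have hn := (List.getElem?_eq_some_iff.mp hp).1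
      refine ⟨t.pc, hn, ?_⟩
      simp only [hp]
      exact (D.holds_atF he hn).mpr ⟨t, ht, rfl, hc⟩
    · simp at h

lemma holds_setF (he : ∀ v, (e v).length = s) {d : Fin M.dirs} {x v : M.V} (hx : x ≠ .loc 3)
    (hv₃ : v ≠ .loc 3) (hv₅ : v ≠ .loc 5) (hv₆ : v ≠ .loc 6) :
    (M.setF d x v).Holds s R e ↔ ∃ t i j, (e x, t) ∈ θ ∧
      M.redirection g t = some (i, d, j) ∧ N[i]? = some (e v) := by
  rw [setF, holds_lines]
  constructor
  · rintro ⟨n, hn, h⟩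
    split at h
    · rename_i p d' q hp
      simp only [Form.holds_guard] at h
      obtain ⟨rfl, h⟩ := h
      obtain ⟨t, ht, rfl, u, hu, hc, h⟩ := (D.holds_ex_atF he hn hx).mp h
      obtain ⟨i, hi, h⟩ := (D.holds_walkF (update_len he _ hu) (by simp) (by simp) hv₅ hv₆).mp h
      rw [Function.update_self] at hi
      rw [Function.update_of_ne hv₃] at h
      rw [D.index_inj hi hc] at h
      exact ⟨t, _, g.walk t.center q, ht, by simp only [redirection, hp], h⟩
    · exact h.elim
  · rintro ⟨t, i, j, ht, h, hi⟩
    unfold redirection at h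
    split at h
    · rename_i p d' q hp
      simp only [Option.some.injEq, Prod.mk.injEq] at h
      obtain ⟨rfl, rfl, rfl⟩ := h
      have hn := (List.getElem?_eq_some_iff.mp hp).1
      obtain ⟨u, hu, hu'⟩ := D.exists_name (D.center_lt _ ht)
      refine ⟨t.pc, hn, ?_⟩
      simp only [hp, Form.holds_guard, true_and]
      refine (D.holds_ex_atF he hn hx).mpr ⟨t, ht, rfl, u, hu, hu',
        (D.holds_walkF (update_len he _ hu) (by simp) (by simp) hv₅ hv₆).mpr ⟨t.center, ?_, ?_⟩⟩
      · rwa [Function.update_self]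
      · rwa [Function.update_of_ne hv₃]
    · simp at h

lemma holds_setToF (he : ∀ v, (e v).length = s) {d : Fin M.dirs} {x v u : M.V} (hx : x ≠ .loc 3)
    (hv₃ : v ≠ .loc 3) (hv₅ : v ≠ .loc 5) (hv₆ : v ≠ .loc 6)
    (hu₃ : u ≠ .loc 3) (hu₅ : u ≠ .loc 5) (hu₆ : u ≠ .loc 6) :
    (M.setToF d x v u).Holds s R e ↔ ∃ t i j, (e x, t) ∈ θ ∧
      M.redirection g t = some (i, d, j) ∧ N[i]? = some (e v) ∧ N[j]? = some (e u) := by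
  rw [setToF, holds_lines]
  constructor
  · rintro ⟨n, hn, h⟩
    split at h
    · rename_i p d' q hp
      simp only [Form.holds_guard] at h
      obtain ⟨rfl, h⟩ := h
      obtain ⟨t, ht, rfl, r, hr, hc, h⟩ := (D.holds_ex_atF he hn hx).mp h
      obtain ⟨i, hi, h₁⟩ :=
        (D.holds_walkF (update_len he _ hr) (by simp) (by simp) hv₅ hv₆).mp h.1
      obtain ⟨j, hj, h₂⟩ :=
        (D.holds_walkF (update_len he _ hr) (by simp) (by simp) hu₅ hu₆).mp h.2
      rw [Function.update_self] at hi hj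
      rw [Function.update_of_ne hv₃] at h₁
      rw [Function.update_of_ne hu₃] at h₂
      rw [D.index_inj hi hc] at h₁
      rw [D.index_inj hj hc] at h₂
      exact ⟨t, _, _, ht, by simp only [redirection, hp], h₁, h₂⟩
    · exact h.elim
  · rintro ⟨t, i, j, ht, h, hi, hj⟩
    unfold redirection at h
    split at h
    · rename_i p d' q hp
      simp only [Option.some.injEq, Prod.mk.injEq] at h
      obtain ⟨rfl, rfl, rfl⟩ := h
      have hn := (List.getElem?_eq_some_iff.mp hp).1
      obtain ⟨r, hr, hr'⟩ := D.exists_name (D.center_lt _ ht)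
      refine ⟨t.pc, hn, ?_⟩
      simp only [hp, Form.holds_guard, true_and]
      refine (D.holds_ex_atF he hn hx).mpr ⟨t, ht, rfl, r, hr, hr',
        (D.holds_walkF (update_len he _ hr) (by simp) (by simp) hv₅ hv₆).mpr ⟨t.center, ?_, ?_⟩,
        (D.holds_walkF (update_len he _ hr) (by simp) (by simp) hu₅ hu₆).mpr ⟨t.center, ?_, ?_⟩⟩
      · rwa [Function.update_self]
      · rwa [Function.update_of_ne hv₃]
      · rwa [Function.update_self]
      · rwa [Function.update_of_ne hu₃]
    · simp at h

/-- Whether an execution goes on depends on its instruction only, so the symbol `a` and the number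
`n` of a new node are arbitrary. -/
lemma holds_aliveF (he : ∀ v, (e v).length = s) {x : M.V} (hx : x ≠ .loc 3) {a : Option α}
    {n : ℕ} : (M.aliveF x).Holds s R e ↔ ∃ t, (e x, t) ∈ θ ∧ M.next g a n t ≠ none := by
  rw [aliveF, holds_lines]
  constructor
  · rintro ⟨k, hk, h⟩
    have hp := List.getElem?_eq_getElem hk
    split at h
    · exact h.elim
    · exact h.elim
    · obtain ⟨t, ht, rfl⟩ := (D.holds_ex_atF' he hk hx).mp h
      refine ⟨t, ht, ?_⟩
      unfold next
      split <;> simp_all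
      cases hq : M.prog[t.pc] <;> simp_all
  · rintro ⟨t, ht, h⟩
    by_cases hk : t.pc < M.prog.length
    · refine ⟨t.pc, hk, ?_⟩
      split
      · simp_all [next]
      · simp_all [next]
      · exact (D.holds_ex_atF' he hk hx).mpr ⟨t, ht, rfl⟩
    · simp [next, List.getElem?_eq_none (not_lt.mp hk)] at h

lemma holds_readF (he : ∀ v, (e v).length = s) :
    M.readF.Holds s R e ↔ ∃ p ∈ θ, M.reads p.2 = true := by
  rw [readF, holds_lines]
  constructor
  · rintro ⟨k, hk, h⟩
    split at h
    · rename_i hp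
      obtain ⟨p, hp', rfl⟩ := (D.holds_hitF he hk).mp h
      exact ⟨p, hp', by simp [reads, hp]⟩
    · exact h.elim
  · rintro ⟨p, hp', h⟩
    unfold reads at h
    split at h
    · rename_i hp
      have hk := (List.getElem?_eq_some_iff.mp hp).1
      refine ⟨p.2.pc, hk, ?_⟩
      simp only [hp]
      exact (D.holds_hitF he hk).mpr ⟨p, hp', rfl⟩
    · simp at h

lemma holds_contF_old (he : ∀ v, (e v).length = s) {q : Fin (M.prog.length + 1)} {a : Option α}
    {x y : M.V} (hx : x ≠ .loc 3) (hy₃ : y ≠ .loc 3) (hy₅ : y ≠ .loc 5) (hy₆ : y ≠ .loc 6)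
    (hy₇ : y ≠ .loc 7) (n : ℕ) :
    (M.contF q 0 a x y).Holds s R e ↔ ∃ t t', (e x, t) ∈ θ ∧ M.creates t = false ∧
      M.next g a n t = some t' ∧ M.line t'.pc = q ∧ N[t'.center]? = some (e y) := by
  rw [contF, holds_lines]
  constructor
  · rintro ⟨k, hk, h⟩
    split at h
    · simp at h
    · rename_i hp
      simp only [Form.holds_guard, true_and] at h
      obtain ⟨t, ht, rfl, hc⟩ := (D.holds_atF he hk).mp h.2
      exact ⟨t, ⟨t.pc + 1, t.center, t.main⟩, ht, by simp [creates, hp], by simp only [next, hp], h.1, hc⟩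
    · rename_i p hp
      simp only [Form.holds_guard, true_and] at h
      obtain ⟨hq, h⟩ := h
      obtain ⟨t, ht, rfl, r, hr, hc, h⟩ := (D.holds_ex_atF he hk hx).mp h
      obtain ⟨i, hi, h⟩ :=
        (D.holds_walkF (update_len he _ hr) (by simp) (by simp) hy₅ hy₆).mp h
      rw [Function.update_self] at hi
      rw [Function.update_of_ne hy₃] at h
      rw [D.index_inj hi hc] at h
      exact ⟨t, ⟨t.pc + 1, g.walk t.center p, t.main⟩, ht, by simp [creates, hp],
        by simp only [next, hp], hq, h⟩
    · rename_i p p' ln hp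
      simp only [Form.holds_guard, true_and, Form.holds_and, Form.holds_or, Form.holds_not,
        Form.holds_tru, and_true] at h
      obtain ⟨h₁, h₂⟩ := h
      obtain ⟨t, ht, rfl, hc⟩ := (D.holds_atF he hk).mp h₁
      refine ⟨t, ⟨if g.walk t.center p = g.walk t.center p' then ln else t.pc + 1, t.center, t.main⟩,
        ht, by simp [creates, hp], by simp only [next, hp], ?_, hc⟩
      rw [D.holds_boolF he hy₅ hy₇ hc] at h₂
      simp only [BoolExpr.eval, beq_iff_eq] at h₂
      rcases h₂ with ⟨h, h'⟩ | ⟨h, h'⟩ <;> simp [h, h']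
    · rename_i ln hp
      simp only [Form.holds_guard, true_and] at h
      obtain ⟨t, ht, rfl, hc⟩ := (D.holds_atF he hk).mp h.2
      exact ⟨t, ⟨a.elim (t.pc + 1) ln, t.center, t.main⟩, ht, by simp [creates, hp],
        by simp only [next, hp], h.1, hc⟩
    · exact h.elim
  · rintro ⟨t, t', ht, hn, h, hq, hc⟩
    by_cases hk : t.pc < M.prog.length
    swap
    · simp [next, List.getElem?_eq_none (not_lt.mp hk)] at h
    refine ⟨t.pc, hk, ?_⟩
    unfold next at h
    split at h <;> rename_i hp <;> simp only [Option.some.injEq, reduceCtorEq] at h <;>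
      try subst h
    · simp [creates, hp] at hn
    · simp only [hp, Form.holds_guard, true_and]
      exact ⟨hq, (D.holds_atF he hk).mpr ⟨t, ht, rfl, hc⟩⟩
    · simp only [hp, Form.holds_guard, true_and]
      obtain ⟨r, hr, hr'⟩ := D.exists_name (D.center_lt _ ht)
      refine ⟨hq, (D.holds_ex_atF he hk hx).mpr ⟨t, ht, rfl, r, hr, hr',
        (D.holds_walkF (update_len he _ hr) (by simp) (by simp) hy₅ hy₆).mpr ⟨t.center, ?_, ?_⟩⟩⟩
      · rwa [Function.update_self]
      · rwa [Function.update_of_ne hy₃]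
    · simp only [hp, Form.holds_guard, true_and, Form.holds_and, Form.holds_or, Form.holds_not,
        Form.holds_tru, and_true]
      refine ⟨(D.holds_atF he hk).mpr ⟨t, ht, rfl, hc⟩, ?_⟩
      rw [D.holds_boolF he hy₅ hy₇ hc]
      simp only [BoolExpr.eval, beq_iff_eq]
      split at hq <;> simp_all
    · simp only [hp, Form.holds_guard, true_and]
      exact ⟨hq, (D.holds_atF he hk).mpr ⟨t, ht, rfl, hc⟩⟩

lemma holds_contF_new (he : ∀ v, (e v).length = s) {q : Fin (M.prog.length + 1)} {a : Option α}
    {x y : M.V} (hx : x ≠ .loc 3) :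
    (M.contF q 1 a x y).Holds s R e ↔ ∃ t, (e x, t) ∈ θ ∧ M.creates t = true ∧
      M.line (t.pc + 1) = q ∧ e x = e y := by
  rw [contF, holds_lines]
  constructor
  · rintro ⟨k, hk, h⟩
    split at h
    · rename_i hp
      simp only [Form.holds_guard, true_and, Form.holds_and, Form.holds_eq] at h
      obtain ⟨t, ht, rfl⟩ := (D.holds_ex_atF' he hk hx).mp h.2.2
      exact ⟨t, ht, by simp [creates, hp], h.1, h.2.1⟩
    all_goals simp at h
  · rintro ⟨t, ht, h, hq, hxy⟩
    unfold creates at h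
    split at h
    · rename_i hp
      have hk := (List.getElem?_eq_some_iff.mp hp).1
      refine ⟨t.pc, hk, ?_⟩
      simp only [hp, Form.holds_guard, true_and, Form.holds_and, Form.holds_eq]
      exact ⟨hq, hxy, (D.holds_ex_atF' he hk hx).mpr ⟨t, ht, rfl⟩⟩
    · simp at h

omit D in
lemma not_holds_contF {q : Fin (M.prog.length + 1)} {a : Option α} {x y : M.V} (h : ℕ) :
    ¬ (M.contF q (h + 2) a x y).Holds s R e := by
  rw [contF, holds_lines]
  rintro ⟨k, hk, h⟩
  split at h <;> simp at h

end Describes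

end MWSMM.Machine

/-! ### The effect of a step on graph and executions, in terms of names. -/

namespace MWSMM.Machine

open OfflineTM (Form System)

variable {α : Type} (M : Machine α)

/-- After a step of the executions in `l`, which are sorted by their names, the `d` edge of the old
node `i` points to `j`. -/
def EdgeSpec {m : ℕ} (g : Memory M.dirs) (l : List (List (Fin m) × Thread)) (i : ℕ)
    (d : Fin M.dirs) (j : ℕ) : Prop :=
  (∃ p ∈ l, M.redirection g p.2 = some (i, d, j) ∧
    ∀ p' ∈ l, p.1 < p'.1 → ∀ j', M.redirection g p'.2 ≠ some (i, d, j')) ∨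
  (∀ p ∈ l, ∀ j', M.redirection g p.2 ≠ some (i, d, j')) ∧ j = g.ptr i d

/-- The names of the nodes after a step of the executions in `l`. -/
def newNames {m : ℕ} (N : List (List (Fin (m + 2)))) (l : List (List (Fin (m + 2)) × Thread)) :
    List (List (Fin (m + 2))) :=
  N.map (0 :: ·) ++ (l.filter fun p => M.creates p.2).map fun p => 1 :: p.1

variable {M}

namespace EdgeSpec

variable {m : ℕ} {g : Memory M.dirs} {l : List (List (Fin m) × Thread)} {i j j' : ℕ}
  {d : Fin M.dirs}

/-- The last execution that redirects the edge is unique because the names are linearly ordered and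
distinct. -/
lemma unique (hl : (l.map Prod.fst).Pairwise (· < ·)) (h : M.EdgeSpec g l i d j)
    (h' : M.EdgeSpec g l i d j') : j = j' := by
  rcases h with ⟨p, hp, hr, hm⟩ | ⟨h₁, rfl⟩ <;> rcases h' with ⟨p', hp', hr', hm'⟩ | ⟨h₁', rfl⟩
  · have hlt : p.1 = p'.1 := by
      rcases lt_trichotomy p.1 p'.1 with h | h | h
      · exact absurd hr' (hm p' hp' h j')
      · exact h
      · exact absurd hr (hm' p hp h j)
    have : p = p' := List.inj_on_of_nodup_map (hl.imp fun h => h.ne) hp hp' hlt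
    subst this
    rw [hr] at hr'
    simp_all
  · exact absurd hr (h₁' p hp j)
  · exact absurd hr' (h₁ p' hp' j')
  · rfl

lemma snoc_of_ne {p : List (Fin m) × Thread} (h : M.EdgeSpec g l i d j)
    (hp : ∀ j', M.redirection g p.2 ≠ some (i, d, j')) : M.EdgeSpec g (l ++ [p]) i d j := by
  rcases h with ⟨q, hq, hr, hm⟩ | ⟨h, rfl⟩
  · refine .inl ⟨q, by simp [hq], hr, fun p' hp' hlt => ?_⟩
    rcases List.mem_append.mp hp' with h | h
    · exact hm p' h hlt
    · rw [List.mem_singleton.mp h]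
      exact hp
  · refine .inr ⟨fun p' hp' => ?_, rfl⟩
    rcases List.mem_append.mp hp' with h' | h'
    · exact h p' h'
    · rw [List.mem_singleton.mp h']
      exact hp

lemma snoc_of_eq {p : List (Fin m) × Thread}
    (hl : ((l ++ [p]).map Prod.fst).Pairwise (· < ·))
    (hp : M.redirection g p.2 = some (i, d, j)) : M.EdgeSpec g (l ++ [p]) i d j := by
  refine .inl ⟨p, by simp, hp, fun p' hp' hlt => ?_⟩
  rw [List.map_append, List.pairwise_append] at hl
  rcases List.mem_append.mp hp' with h | h
  · exact absurd (hl.2.2 p'.1 (List.mem_map_of_mem h) p.1 (by simp)) hlt.asymm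
  · rw [List.mem_singleton.mp h] at hlt
    exact absurd hlt (lt_irrefl _)

end EdgeSpec

lemma newNames_zero {m : ℕ} {N : List (List (Fin (m + 2)))}
    {l : List (List (Fin (m + 2)) × Thread)} {n : ℕ} {x : List (Fin (m + 2))} :
    (M.newNames N l)[n]? = some (0 :: x) ↔ N[n]? = some x := by
  unfold newNames
  by_cases h : n < N.length
  · rw [List.getElem?_append_left (by simpa), List.getElem?_map]
    simp
  · rw [List.getElem?_append_right (by simpa using h), List.getElem?_map,
      List.getElem?_eq_none (not_lt.mp h)]
    simp

lemma newNames_one {m : ℕ} {N : List (List (Fin (m + 2)))}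
    {l : List (List (Fin (m + 2)) × Thread)} {n : ℕ} {x : List (Fin (m + 2))}
    (h : (M.newNames N l)[n]? = some (1 :: x)) :
    N.length ≤ n ∧ ∃ t, (x, t) ∈ l ∧ M.creates t = true := by
  unfold newNames at h
  by_cases hn : n < N.length
  · rw [List.getElem?_append_left (by simpa), List.getElem?_map] at h
    simp at h
  · refine ⟨not_lt.mp hn, ?_⟩
    rw [List.getElem?_append_right (by simpa using hn)] at h
    have := List.mem_of_getElem? h
    simpa using this

lemma newNames_snoc {m : ℕ} {N : List (List (Fin (m + 2)))}
    {l : List (List (Fin (m + 2)) × Thread)} {p : List (Fin (m + 2)) × Thread} :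
    M.newNames N (l ++ [p]) =
      M.newNames N l ++ if M.creates p.2 then [1 :: p.1] else [] := by
  unfold newNames
  by_cases h : M.creates p.2 <;> simp [h]

/-- Separates the change of the graph from the fate of the execution, so that the proofs about a
step need not go through all instructions again. -/
lemma execThread_eq (g : Memory M.dirs) (a : Option α) (acc : Memory M.dirs × List Thread)
    (t : Thread) : M.execThread g a acc t =
      (if M.creates t then acc.1.create t.center else
        (M.redirection g t).elim acc.1 fun r => acc.1.redirect r.1 r.2.1 r.2.2,
        acc.2 ++ (M.next g a acc.1.size t).toList) := by
  unfold execThread creates redirection next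
  rcases M.prog[t.pc]? with _ | (_ | _ | _ | _ | _ | _ | _) <;> simp

lemma next_of_not_creates {g : Memory M.dirs} {a : Option α} {t : Thread}
    (h : M.creates t = false) (n n' : ℕ) : M.next g a n t = M.next g a n' t := by
  unfold creates at h
  unfold next
  rcases hp : M.prog[t.pc]? with _ | (_ | _ | _ | _ | _ | _ | _) <;> simp_all

lemma next_of_creates {g : Memory M.dirs} {a : Option α} {t : Thread}
    (h : M.creates t = true) (n : ℕ) : M.next g a n t = some ⟨t.pc + 1, n, t.main⟩ := by
  unfold creates at h
  unfold next
  rcases hp : M.prog[t.pc]? with _ | (_ | _ | _ | _ | _ | _ | _) <;> simp_all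

lemma next_main {g : Memory M.dirs} {a : Option α} {t t' : Thread} {n : ℕ}
    (h : M.next g a n t = some t') : t'.main = t.main := by
  unfold next at h
  rcases hp : M.prog[t.pc]? with _ | (_ | _ | _ | _ | _ | _ | _) <;>
    simp only [hp, Option.some.injEq, reduceCtorEq] at h <;> simp [← h]

lemma redirection_of_creates {g : Memory M.dirs} {t : Thread}
    (h : M.creates t = true) : M.redirection g t = none := by
  unfold creates at h
  unfold redirection
  rcases hp : M.prog[t.pc]? with _ | (_ | _ | _ | _ | _ | _ | _) <;> simp_all

/-- The result of a step, for executions with names. -/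
structure Stepped {m : ℕ} (g : Memory M.dirs) (a : Option α) (N : List (List (Fin (m + 2))))
    (l : List (List (Fin (m + 2)) × Thread)) (r : Memory M.dirs × List Thread)
    (Θ : List (List (Fin (m + 2)) × Thread)) : Prop where
  size : (M.newNames N l).length = r.1.size
  map_snd : Θ.map Prod.snd = r.2
  sublist : (Θ.map Prod.fst).Sublist (l.map fun p => 0 :: p.1)
  mem_iff : ∀ y t', (y, t') ∈ Θ ↔ ∃ x t n, (x, t) ∈ l ∧ y = 0 :: x ∧ M.next g a n t = some t' ∧
    (M.creates t = true → (M.newNames N l)[n]? = some (1 :: x))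
  old : ∀ i < g.size, ∀ d, M.EdgeSpec g l i d (r.1.ptr i d)
  new : ∀ n x, (M.newNames N l)[n]? = some (1 :: x) →
    ∃ t, (x, t) ∈ l ∧ M.creates t = true ∧ ∀ d, r.1.ptr n d = t.center

/-- A step is a fold from the left, so the induction appends one execution at the end. Its name is
the greatest so far: its redirection prevails, and its node gets the next free number. -/
lemma exists_stepped {m : ℕ} {g : Memory M.dirs} (a : Option α) {N : List (List (Fin (m + 2)))}
    (hN : N.length = g.size) {l : List (List (Fin (m + 2)) × Thread)}
    (hl : (l.map Prod.fst).Pairwise (· < ·))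
    (hr : ∀ p ∈ l, ∀ i d j, M.redirection g p.2 = some (i, d, j) → i < g.size) :
    ∃ Θ, Stepped g a N l (l.foldl (fun acc p => M.execThread g a acc p.2) (g, [])) Θ := by
  induction l using List.reverseRecOn with
  | nil =>
    refine ⟨[], by simp [newNames, hN], rfl, by simp, by simp, fun i _ d => .inr (by simp), ?_⟩
    intro n x h
    obtain ⟨-, t, ht, -⟩ := newNames_one h
    simp at ht
  | append_singleton l p ih =>
    have hl' : (l.map Prod.fst).Pairwise (· < ·) := by
      rw [List.map_append] at hl
      exact (List.pairwise_append.mp hl).1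
    have hlt : ∀ x t, (x, t) ∈ l → x < p.1 := by
      intro x t h
      rw [List.map_append] at hl
      exact (List.pairwise_append.mp hl).2.2 x (List.mem_map_of_mem h) p.1 (by simp)
    obtain ⟨Θ, S⟩ := ih hl' fun q hq => hr q (by simp [hq])
    rw [List.foldl_append, List.foldl_cons, List.foldl_nil]
    generalize l.foldl (fun acc p => M.execThread g a acc p.2) (g, []) = r at S
    have hsize : (M.newNames N l).length ≥ N.length := by simp [newNames]
    -- The appended execution does not change the numbers of the nodes created by its predecessors.
    have hpre : ∀ x t, (x, t) ∈ l → ∀ n : ℕ, (M.newNames N (l ++ [p]))[n]? = some (1 :: x) ↔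
        (M.newNames N l)[n]? = some (1 :: x) := by
      intro x t h n
      rw [newNames_snoc, List.getElem?_append]
      split
      · rfl
      · rename_i hn
        rw [List.getElem?_eq_none (not_lt.mp hn)]
        have := (hlt x t h).ne
        split <;> simp [List.getElem?_singleton, this.symm]
    rw [execThread_eq]
    refine ⟨Θ ++ (M.next g a r.1.size p.2).toList.map fun t => (0 :: p.1, t), ?_, ?_, ?_, ?_, ?_, ?_⟩
    · rw [newNames_snoc]
      by_cases hc : M.creates p.2 = true
      · simp [hc, S.size, Memory.create]
      · simp only [hc, if_false, List.append_nil, S.size, Bool.false_eq_true]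
        cases M.redirection g p.2 <;> rfl
    · rw [List.map_append, S.map_snd, List.map_map]
      simp [Function.comp_def]
    · rw [List.map_append, List.map_append]
      refine S.sublist.append ?_
      cases M.next g a r.1.size p.2 <;> simp
    · intro y t'
      rw [List.mem_append, S.mem_iff]
      constructor
      · rintro (⟨x, t, n, hx, rfl, hn, hc⟩ | h)
        · exact ⟨x, t, n, by simp [hx], rfl, hn, fun h => (hpre x t hx n).mpr (hc h)⟩
        · simp only [List.mem_map, Option.mem_toList, Prod.mk.injEq] at h
          obtain ⟨_, h, rfl, rfl⟩ := h
          refine ⟨p.1, p.2, r.1.size, by simp, rfl, h, fun hc => ?_⟩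
          rw [newNames_snoc, ← S.size]
          simp [hc]
      · rintro ⟨x, t, n, hx, rfl, hn, hc⟩
        rcases List.mem_append.mp hx with h | h
        · exact .inl ⟨x, t, n, h, rfl, hn, fun h' => (hpre x t h n).mp (hc h')⟩
        · rw [List.mem_singleton] at h
          subst h
          refine .inr ?_
          simp only [List.mem_map, Option.mem_toList, Prod.mk.injEq]
          refine ⟨t', ?_, by simp⟩
          by_cases h : M.creates t = true
          · have := hc h
            rw [newNames_snoc, List.getElem?_append] at this
            split at this
            · obtain ⟨-, t₀, ht₀, -⟩ := newNames_one this
              exact absurd (hlt _ _ ht₀) (lt_irrefl _)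
            · rename_i hn'
              have hlen := (List.getElem?_eq_some_iff.mp this).1
              have : n = r.1.size := by
                rw [← S.size]
                simp at hlen
                omega
              rwa [← this]
          · rw [next_of_not_creates (by simpa using h) _ n]
            exact hn
    · intro i hi d
      by_cases hc : M.creates p.2 = true
      · have hni : i ≠ r.1.size := by rw [← S.size]; omega
        simp only [hc, if_true, Memory.create, Function.update_of_ne hni]
        refine (S.old i hi d).snoc_of_ne ?_
        simp [redirection_of_creates hc]
      · simp only [hc, if_false, Bool.false_eq_true]
        rcases hp : M.redirection g p.2 with _ | ⟨i', d', j'⟩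
        · exact (S.old i hi d).snoc_of_ne (by simp [hp])
        · simp only [Option.elim_some, Memory.redirect]
          by_cases h : i = i' ∧ d = d'
          · obtain ⟨rfl, rfl⟩ := h
            simp only [Function.update_self]
            exact EdgeSpec.snoc_of_eq hl hp
          · have : Function.update r.1.ptr i' (Function.update (r.1.ptr i') d' j') i d =
                r.1.ptr i d := by
              by_cases hi' : i = i'
              · subst hi'
                rw [Function.update_self, Function.update_of_ne fun hd => h ⟨rfl, hd⟩]
              · rw [Function.update_of_ne hi']
            rw [this]
            refine (S.old i hi d).snoc_of_ne fun j'' hj => ?_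
            rw [hp] at hj
            simp only [Option.some.injEq, Prod.mk.injEq] at hj
            exact h ⟨hj.1.symm, hj.2.1.symm⟩
    · intro n x h
      rw [newNames_snoc, List.getElem?_append] at h
      by_cases hc : M.creates p.2 = true
      · simp only [hc, if_true, Memory.create]
        split at h
        · rename_i hn
          obtain ⟨t, ht, htc, hd⟩ := S.new n x h
          refine ⟨t, by simp [ht], htc, fun d => ?_⟩
          rw [Function.update_of_ne (by rw [← S.size]; exact hn.ne), hd]
        · rename_i hn
          rw [List.getElem?_singleton] at h
          split at h
          · rename_i hn'
            have : n = r.1.size := by rw [← S.size]; omega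
            subst this
            simp only [Option.some.injEq, List.cons.injEq, true_and] at h
            exact ⟨p.2, by simp [← h], hc, fun d => by rw [Function.update_self]⟩
          · simp at h
      · simp only [hc, if_false, Bool.false_eq_true, List.getElem?_nil] at h ⊢
        split at h
        · obtain ⟨t, ht, htc, hd⟩ := S.new n x h
          refine ⟨t, by simp [ht], htc, fun d => ?_⟩
          rcases hp : M.redirection g p.2 with _ | ⟨i', d', j'⟩
          · exact hd d
          -- Only edges of old nodes are redirected, so the node `n` created in this step keeps its
          -- edges.
          · have := hr p (by simp) _ _ _ hp
            have := (newNames_one h).1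
            simp only [Option.elim_some, Memory.redirect]
            rw [Function.update_of_ne (by omega), hd]
        · simp at h

end MWSMM.Machine

/-! ### Configurations with names: new executions and `match` instructions. -/

namespace MWSMM.Machine

open OfflineTM (Form System)

variable {α : Type} (M : Machine α)

/-- The relations `R` describe the configuration `c`, where the nodes have the names in `N`, and the
executions have the names in `θ`. -/
structure Models {m : ℕ} (s : ℕ)
    (R : Kind M.prog.length M.dirs → List (Fin (m + 2)) → List (Fin (m + 2)) → Prop)
    (c : Config M.dirs) (N : List (List (Fin (m + 2)))) (θ : List (List (Fin (m + 2)) × Thread)) :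
    Prop extends M.Describes s R c.mem N θ where
  map_snd : θ.map Prod.snd = c.threads
  sorted_nodes : N.Pairwise (· < ·)
  sorted : (θ.map Prod.fst).Pairwise (· < ·)
  main_iff : ∀ p ∈ θ, p.2.main = true ↔ p.1 = List.replicate s 0
  center_lt_size : c.center < c.mem.size
  center : ∀ x, x.length = s → (R .center x x ↔ N[c.center]? = some x)

/-- The configuration after a step in which new executions are started at the given lines. -/
def stepTo (sel : ℕ → List ℕ) (ls : List ℕ) (a : Option α) (pos : ℕ) (c : Config M.dirs) :
    Config M.dirs :=
  let r := c.threads.foldl (M.execThread c.mem a) (c.mem, [])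
  { mem := r.1
    center := (r.2.find? fun τ => τ.main).elim c.center fun τ => τ.center
    threads := r.2 ++ forks sel ls
    pos := pos }

/-- The new executions, with their names. -/
def namedForks {m : ℕ} (N : List (List (Fin (m + 2)))) (sel : ℕ → List ℕ) (ls : List (ℕ × ℕ)) :
    List (List (Fin (m + 2)) × Thread) :=
  ls.flatMap fun p => (sel p.2).map fun v =>
    (Fin.ofNat (m + 2) (p.1 + 2) :: N.getD v [], ⟨p.2 + 1, v, false⟩)

variable {M}

lemma namedForks_map_snd {m : ℕ} {N : List (List (Fin (m + 2)))} {sel : ℕ → List ℕ}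
    {ls : List (ℕ × ℕ)} :
    (namedForks N sel ls).map Prod.snd = forks sel (ls.map Prod.snd) := by
  induction ls with
  | nil => rfl
  | cons p ls ih =>
    simp only [namedForks, forks, List.flatMap_cons, List.map_append, List.map_cons] at ih ⊢
    rw [ih]
    simp [Function.comp_def]

/-- The bounds on the indices and on the nodes exclude a wrap-around of the letter `j + 2` and the
default name. -/
lemma mem_namedForks {m : ℕ} {N : List (List (Fin (m + 2)))} {sel : ℕ → List ℕ}
    {ls : List (ℕ × ℕ)} (hls : ∀ p ∈ ls, p.1 < m) (hsel : ∀ ℓ, ∀ v ∈ sel ℓ, v < N.length)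
    {y : List (Fin (m + 2))} {t : Thread} :
    (y, t) ∈ namedForks N sel ls ↔ ∃ (j : Fin (m + 2)) (k ℓ : ℕ) (x : List (Fin (m + 2))) (v : ℕ),
      j.val = k + 2 ∧ (k, ℓ) ∈ ls ∧ v ∈ sel ℓ ∧ N[v]? = some x ∧ y = j :: x ∧
      t = ⟨ℓ + 1, v, false⟩ := by
  simp only [namedForks, List.mem_flatMap, List.mem_map, Prod.mk.injEq, Prod.exists]
  constructor
  · rintro ⟨k, ℓ, hk, v, hv, rfl, rfl⟩
    refine ⟨Fin.ofNat (m + 2) (k + 2), k, ℓ, N.getD v [], v, ?_, hk, hv, ?_, rfl, rfl⟩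
    · have := hls _ hk
      simp only [Fin.val_ofNat]
      exact Nat.mod_eq_of_lt (by simpa using this)
    · have := hsel _ _ hv
      simp [List.getD_eq_getElem?_getD, List.getElem?_eq_getElem this]
  · rintro ⟨j, k, ℓ, x, v, hj, hk, hv, hx, rfl, rfl⟩
    refine ⟨k, ℓ, hk, v, hv, ?_, rfl⟩
    have : Fin.ofNat (m + 2) (k + 2) = j := by
      rw [← hj]
      simp
    rw [this, List.getD_eq_getElem?_getD, hx]
    rfl

lemma namedForks_sorted {m : ℕ} {N : List (List (Fin (m + 2)))} (hN : N.Pairwise (· < ·))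
    {sel : ℕ → List ℕ} {ls : List (ℕ × ℕ)} (hls : ∀ p ∈ ls, p.1 < m)
    (hs : (ls.map Prod.fst).Pairwise (· < ·)) (hsel : ∀ ℓ, ∀ v ∈ sel ℓ, v < N.length)
    (hsel' : ∀ ℓ, (sel ℓ).Pairwise (· < ·)) :
    ((namedForks N sel ls).map Prod.fst).Pairwise (· < ·) := by
  rw [List.pairwise_map] at hs ⊢
  rw [namedForks, List.pairwise_flatMap]
  constructor
  · intro p hp
    rw [List.pairwise_map]
    refine (hsel' p.2).imp_of_mem fun {v v'} hv hv' h => List.Lex.cons ?_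
    have h₁ := hsel _ _ hv
    have h₂ := hsel _ _ hv'
    simp only [List.getD_eq_getElem?_getD, List.getElem?_eq_getElem h₁,
      List.getElem?_eq_getElem h₂, Option.getD_some]
    exact List.pairwise_iff_getElem.mp hN v v' h₁ h₂ h
  · refine hs.imp_of_mem fun {p p'} hp hp' h => ?_
    simp only [List.mem_map]
    rintro _ ⟨v, hv, rfl⟩ _ ⟨v', hv', rfl⟩
    refine List.Lex.rel ?_
    have h₁ := hls p hp
    have h₂ := hls p' hp'
    rw [Fin.lt_def, Fin.val_ofNat, Fin.val_ofNat, Nat.mod_eq_of_lt (by omega),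
      Nat.mod_eq_of_lt (by omega)]
    omega

lemma matching_sorted (g : Memory M.dirs) (b : BoolExpr M.dirs) :
    (g.matching b).Pairwise (· < ·) :=
  List.pairwise_lt_range.filter _

lemma selection_sorted {m : ℕ} (g : Memory M.dirs) (N : List (List (Fin m)))
    (σ : Fin M.prog.length → List (Fin m)) (ℓ : ℕ) :
    (M.selection g N σ ℓ).Pairwise (· < ·) := by
  unfold selection
  split
  · exact matching_sorted g _
  · exact (matching_sorted g _).filter _
  · exact List.Pairwise.nil

lemma lt_of_mem_selection {m : ℕ} {g : Memory M.dirs} {N : List (List (Fin m))}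
    {σ : Fin M.prog.length → List (Fin m)} {ℓ v : ℕ} (h : v ∈ M.selection g N σ ℓ) :
    v < g.size := by
  unfold selection at h
  split at h
  · exact (by simpa [Memory.matching] using h : v < g.size ∧ _).1
  · exact (by simpa [Memory.matching] using h : v < g.size ∧ _).1
  · simp at h

/-- Since names are unique, at most one node has the chosen name; so a selection by name is a
possible outcome unless it misses all matching nodes. -/
lemma selects_iff {m s : ℕ} {R : Kind M.prog.length M.dirs → List (Fin m) → List (Fin m) → Prop}
    {g : Memory M.dirs} {N : List (List (Fin m))} {θ : List (List (Fin m) × Thread)}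
    (D : M.Describes s R g N θ) (σ : Fin M.prog.length → List (Fin m)) (ℓ : ℕ) :
    M.Selects g ℓ (M.selection g N σ ℓ) ↔
      (M.matchingAt g ℓ ≠ [] → M.selection g N σ ℓ ≠ []) := by
  unfold Selects matchingAt selection
  rcases hp : M.prog[ℓ]? with _ | (_ | _ | _ | _ | _ | ⟨_ | _, b⟩ | _) <;>
    simp only [ne_eq, not_true_eq_false, imp_self]
  have hℓ : ℓ < M.prog.length := (List.getElem?_eq_some_iff.mp hp).1
  simp only [hℓ, exists_true_left]
  constructor
  · rintro (⟨h, -⟩ | ⟨v, -, h⟩)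
    · exact fun h' => absurd h h'
    · simp [h]
  · intro h
    by_cases hb : g.matching b = []
    · exact .inl ⟨hb, by simp [hb]⟩
    · refine .inr ?_
      have hne := h hb
      generalize hf : (g.matching b).filter (fun v => decide (N[v]? = some (σ ⟨ℓ, hℓ⟩))) = f at hne
      have hnd : f.Nodup := hf ▸ ((matching_sorted g b).filter _).imp fun h => h.ne
      have hmem : ∀ u ∈ f, u ∈ g.matching b ∧ N[u]? = some (σ ⟨ℓ, hℓ⟩) := by
        intro u hu
        rw [← hf] at hu
        simpa using hu
      rcases f with _ | ⟨v, _ | ⟨u, l⟩⟩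
      · exact absurd rfl hne
      · exact ⟨v, (hmem v (by simp)).1, rfl⟩
      · have := D.index_inj (hmem v (by simp)).2 (hmem u (by simp)).2
        simp [this] at hnd

/-- Every possible outcome of the `match` instructions is described by names of nodes. -/
lemma exists_selection {m s : ℕ}
    {R : Kind M.prog.length M.dirs → List (Fin (m + 1)) → List (Fin (m + 1)) → Prop}
    {g : Memory M.dirs} {N : List (List (Fin (m + 1)))}
    {θ : List (List (Fin (m + 1)) × Thread)} (D : M.Describes s R g N θ) {sel : ℕ → List ℕ}
    (hsel : ∀ ℓ, M.Selects g ℓ (sel ℓ)) :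
    ∃ σ : Fin M.prog.length → List (Fin (m + 1)),
      (∀ l, (σ l).length = s) ∧ M.selection g N σ = sel := by
  have key : ∀ l : Fin M.prog.length, ∃ x : List (Fin (m + 1)), x.length = s ∧
      ∀ σ, σ l = x → M.selection g N σ l = sel l := by
    intro l
    have := hsel l
    unfold Selects at this
    split at this
    · rename_i b hp
      exact ⟨List.replicate s 0, by simp, fun σ _ => by simp only [selection, hp, this]⟩
    · rename_i b hp
      rcases this with ⟨h, h'⟩ | ⟨v, hv, h⟩
      · exact ⟨List.replicate s 0, by simp, fun σ _ => by simp only [selection, hp, h, h']; simp⟩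
      · have hv' : v < g.size := by simp [Memory.matching] at hv; exact hv.1
        -- The chosen node is recorded by its name; filtering by this name leaves just this node, as
        -- the list of matching nodes has no repetitions.
        obtain ⟨x, hx, hx'⟩ := D.exists_name hv'
        refine ⟨x, hx, fun σ hσ => ?_⟩
        simp only [selection, hp, h, l.2, exists_true_left, hσ]
        have : ∀ u, N[u]? = some x ↔ u = v := fun u =>
          ⟨fun hu => D.index_inj hu hx', fun hu => hu ▸ hx'⟩
        simp only [this]
        have hnd : (g.matching b).Nodup := (matching_sorted g b).imp fun h => h.ne
        rw [List.filter_eq, List.count_eq_one_of_mem hnd hv]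
        rfl
    · rename_i h₁ h₂
      refine ⟨List.replicate s 0, by simp, fun σ _ => ?_⟩
      rw [this]
      unfold selection
      split
      · rename_i b hp
        exact absurd hp (h₁ b)
      · rename_i b hp
        exact absurd hp (h₂ b)
      · rfl
  choose x hx hx' using key
  refine ⟨x, hx, funext fun ℓ => ?_⟩
  by_cases h : ℓ < M.prog.length
  · exact hx' ⟨ℓ, h⟩ x rfl
  · have hn := List.getElem?_eq_none (not_lt.mp h)
    have := hsel ℓ
    simp only [Selects, hn] at this
    simp [selection, hn, this]

namespace Describes

open scoped Classical

variable {m s : ℕ} {R : Kind M.prog.length M.dirs → List (Fin m) → List (Fin m) → Prop}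
  {g : Memory M.dirs} {N : List (List (Fin m))} {θ : List (List (Fin m) × Thread)}
  (D : M.Describes s R g N θ) {e : M.V → List (Fin m)}

include D

lemma holds_ex_matchF (he : ∀ v, (e v).length = s) {ℓ : ℕ} :
    (Form.ex (.loc 2) (M.matchF ℓ (.loc 2))).Holds s R e ↔ M.matchingAt g ℓ ≠ [] := by
  rw [Form.holds_ex]
  constructor
  · rintro ⟨u, hu, h⟩
    obtain ⟨i, -, hi⟩ := (D.holds_matchF (update_len he _ hu) (by simp) (by simp)).mp h
    exact List.ne_nil_of_mem hi
  · intro h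
    obtain ⟨i, hi⟩ := List.exists_mem_of_ne_nil _ h
    have hlt : i < g.size := by
      unfold matchingAt at hi
      split at hi <;> simp [Memory.matching] at hi
      exact hi.1
    obtain ⟨u, hu, hu'⟩ := D.exists_name hlt
    refine ⟨u, hu, (D.holds_matchF (update_len he _ hu) (by simp) (by simp)).mpr ⟨i, ?_, hi⟩⟩
    rwa [Function.update_self]

lemma holds_ex_selectedF (he : ∀ v, (e v).length = s) {σ : Fin M.prog.length → List (Fin m)}
    (hσ : ∀ l, e (.sel l) = σ l) {ℓ : ℕ} :
    (Form.ex (.loc 2) (M.selectedF ℓ (.loc 2))).Holds s R e ↔ M.selection g N σ ℓ ≠ [] := by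
  rw [Form.holds_ex]
  have hσ' : ∀ u l, Function.update e (.loc 2) u (.sel l) = σ l := by simp [hσ]
  constructor
  · rintro ⟨u, hu, h⟩
    obtain ⟨i, -, hi⟩ :=
      (D.holds_selectedF (update_len he _ hu) (by simp) (by simp) (hσ' u)).mp h
    exact List.ne_nil_of_mem hi
  · intro h
    obtain ⟨i, hi⟩ := List.exists_mem_of_ne_nil _ h
    obtain ⟨u, hu, hu'⟩ := D.exists_name (lt_of_mem_selection hi)
    refine ⟨u, hu,
      (D.holds_selectedF (update_len he _ hu) (by simp) (by simp) (hσ' u)).mpr ⟨i, ?_, hi⟩⟩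
    rwa [Function.update_self]

lemma holds_legalF (he : ∀ v, (e v).length = s) {σ : Fin M.prog.length → List (Fin m)}
    (hσ : ∀ l, e (.sel l) = σ l) :
    M.legalF.Holds s R e ↔ ∀ ℓ, M.Selects g ℓ (M.selection g N σ ℓ) := by
  simp only [selects_iff D, legalF, Form.holds_conj, List.mem_map, List.mem_range,
    forall_exists_index, and_imp, forall_apply_eq_imp_iff₂, Form.holds_or, Form.holds_not,
    D.holds_ex_matchF he, D.holds_ex_selectedF he hσ]
  constructor
  · intro h ℓ
    by_cases hℓ : ℓ < M.prog.length
    · have := h ℓ hℓ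
      tauto
    · simp [matchingAt, List.getElem?_eq_none (not_lt.mp hℓ)]
  · intro h ℓ _
    have := h ℓ
    tauto

lemma holds_legitF (he : ∀ v, (e v).length = s) {σ : Fin M.prog.length → List (Fin m)}
    (hσ : ∀ l, e (.sel l) = σ l) {h : M.Hdr} :
    (M.legitF h).Holds s R e ↔ (∀ ℓ, M.Selects g ℓ (M.selection g N σ ℓ)) ∧
      match h.1 with
      | none => θ ≠ [] ∧ (h.2 = true ↔ ∃ p ∈ θ, M.reads p.2 = true)
      | some a => θ = [] ∧ h.2 = false ∧ ∃ ℓ ∈ M.topLevel[a], M.selection g N σ ℓ ≠ [] := by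
  rw [legitF, Form.holds_and, D.holds_legalF he hσ]
  refine and_congr_right fun _ => ?_
  rcases h with ⟨_ | a, b⟩
  · simp only [Form.holds_and, D.holds_anyF he]
    refine and_congr_right fun _ => ?_
    cases b <;> simp [D.holds_readF he]
  · simp only [Form.holds_and, Form.holds_not, D.holds_anyF he, not_not, Form.holds_guard,
      Form.holds_disj, List.mem_map, exists_exists_and_eq_and, D.holds_ex_selectedF he hσ]

/-- The order of the names turns "no later execution redirects the edge" into a quantifier over
greater words. -/
lemma holds_ptrF (he : ∀ v, (e v).length = s) {d : Fin M.dirs} :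
    (M.ptrF d (.loc 0) (.loc 1)).Holds s R e ↔ ∃ i j, N[i]? = some (e (.loc 0)) ∧
      N[j]? = some (e (.loc 1)) ∧ M.EdgeSpec g θ i d j := by
  have hset : ∀ u, u.length = s → ((M.setF d (.loc 2) (.loc 0)).Holds s R
      (Function.update e (.loc 2) u) ↔ ∃ t i j, (u, t) ∈ θ ∧
        M.redirection g t = some (i, d, j) ∧ N[i]? = some (e (.loc 0))) := by
    intro u hu
    rw [D.holds_setF (update_len he _ hu) (by simp) (by simp) (by simp) (by simp)]
    simp
  have hset' : ∀ u, u.length = s → ∀ u', u'.length = s →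
      ((M.setF d (.loc 4) (.loc 0)).Holds s R
      (Function.update (Function.update e (.loc 2) u) (.loc 4) u') ↔ ∃ t i j, (u', t) ∈ θ ∧
        M.redirection g t = some (i, d, j) ∧ N[i]? = some (e (.loc 0))) := by
    intro u hu u' hu'
    rw [D.holds_setF (update_len (update_len he _ hu) _ hu') (by simp) (by simp) (by simp)
      (by simp)]
    simp
  have hto : ∀ u, u.length = s → ((M.setToF d (.loc 2) (.loc 0) (.loc 1)).Holds s R
      (Function.update e (.loc 2) u) ↔ ∃ t i j, (u, t) ∈ θ ∧
        M.redirection g t = some (i, d, j) ∧ N[i]? = some (e (.loc 0)) ∧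
        N[j]? = some (e (.loc 1))) := by
    intro u hu
    rw [D.holds_setToF (update_len he _ hu) (by simp) (by simp) (by simp) (by simp) (by simp)
      (by simp) (by simp)]
    simp
  have hrel : (Form.rel (.ptr d) (.loc 0) (.loc 1) : M.Fm).Holds s R e ↔
      ∃ i, N[i]? = some (e (.loc 0)) ∧ N[g.ptr i d]? = some (e (.loc 1)) :=
    D.ptr d _ _ (he _) (he _)
  simp only [ptrF, Form.holds_or, Form.holds_ex, Form.holds_and, Form.holds_not, hrel]
  constructor
  · rintro (⟨u, hu, h₁, h₂⟩ | ⟨h₁, i, hi, hi'⟩)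
    · obtain ⟨t, i, j, ht, hr, hi, hj⟩ := (hto u hu).mp h₁
      refine ⟨i, j, hi, hj, .inl ⟨_, ht, hr, fun p' hp' hlt j' hj' => h₂ ⟨p'.1, D.thr_len _ hp', ?_,
        (hset' u hu _ (D.thr_len _ hp')).mpr ⟨p'.2, i, j', hp', hj', hi⟩⟩⟩⟩
      simpa using hlt
    · exact ⟨i, _, hi, hi', .inr ⟨fun p hp j' hj' => h₁ ⟨p.1, D.thr_len _ hp,
        (hset _ (D.thr_len _ hp)).mpr ⟨p.2, i, j', hp, hj', hi⟩⟩, rfl⟩⟩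
  · rintro ⟨i, j, hi, hj, ⟨p, hp, hr, hm⟩ | ⟨h, rfl⟩⟩
    · refine .inl ⟨p.1, D.thr_len _ hp,
        (hto _ (D.thr_len _ hp)).mpr ⟨p.2, i, j, hp, hr, hi, hj⟩, ?_⟩
      rintro ⟨u, hu, hlt, h⟩
      obtain ⟨t', i', j', ht', hr', hi'⟩ := (hset' _ (D.thr_len _ hp) _ hu).mp h
      rw [D.index_inj hi' hi] at hr'
      exact hm _ ht' (by simpa using hlt) j' hr'
    · refine .inr ⟨?_, i, hi, hj⟩
      rintro ⟨u, hu, h'⟩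
      obtain ⟨t', i', j', ht', hr', hi'⟩ := (hset _ hu).mp h'
      rw [D.index_inj hi' hi] at hr'
      exact h _ ht' j' hr'

lemma next_center_lt {a : Option α} {n : ℕ} {x : List (Fin m)} {t t' : Thread} (ht : (x, t) ∈ θ)
    (hc : M.creates t = false) (h : M.next g a n t = some t') : t'.center < g.size := by
  have h₀ : t.center < g.size := D.center_lt _ ht
  unfold creates at hc
  unfold next at h
  rcases hp : M.prog[t.pc]? with _ | (_ | _ | _ | _ | _ | _ | _) <;>
    simp only [hp, Option.some.injEq, reduceCtorEq] at h hc <;> rw [← h]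
  · exact h₀
  · exact D.walk_lt h₀ _
  · exact h₀
  · exact h₀

lemma redirection_lt {x : List (Fin m)} {t : Thread} (ht : (x, t) ∈ θ) {i j : ℕ}
    {d : Fin M.dirs} (h : M.redirection g t = some (i, d, j)) : i < g.size ∧ j < g.size := by
  have h₀ : t.center < g.size := D.center_lt _ ht
  unfold redirection at h
  split at h
  · simp only [Option.some.injEq, Prod.mk.injEq] at h
    obtain ⟨rfl, -, rfl⟩ := h
    exact ⟨D.walk_lt h₀ _, D.walk_lt h₀ _⟩
  · simp at h

end Describes

end MWSMM.Machine

/-! ### The rules describe a step. -/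

namespace MWSMM.Machine

open OfflineTM (Form System)
open scoped Classical

variable {α : Type} {M : Machine α}

lemma fin_cases_letter {m : ℕ} (g : Fin (m + 2)) : g = 0 ∨ g = 1 ∨ ∃ k, g.val = k + 2 := by
  rcases g with ⟨_ | _ | k, h⟩
  · exact .inl rfl
  · exact .inr (.inl rfl)
  · exact .inr (.inr ⟨k, rfl⟩)

lemma newNames_cases {m : ℕ} {N : List (List (Fin (m + 2)))}
    {l : List (List (Fin (m + 2)) × Thread)} {n : ℕ} {y : List (Fin (m + 2))}
    (h : (M.newNames N l)[n]? = some y) : ∃ x, y = 0 :: x ∨ y = 1 :: x := by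
  have := List.mem_of_getElem? h
  simp only [newNames, List.mem_append, List.mem_map] at this
  rcases this with ⟨x, -, rfl⟩ | ⟨p, -, rfl⟩
  · exact ⟨x, .inl rfl⟩
  · exact ⟨p.1, .inr rfl⟩

lemma exists_index_of_creates {m : ℕ} (N : List (List (Fin (m + 2))))
    {l : List (List (Fin (m + 2)) × Thread)} {x : List (Fin (m + 2))} {t : Thread}
    (ht : (x, t) ∈ l) (hc : M.creates t = true) :
    ∃ n : ℕ, (M.newNames N l)[n]? = some (1 :: x) := by
  refine List.mem_iff_getElem?.mp ?_
  simp only [newNames, List.mem_append, List.mem_map, List.mem_filter]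
  exact .inr ⟨_, ⟨ht, hc⟩, rfl⟩

section

variable {m s : ℕ}
  {R : Kind M.prog.length M.dirs → List (Fin (m + 2)) → List (Fin (m + 2)) → Prop}
  {g : Memory M.dirs} {a : Option α} {N : List (List (Fin (m + 2)))}
  {θ Θ : List (List (Fin (m + 2)) × Thread)} {r : Memory M.dirs × List Thread}
  {e : M.V → List (Fin (m + 2))}

namespace Stepped

/-- The letter in front of the center tells the instruction apart: `1` occurs exactly after `new`,
when the center is the node created by the execution itself, and `0` for all others that go on. -/
lemma holds_contF (S : M.Stepped g a N θ r Θ) (D : M.Describes s R g N θ)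
    (he : ∀ v, (e v).length = s) {q : Fin (M.prog.length + 1)}
    {x y : M.V} (hx : x ≠ .loc 3) (hy₃ : y ≠ .loc 3) (hy₅ : y ≠ .loc 5) (hy₆ : y ≠ .loc 6)
    (hy₇ : y ≠ .loc 7) (h : Fin (m + 2)) :
    (M.contF q h a x y).Holds s R e ↔ ∃ t', (0 :: e x, t') ∈ Θ ∧ M.line t'.pc = q ∧
      (M.newNames N θ)[t'.center]? = some (h :: e y) := by
  simp only [S.mem_iff, List.cons.injEq, true_and]
  rcases fin_cases_letter h with rfl | rfl | ⟨k, hk⟩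
  · rw [Fin.val_zero, D.holds_contF_old he hx hy₃ hy₅ hy₆ hy₇ 0]
    constructor
    · rintro ⟨t, t', ht, hc, hn, hq, hy⟩
      exact ⟨t', ⟨_, t, 0, ht, rfl, hn, by simp [hc]⟩, hq, newNames_zero.mpr hy⟩
    · rintro ⟨t', ⟨_, t, n, ht, rfl, hn, hc⟩, hq, hy⟩
      cases hcr : M.creates t with
      | false => exact ⟨t, t', ht, hcr, next_of_not_creates hcr n 0 ▸ hn, hq, newNames_zero.mp hy⟩
      | true =>
        rw [next_of_creates hcr, Option.some.injEq] at hn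
        rw [← hn, hc hcr] at hy
        simp at hy
  · rw [Fin.val_one, D.holds_contF_new he hx]
    constructor
    · rintro ⟨t, ht, hc, hq, hxy⟩
      obtain ⟨n, hn⟩ := exists_index_of_creates N ht hc
      exact ⟨_, ⟨_, t, n, ht, rfl, next_of_creates hc n, fun _ => hn⟩, hq, hxy ▸ hn⟩
    · rintro ⟨t', ⟨_, t, n, ht, rfl, hn, hc⟩, hq, hy⟩
      cases hcr : M.creates t with
      | false =>
        -- Without `new` the center is an old node, but names with the letter `1` belong to numbers
        -- beyond the old nodes.
        have h₁ := D.next_center_lt ht hcr hn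
        have h₂ := (newNames_one hy).1
        rw [D.size] at h₂
        omega
      | true =>
        rw [next_of_creates hcr, Option.some.injEq] at hn
        rw [← hn, hc hcr] at hy
        refine ⟨t, ht, hcr, ?_, by simpa using hy⟩
        rw [← hn] at hq
        exact hq
  · rw [hk]
    refine iff_of_false (Describes.not_holds_contF k) ?_
    rintro ⟨t', -, -, hy⟩
    obtain ⟨z, hz | hz⟩ := newNames_cases hy <;> rw [List.cons.injEq] at hz <;> rw [hz.1] at hk <;>
      simp at hk

lemma holds_aliveF (S : M.Stepped g a N θ r Θ) (D : M.Describes s R g N θ)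
    (he : ∀ v, (e v).length = s) {x : M.V} (hx : x ≠ .loc 3) :
    (M.aliveF x).Holds s R e ↔ ∃ t', (0 :: e x, t') ∈ Θ := by
  rw [D.holds_aliveF he hx (a := a) (n := 0)]
  simp only [S.mem_iff, List.cons.injEq, true_and]
  constructor
  · rintro ⟨t, ht, hn⟩
    cases hcr : M.creates t with
    | false =>
      obtain ⟨t', ht'⟩ := Option.ne_none_iff_exists'.mp hn
      exact ⟨t', _, t, 0, ht, rfl, ht', by simp [hcr]⟩
    | true =>
      obtain ⟨n, hn⟩ := exists_index_of_creates N ht hcr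
      exact ⟨_, _, t, n, ht, rfl, next_of_creates hcr n, fun _ => hn⟩
  · rintro ⟨t', _, t, n, ht, rfl, hn, -⟩
    refine ⟨t, ht, ?_⟩
    cases hcr : M.creates t with
    | false => rw [next_of_not_creates hcr 0 n, hn]; simp
    | true => rw [next_of_creates hcr]; simp

lemma le_size (S : M.Stepped g a N θ r Θ) (D : M.Describes s R g N θ) : g.size ≤ r.1.size := by
  rw [← S.size, ← D.size]
  simp [newNames]

/-- Redirected edges end where a path in the old graph ends, and a new node points to the center
that its creator had before the step. -/
lemma ptr_lt_old (S : M.Stepped g a N θ r Θ) (D : M.Describes s R g N θ) {i : ℕ}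
    (hi : i < r.1.size) (d : Fin M.dirs) : r.1.ptr i d < g.size := by
  rw [← S.size] at hi
  obtain ⟨y, hy⟩ : ∃ y, (M.newNames N θ)[i]? = some y := ⟨_, List.getElem?_eq_getElem hi⟩
  obtain ⟨x, rfl | rfl⟩ := newNames_cases hy
  · have hi' := D.lt_size (newNames_zero.mp hy)
    rcases S.old i hi' d with ⟨p, hp, h, -⟩ | ⟨-, h⟩
    · exact (D.redirection_lt hp h).2
    · rw [h]
      exact D.ptr_lt i hi' d
  · obtain ⟨t, ht, -, h⟩ := S.new i x hy
    rw [h]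
    exact D.center_lt _ ht

lemma center_lt (S : M.Stepped g a N θ r Θ) (D : M.Describes s R g N θ)
    {p : List (Fin (m + 2)) × Thread} (hp : p ∈ Θ) : p.2.center < r.1.size := by
  obtain ⟨x, t, n, ht, -, hn, hc⟩ := (S.mem_iff p.1 p.2).mp hp
  cases hcr : M.creates t with
  | false => exact (D.next_center_lt ht hcr hn).trans_le (S.le_size D)
  | true =>
    rw [next_of_creates hcr, Option.some.injEq] at hn
    rw [← hn, ← S.size]
    exact (List.getElem?_eq_some_iff.mp (hc hcr)).1

end Stepped

end

lemma pairwise_map_cons {m : ℕ} {β : Type} {f : β → List (Fin m)} {l : List β} (g : Fin m)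
    (h : (l.map f).Pairwise (· < ·)) : (l.map fun p => g :: f p).Pairwise (· < ·) := by
  rw [List.pairwise_map] at h ⊢
  exact h.imp fun h => List.Lex.cons h

/-- Old nodes precede new ones because `0 < 1`, and within each group the old order of nodes or of
executions is inherited. -/
lemma newNames_sorted {m : ℕ} {N : List (List (Fin (m + 2)))}
    {l : List (List (Fin (m + 2)) × Thread)} (hN : N.Pairwise (· < ·))
    (hl : (l.map Prod.fst).Pairwise (· < ·)) : (M.newNames N l).Pairwise (· < ·) := by
  rw [newNames, List.pairwise_append]
  refine ⟨pairwise_map_cons (f := id) 0 (by simpa using hN),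
    pairwise_map_cons (f := Prod.fst) 1 (hl.sublist (List.filter_sublist.map _)), ?_⟩
  simp only [List.mem_map]
  rintro _ ⟨x, -, rfl⟩ _ ⟨y, -, rfl⟩
  exact List.Lex.rel (by simp)

/-- If the relations `R'` are obtained from `R` by the rules, then they describe the configuration
after the step. -/
theorem Models.step {m s : ℕ}
    {R R' : Kind M.prog.length M.dirs → List (Fin (m + 2)) → List (Fin (m + 2)) → Prop}
    {c : Config M.dirs} {N : List (List (Fin (m + 2)))} {θ : List (List (Fin (m + 2)) × Thread)}
    (H : M.Models s R c N θ) {h : M.Hdr} {a : Option α}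
    {σ : Fin M.prog.length → List (Fin (m + 2))}
    {E : List (Fin (m + 2)) → List (Fin (m + 2)) → M.V → List (Fin (m + 2))}
    (hE : ∀ x y, x.length = s → y.length = s → ∀ v, (E x y v).length = s)
    (hE₀ : ∀ x y, E x y (.loc 0) = x) (hE₁ : ∀ x y, E x y (.loc 1) = y)
    (hσ : ∀ x y l, E x y (.sel l) = σ l)
    (hR : ∀ k (g g' : Fin (m + 2)) x y,
      R' k (g :: x) (g' :: y) ↔ (M.ruleF g g' h a k).Holds s R (E x y))
    {ls : List (ℕ × ℕ)} (hls : ∀ j ℓ, (j, ℓ) ∈ ls ↔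
      M.forkLine h j = some ℓ ∧ (h.1 = none → ∃ p ∈ θ, p.2.pc = ℓ))
    (hsort : (ls.map Prod.fst).Pairwise (· < ·)) (hm : ∀ p ∈ ls, p.1 < m) (pos : ℕ) :
    ∃ N' θ', M.Models (s + 1) R'
      (M.stepTo (M.selection c.mem N σ) (ls.map Prod.snd) a pos c) N' θ' := by
  have D := H.toDescribes
  obtain ⟨Θ, S⟩ := exists_stepped a H.size H.sorted
    fun p hp i d j h => (D.redirection_lt hp h).1
  have hfold : c.threads.foldl (M.execThread c.mem a) (c.mem, []) =
      θ.foldl (fun acc p => M.execThread c.mem a acc p.2) (c.mem, []) := by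
    rw [← H.map_snd, List.foldl_map]
  unfold stepTo
  rw [hfold]
  generalize θ.foldl (fun acc p => M.execThread c.mem a acc p.2) (c.mem, []) = r at S
  have hsel : ∀ ℓ, ∀ v ∈ M.selection c.mem N σ ℓ, v < N.length := fun ℓ v hv => by
    rw [H.size]
    exact lt_of_mem_selection hv
  have hforks : ∀ y t, (y, t) ∈ namedForks N (M.selection c.mem N σ) ls ↔ _ := fun y t =>
    mem_namedForks (y := y) (t := t) hm hsel
  have hΘ : ∀ p ∈ Θ, ∃ x t n, (x, t) ∈ θ ∧ p.1 = 0 :: x ∧ M.next c.mem a n t = some p.2 :=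
    fun p hp => by
      obtain ⟨x, t, n, h₁, h₂, h₃, -⟩ := (S.mem_iff p.1 p.2).mp hp
      exact ⟨x, t, n, h₁, h₂, h₃⟩
  have hΘs : (Θ.map Prod.fst).Pairwise (· < ·) :=
    (pairwise_map_cons (f := Prod.fst) 0 H.sorted).sublist S.sublist
  have hmain : ∀ p ∈ Θ, p.2.main = true ↔ p.1 = 0 :: List.replicate s 0 := by
    intro p hp
    obtain ⟨x, t, n, h₁, h₂, h₃⟩ := hΘ p hp
    rw [next_main h₃, H.main_iff _ h₁, h₂]
    simp
  refine ⟨M.newNames N θ, Θ ++ namedForks N (M.selection c.mem N σ) ls,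
    { size := S.size
      len := ?len
      nodup := (newNames_sorted H.sorted_nodes H.sorted).imp fun h => h.ne
      ptr_lt := fun i hi d => (S.ptr_lt_old D hi d).trans_le (S.le_size D)
      thr_len := ?thr_len
      center_lt := ?center_lt
      node := ?node
      ptr := ?ptr
      thr := ?thr
      map_snd := by rw [List.map_append, S.map_snd, namedForks_map_snd]
      sorted_nodes := newNames_sorted H.sorted_nodes H.sorted
      sorted := ?sorted
      main_iff := ?main_iff
      center_lt_size := ?center_lt_size
      center := ?center }⟩
  case len =>
    intro x hx
    simp only [newNames, List.mem_append, List.mem_map, List.mem_filter] at hx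
    rcases hx with ⟨y, hy, rfl⟩ | ⟨p, hp, rfl⟩
    · simp [H.len y hy]
    · simp [H.thr_len p hp.1]
  case thr_len =>
    intro p hp
    rcases List.mem_append.mp hp with hp | hp
    · obtain ⟨x, t, n, h₁, h₂, h₃⟩ := hΘ p hp
      rw [h₂]
      simpa using H.thr_len _ h₁
    · obtain ⟨j, k, ℓ, x, v, -, -, -, hx, h₂, -⟩ := (hforks p.1 p.2).mp hp
      rw [h₂]
      simpa using D.length_eq hx
  case center_lt =>
    intro p hp
    rcases List.mem_append.mp hp with hp | hp
    · exact S.center_lt D hp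
    · obtain ⟨j, k, ℓ, x, v, -, -, hv, -, -, h₂⟩ := (hforks p.1 p.2).mp hp
      rw [h₂]
      exact (lt_of_mem_selection hv).trans_le (S.le_size D)
  case node =>
    rintro (_ | ⟨g, x⟩) hx
    · simp at hx
    have hx : x.length = s := by simpa using hx
    have he := hE x x hx hx
    rw [hR, List.mem_iff_getElem?]
    rcases fin_cases_letter g with rfl | rfl | ⟨k, hk⟩
    · simp only [newNames_zero, Fin.val_zero, ruleF, D.holds_nodeF he, hE₀]
    · simp only [Fin.val_one, ruleF, Form.holds_ex]
      constructor
      · rintro ⟨u, hu, h⟩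
        obtain ⟨t, ht, hc, -⟩ := (D.holds_newF (Describes.update_len he _ hu)).mp h
        rw [Function.update_of_ne (by simp), hE₀] at ht
        exact exists_index_of_creates N ht hc
      · rintro ⟨n, hn⟩
        obtain ⟨-, t, ht, hc⟩ := newNames_one hn
        obtain ⟨u, hu, hu'⟩ := D.exists_name (D.center_lt _ ht)
        refine ⟨u, hu, (D.holds_newF (Describes.update_len he _ hu)).mpr ⟨t, ?_, hc, ?_⟩⟩
        · rwa [Function.update_of_ne (by simp), hE₀]
        · rwa [Function.update_self]
    · simp only [hk, ruleF, Form.holds_fls, false_iff]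
      rintro ⟨n, hn⟩
      obtain ⟨z, hz | hz⟩ := newNames_cases hn <;> rw [List.cons.injEq] at hz <;>
        rw [hz.1] at hk <;> simp at hk
  case ptr =>
    rintro d (_ | ⟨g, x⟩) (_ | ⟨g', y⟩) hx hy
    · simp at hx
    · simp at hx
    · simp at hy
    have hx : x.length = s := by simpa using hx
    have hy : y.length = s := by simpa using hy
    have he := hE x y hx hy
    simp only [hR, ruleF, Form.holds_guard]
    by_cases hg' : g' = 0
    swap
    -- No edge ends at a node created in this step, so a target whose name does not begin with `0`
    -- is impossible.
    · refine iff_of_false (fun h => hg' (Fin.ext h.1)) ?_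
      rintro ⟨i, hi, hi'⟩
      have hi₀ : i < r.1.size := by
        rw [← S.size]
        exact (List.getElem?_eq_some_iff.mp hi).1
      obtain ⟨z, -, hz⟩ := D.exists_name (S.ptr_lt_old D hi₀ d)
      rw [← newNames_zero (M := M) (l := θ), hi'] at hz
      simp at hz
      exact hg' hz.1
    subst hg'
    simp only [Fin.val_zero, true_and, newNames_zero]
    rcases fin_cases_letter g with rfl | rfl | ⟨k, hk⟩
    · simp only [newNames_zero, Fin.val_zero, D.holds_ptrF he, hE₀, hE₁]
      constructor
      · rintro ⟨i, j, hi, hj, hs⟩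
        refine ⟨i, hi, ?_⟩
        rwa [(S.old i (D.lt_size hi) d).unique H.sorted hs]
      · rintro ⟨i, hi, hj⟩
        exact ⟨i, _, hi, hj, S.old i (D.lt_size hi) d⟩
    · simp only [Fin.val_one, D.holds_newF he, hE₀, hE₁]
      constructor
      · rintro ⟨t, ht, hc, hy'⟩
        obtain ⟨n, hn⟩ := exists_index_of_creates N ht hc
        refine ⟨n, hn, ?_⟩
        obtain ⟨t', ht', -, hd⟩ := S.new n x hn
        have := List.inj_on_of_nodup_map (H.sorted.imp fun h => h.ne) ht ht' rfl
        simp only [Prod.mk.injEq, true_and] at this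
        rwa [hd, ← this]
      · rintro ⟨n, hn, hy'⟩
        obtain ⟨t, ht, hc, hd⟩ := S.new n x hn
        exact ⟨t, ht, hc, hd d ▸ hy'⟩
    · simp only [hk, Form.holds_fls, false_iff]
      rintro ⟨n, hn, -⟩
      obtain ⟨z, hz | hz⟩ := newNames_cases hn <;> rw [List.cons.injEq] at hz <;>
        rw [hz.1] at hk <;> simp at hk
  case thr =>
    rintro q (_ | ⟨g, x⟩) (_ | ⟨g', y⟩) hx hy
    · simp at hx
    · simp at hx
    · simp at hy
    have hx : x.length = s := by simpa using hx
    have hy : y.length = s := by simpa using hy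
    have he := hE x y hx hy
    rw [hR]
    rcases fin_cases_letter g with rfl | rfl | ⟨k, hk⟩
    · simp only [ruleF, Fin.val_zero]
      rw [S.holds_contF D he (by simp) (by simp) (by simp) (by simp) (by simp), hE₀, hE₁]
      refine exists_congr fun t => and_congr_left fun _ => ?_
      rw [List.mem_append, or_iff_left]
      intro h
      obtain ⟨j, k, ℓ, x', v, hj, -, -, -, h₂, -⟩ := (hforks _ _).mp h
      rw [List.cons.injEq] at h₂
      rw [← h₂.1] at hj
      simp at hj
    · simp only [ruleF, Fin.val_one, Form.holds_fls, false_iff]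
      rintro ⟨t, ht, -⟩
      rcases List.mem_append.mp ht with h | h
      · obtain ⟨x', -, -, -, h₂, -⟩ := hΘ _ h
        simp at h₂
      · obtain ⟨j, k, ℓ, x', v, hj, -, -, -, h₂, -⟩ := (hforks _ _).mp h
        rw [List.cons.injEq] at h₂
        rw [← h₂.1] at hj
        simp at hj
    · simp only [ruleF, hk, Form.holds_guard, forkF]
      have hfork : ∀ (t : Thread), (g :: x, t) ∈ Θ ++ namedForks N (M.selection c.mem N σ) ls ↔
          ∃ ℓ v, (k, ℓ) ∈ ls ∧ v ∈ M.selection c.mem N σ ℓ ∧ N[v]? = some x ∧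
            t = ⟨ℓ + 1, v, false⟩ := by
        intro t
        rw [List.mem_append, hforks]
        constructor
        · rintro (h | ⟨j, k', ℓ, x', v, hj, hk', hv, hx', h₁, h₂⟩)
          · obtain ⟨x', -, -, -, h₂, -⟩ := hΘ _ h
            rw [List.cons.injEq] at h₂
            rw [h₂.1] at hk
            simp at hk
          · rw [List.cons.injEq] at h₁
            obtain ⟨rfl, rfl⟩ := h₁
            obtain rfl : k = k' := by omega
            exact ⟨ℓ, v, hk', hv, hx', h₂⟩
        · rintro ⟨ℓ, v, hk', hv, hx', h₂⟩
          exact .inr ⟨g, k, ℓ, x, v, hk, hk', hv, hx', rfl, h₂⟩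
      -- In an ordinary step a `match` has to be reached by some execution; in a round there is no
      -- such condition.
      have hhit : ∀ ℓ, M.forkLine h k = some ℓ →
          ((if h.1 = none then M.hitF ℓ else .tru : M.Fm).Holds s R (E x y) ↔
            (h.1 = none → ∃ p ∈ θ, p.2.pc = ℓ)) := by
        intro ℓ hℓ
        by_cases hn : h.1 = none
        · have : ℓ < M.prog.length := by
            simp only [forkLine, hn] at hℓ
            split at hℓ
            · simp only [Option.some.injEq] at hℓ
              omega
            · simp at hℓ
          simp only [hn, if_true, D.holds_hitF he this, true_imp_iff]
        · simp [hn]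
      constructor
      · rintro ⟨hg', hf⟩
        obtain rfl : g' = 0 := Fin.ext hg'
        rcases hℓ : M.forkLine h k with _ | ℓ
        · simp [hℓ] at hf
        simp only [hℓ, Form.holds_guard, Form.holds_and, Form.holds_eq, hE₀, hE₁,
          D.holds_selectedF he (v := .loc 0) (by simp) (by simp) (hσ x y)] at hf
        obtain ⟨hq, rfl, ⟨v, hv, hv'⟩, hh⟩ := hf
        exact ⟨_, (hfork _).mpr ⟨ℓ, v, (hls k ℓ).mpr ⟨hℓ, (hhit ℓ hℓ).mp hh⟩, hv', hv, rfl⟩, hq,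
          newNames_zero.mpr hv⟩
      · rintro ⟨t, ht, hq, hy'⟩
        obtain ⟨ℓ, v, hk', hv, hx', rfl⟩ := (hfork t).mp ht
        obtain ⟨hℓ, hh⟩ := (hls k ℓ).mp hk'
        have := (newNames_zero (M := M) (l := θ)).mpr hx'
        rw [this, Option.some.injEq, List.cons.injEq] at hy'
        obtain ⟨rfl, rfl⟩ := hy'
        refine ⟨rfl, ?_⟩
        simp only [hℓ, Form.holds_guard, Form.holds_and, Form.holds_eq, hE₀, hE₁,
          D.holds_selectedF he (v := .loc 0) (by simp) (by simp) (hσ x x)]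
        exact ⟨hq, trivial, ⟨v, hx', hv⟩, (hhit ℓ hℓ).mpr hh⟩
  case sorted =>
    rw [List.map_append, List.pairwise_append]
    refine ⟨hΘs, namedForks_sorted H.sorted_nodes hm hsort hsel
      fun ℓ => selection_sorted c.mem N σ ℓ, ?_⟩
    simp only [List.mem_map]
    rintro _ ⟨p, hp, rfl⟩ _ ⟨p', hp', rfl⟩
    obtain ⟨x, t, n, h₁, h₂, h₃⟩ := hΘ p hp
    obtain ⟨j, k, ℓ, x', v, hj, -, -, -, h₂', -⟩ := (hforks p'.1 p'.2).mp hp'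
    rw [h₂, h₂']
    exact List.Lex.rel (by rw [Fin.lt_def, hj]; simp)
  case main_iff =>
    intro p hp
    rw [List.replicate_succ]
    rcases List.mem_append.mp hp with hp | hp
    · exact hmain p hp
    · obtain ⟨j, k, ℓ, x, v, hj, -, -, -, h₂, h₃⟩ := (hforks p.1 p.2).mp hp
      rw [h₂, h₃]
      simp only [Bool.false_eq_true, List.cons.injEq, false_iff, not_and]
      rintro rfl
      simp at hj
  case center_lt_size =>
    rcases hf : r.2.find? fun τ => τ.main with _ | τ <;>
      simp only [hf, Option.elim_none, Option.elim_some]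
    · exact H.center_lt_size.trans_le (S.le_size D)
    · have := List.mem_of_find?_eq_some hf
      rw [← S.map_snd] at this
      obtain ⟨p, hp, rfl⟩ := List.mem_map.mp this
      exact S.center_lt D hp
  case center =>
    rintro (_ | ⟨g, x⟩) hx
    · simp at hx
    have hx : x.length = s := by simpa using hx
    have he := hE x x hx hx
    have hlen : (List.replicate s (0 : Fin (m + 2))).length = s := by simp
    have hrel : (Form.rel .center (.loc 0) (.loc 0) : M.Fm).Holds s R (E x x) ↔
        N[c.center]? = some x := by
      rw [← H.center x hx]
      simp only [Form.Holds, hE₀]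
    have h₁ : ∀ u : List (Fin (m + 2)), u.length = s →
        ((M.rootF (.loc 2)).Holds s R (Function.update (E x x) (.loc 2) u) ↔
          u = List.replicate s 0) := by
      intro u hu
      rw [holds_rootF (by simp) (by simpa using hu)]
      simp
    have h₂ : ∀ u : List (Fin (m + 2)), u.length = s → ∀ q,
        ((M.contF q g a (.loc 2) (.loc 0)).Holds s R (Function.update (E x x) (.loc 2) u) ↔
          ∃ t', (0 :: u, t') ∈ Θ ∧ M.line t'.pc = q ∧
            (M.newNames N θ)[t'.center]? = some (g :: x)) := by
      intro u hu q
      rw [S.holds_contF D (Describes.update_len he _ hu) (by simp) (by simp) (by simp) (by simp)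
        (by simp)]
      simp [hE₀]
    have h₃ : ∀ u : List (Fin (m + 2)), u.length = s →
        ((M.aliveF (.loc 2)).Holds s R (Function.update (E x x) (.loc 2) u) ↔
          ∃ t', (0 :: u, t') ∈ Θ) := by
      intro u hu
      rw [S.holds_aliveF D (Describes.update_len he _ hu) (by simp)]
      simp
    -- The rule quantifies over the execution of the prologue; its name can only be the word of
    -- zeros.
    have key : R' .center (g :: x) (g :: x) ↔
        (∃ t', (0 :: List.replicate s 0, t') ∈ Θ ∧
          (M.newNames N θ)[t'.center]? = some (g :: x)) ∨
        (g = 0 ∧ N[c.center]? = some x ∧ ¬ ∃ t', (0 :: List.replicate s 0, t') ∈ Θ) := by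
      simp only [hR, ruleF, Form.holds_or, Form.holds_ex, Form.holds_and, Form.holds_disj,
        Form.holds_guard, Form.holds_not, hrel, List.mem_map, List.mem_finRange, true_and,
        exists_exists_eq_and]
      refine or_congr ?_ (and_congr ⟨fun h => Fin.ext h, fun h => h ▸ rfl⟩ (and_congr_right fun _ => not_congr ?_))
      · constructor
        · rintro ⟨u, hu, hr, q, hc⟩
          rw [h₁ u hu] at hr
          subst hr
          obtain ⟨t', ht', -, hc⟩ := (h₂ _ hu q).mp hc
          exact ⟨t', ht', hc⟩
        · rintro ⟨t', ht', hc⟩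
          exact ⟨_, hlen, (h₁ _ hlen).mpr rfl, M.line t'.pc,
            (h₂ _ hlen _).mpr ⟨t', ht', rfl, hc⟩⟩
      · constructor
        · rintro ⟨u, hu, hr, hc⟩
          rw [h₁ u hu] at hr
          subst hr
          exact (h₃ _ hu).mp hc
        · intro h
          exact ⟨_, hlen, (h₁ _ hlen).mpr rfl, (h₃ _ hlen).mpr h⟩
    rw [key]
    rcases hf : r.2.find? fun τ => τ.main with _ | τ <;>
      simp only [hf, Option.elim_none, Option.elim_some]
    · have hno : ¬ ∃ t', (0 :: List.replicate s 0, t') ∈ Θ := by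
        rintro ⟨t', ht'⟩
        have h₁ := (hmain _ ht').mpr rfl
        have h₂ : t' ∈ r.2 := S.map_snd ▸ List.mem_map_of_mem ht'
        exact List.find?_eq_none.mp hf t' h₂ h₁
      constructor
      · rintro (⟨t', ht', -⟩ | ⟨rfl, hc, -⟩)
        · exact absurd ⟨t', ht'⟩ hno
        · exact newNames_zero.mpr hc
      · intro hc
        obtain ⟨z, -, hz⟩ := D.exists_name H.center_lt_size
        rw [← newNames_zero (M := M) (l := θ)] at hz
        have : some (g :: x) = some (0 :: z) := hc.symm.trans hz
        simp only [Option.some.injEq, List.cons.injEq] at this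
        obtain ⟨rfl, rfl⟩ := this
        exact .inr ⟨rfl, newNames_zero.mp hz, hno⟩
    · have hτ := List.mem_of_find?_eq_some hf
      have hτ' := List.find?_some hf
      rw [← S.map_snd] at hτ
      obtain ⟨p, hp, rfl⟩ := List.mem_map.mp hτ
      have hp₁ := (hmain p hp).mp hτ'
      constructor
      · rintro (⟨t', ht', hc⟩ | ⟨-, -, hn⟩)
        · have := List.inj_on_of_nodup_map (hΘs.imp fun h => h.ne) hp ht' hp₁
          rw [this]
          exact hc
        · exact absurd ⟨p.2, hp₁ ▸ hp⟩ hn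
      · intro hc
        exact .inl ⟨p.2, hp₁ ▸ hp, hc⟩

end MWSMM.Machine

/-! ### Computations and lists of blocks. -/

namespace MWSMM.Machine

open OfflineTM (Form System)
open scoped Classical

variable {α : Type} {M : Machine α}

/-- Whether anything is selected does not depend on the choice made; this is why halting can be
expressed without quantifying over outcomes. -/
lemma Selects.ne_nil_iff {g : Memory M.dirs} {ℓ : ℕ} {s : List ℕ} (h : M.Selects g ℓ s) :
    s ≠ [] ↔ M.matchingAt g ℓ ≠ [] := by
  unfold Selects at h
  unfold matchingAt
  rcases hp : M.prog[ℓ]? with _ | (_ | _ | _ | _ | _ | ⟨_ | _, b⟩ | _) <;> simp only [hp] at h ⊢ <;>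
    try simp [h]
  rcases h with ⟨h, h'⟩ | ⟨v, hv, rfl⟩
  · simp [h, h']
  · simpa using List.ne_nil_of_mem hv

lemma exists_selects (g : Memory M.dirs) : ∃ sel : ℕ → List ℕ, ∀ ℓ, M.Selects g ℓ (sel ℓ) := by
  have : ∀ ℓ, ∃ s, M.Selects g ℓ s := by
    intro ℓ
    unfold Selects
    split
    · exact ⟨_, rfl⟩
    · rename_i b _
      rcases hb : g.matching b with _ | ⟨v, l⟩
      · exact ⟨[], .inl ⟨rfl, rfl⟩⟩
      · exact ⟨[v], .inr ⟨v, by simp, rfl⟩⟩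
    · exact ⟨_, rfl⟩
  choose sel hsel using this
  exact ⟨sel, hsel⟩

lemma forks_ne_nil {sel : ℕ → List ℕ} {ls : List ℕ} :
    forks sel ls ≠ [] ↔ ∃ ℓ ∈ ls, sel ℓ ≠ [] := by
  simp [forks]

lemma halted_iff {w : List α} {c : Config M.dirs} :
    M.Halted w c ↔ c.threads = [] ∧ ∀ ℓ ∈ M.topLevel.flatten, M.matchingAt c.mem ℓ = [] := by
  obtain ⟨sel, hsel⟩ := exists_selects c.mem
  constructor
  · intro h
    have hc : c.threads = [] := by
      by_contra hc
      exact h _ (.exec c sel hc hsel)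
    refine ⟨hc, fun ℓ hℓ => ?_⟩
    by_contra hm
    obtain ⟨blocks, hb, hℓ⟩ := List.mem_flatten.mp hℓ
    exact h _ (.round c sel blocks hc hsel hb
      (forks_ne_nil.mpr ⟨ℓ, hℓ, (hsel ℓ).ne_nil_iff.mpr hm⟩))
  · rintro ⟨hc, hm⟩ c' hs
    cases hs with
    | exec sel hc' hsel => exact hc' hc
    | round sel blocks hc hsel hb hne =>
      obtain ⟨ℓ, hℓ, h⟩ := forks_ne_nil.mp hne
      exact (hsel ℓ).ne_nil_iff.mp h (hm ℓ (List.mem_flatten.mpr ⟨blocks, hb, hℓ⟩))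

variable [Finite α]

lemma models_init : M.Models (m := M.maxFork) 0 (M.system.Rel []) M.init [[]]
    [([], ⟨0, 0, true⟩)] where
  size := rfl
  len := by simp
  nodup := by simp
  ptr_lt := by simp [init]
  thr_len := by simp
  center_lt := by simp [init]
  node := by
    intro x hx
    simp [List.length_eq_zero_iff.mp hx, System.Rel]
  ptr := by
    intro d x y hx hy
    rw [List.length_eq_zero_iff.mp hx, List.length_eq_zero_iff.mp hy]
    exact iff_of_true rfl ⟨0, rfl, rfl⟩
  thr := by
    intro q x y hx hy
    rw [List.length_eq_zero_iff.mp hx, List.length_eq_zero_iff.mp hy]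
    have : M.line 0 = 0 := by simp [line]
    simp only [System.Rel, List.mem_singleton, Prod.mk.injEq, true_and, decide_eq_true_eq,
      exists_eq_left, this, List.getElem?_cons_zero, and_true]
    exact eq_comm
  map_snd := rfl
  sorted_nodes := by simp
  sorted := by simp
  main_iff := by simp
  center_lt_size := by simp [init]
  center := by
    intro x hx
    simp [List.length_eq_zero_iff.mp hx, System.Rel, init]

/-- The names of the nodes that are chosen in the last step. -/
def chosen (b : M.system.Block) (l : Fin M.prog.length) : List (Fin (M.maxFork + 2)) :=
  M.system.track b.cells (.sel l)

lemma env_length {b : M.system.Block} {s : ℕ} (hb : b.cells.length = s)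
    {x y : List (Fin (M.maxFork + 2))} (hx : x.length = s) (hy : y.length = s) (v : M.V) :
    (M.system.env b.cells x y v).length = s := by
  refine Describes.update_len (Describes.update_len (fun v => ?_) _ hx) _ hy v
  simp [System.track, hb]

lemma models_step {B : List M.system.Block} {c : Config M.dirs}
    {N : List (List (Fin (M.maxFork + 2)))} {θ : List (List (Fin (M.maxFork + 2)) × Thread)}
    (H : M.Models B.length (M.system.Rel B) c N θ) {b : M.system.Block}
    (hb : b.cells.length = B.length) {ls : List (ℕ × ℕ)} (hls : ∀ j ℓ, (j, ℓ) ∈ ls ↔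
      M.forkLine b.hdr j = some ℓ ∧ (b.hdr.1 = none → ∃ p ∈ θ, p.2.pc = ℓ))
    (hsort : (ls.map Prod.fst).Pairwise (· < ·)) (hm : ∀ p ∈ ls, p.1 < M.maxFork) (pos : ℕ) :
    ∃ N' θ', M.Models (m := M.maxFork) (B.length + 1) (M.system.Rel (b :: B))
      (M.stepTo (M.selection c.mem N (chosen b)) (ls.map Prod.snd) b.letter pos c) N' θ' :=
  H.step (h := b.hdr) (E := fun x y => M.system.env b.cells x y)
    (fun x y hx hy => env_length hb hx hy)
    (fun x y => by simp [System.env]) (fun x y => by simp [System.env])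
    (fun x y l => by simp [System.env, chosen]) (fun k g g' x y => Iff.rfl) hls hsort hm pos

/-- In an ordinary step the index of a group of new executions is the line of its `match`, in
agreement with their order. -/
lemma models_exec {B : List M.system.Block} {c : Config M.dirs}
    {N : List (List (Fin (M.maxFork + 2)))} {θ : List (List (Fin (M.maxFork + 2)) × Thread)}
    (H : M.Models B.length (M.system.Rel B) c N θ) {b : M.system.Block}
    (hb : b.cells.length = B.length) (hh : b.hdr.1 = none) {w : List α}
    (hw : b.letter = w[c.pos]?) :
    ∃ N' θ', M.Models (m := M.maxFork) (B.length + 1) (M.system.Rel (b :: B))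
      (M.exec w (M.selection c.mem N (chosen b)) c) N' θ' := by
  have := models_step H hb
    (ls := ((List.range M.prog.length).filter fun ℓ => c.threads.any fun τ => τ.pc == ℓ).map
      fun ℓ => (ℓ, ℓ)) ?_ ?_ ?_ (if c.threads.any M.reads then c.pos + 1 else c.pos)
  · rw [List.map_map, hw] at this
    simpa [Function.comp_def, stepTo, exec] using this
  · intro j ℓ
    simp only [forkLine, hh, List.mem_map, List.mem_filter, List.mem_range, Prod.mk.injEq,
      true_imp_iff, ← H.map_snd, List.any_map, List.any_eq_true, Function.comp_apply, beq_iff_eq]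
    constructor
    · rintro ⟨_, ⟨h, h'⟩, rfl, rfl⟩
      exact ⟨if_pos h, h'⟩
    · rintro ⟨h, h'⟩
      split at h
      · obtain rfl := Option.some.inj h
        exact ⟨j, ⟨by assumption, h'⟩, rfl, rfl⟩
      · simp at h
  · rw [List.map_map]
    simpa [Function.comp_def] using List.pairwise_lt_range.filter _
  · simp only [List.mem_map, List.mem_filter, List.mem_range]
    rintro _ ⟨ℓ, ⟨h, -⟩, rfl⟩
    simp only [maxFork]
    omega

/-- In a round the index is the place in the chosen alternative; a line that occurs twice there
gives two groups with different names. -/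
lemma models_round {B : List M.system.Block} {c : Config M.dirs}
    {N : List (List (Fin (M.maxFork + 2)))} {θ : List (List (Fin (M.maxFork + 2)) × Thread)}
    (H : M.Models B.length (M.system.Rel B) c N θ) {b : M.system.Block}
    (hb : b.cells.length = B.length) {a : Fin M.topLevel.length} (hh : b.hdr.1 = some a)
    (hc : c.threads = []) :
    ∃ N' θ', M.Models (m := M.maxFork) (B.length + 1) (M.system.Rel (b :: B))
      { c with threads := forks (M.selection c.mem N (chosen b)) M.topLevel[a] } N' θ' := by
  have := models_step H hb (ls := M.topLevel[a].zipIdx.map Prod.swap) ?_ ?_ ?_ c.pos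
  · rw [List.map_map] at this
    simpa [Function.comp_def, stepTo, hc] using this
  · intro j ℓ
    simp only [forkLine, hh, List.mem_map, reduceCtorEq, false_imp_iff, and_true]
    constructor
    · rintro ⟨⟨ℓ', j'⟩, h, h'⟩
      simp only [Prod.swap_prod_mk, Prod.mk.injEq] at h'
      obtain ⟨rfl, rfl⟩ := h'
      exact List.mem_zipIdx_iff_getElem?.mp h
    · intro h
      exact ⟨(ℓ, j), List.mem_zipIdx_iff_getElem?.mpr h, rfl⟩
  · rw [List.map_map]
    have : Prod.fst ∘ Prod.swap = (Prod.snd : ℕ × ℕ → ℕ) := rfl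
    rw [this, List.zipIdx_map_snd]
    simpa [List.range_eq_range'] using List.pairwise_lt_range (n := M.topLevel[a].length)
  · simp only [List.mem_map]
    rintro _ ⟨⟨ℓ, j⟩, h, rfl⟩
    have h₁ := (List.getElem?_eq_some_iff.mp (List.mem_zipIdx_iff_getElem?.mp h)).1
    have h₂ : M.topLevel[a].length ≤ M.topLevel.flatten.length :=
      (List.sublist_flatten_of_mem (List.getElem_mem a.2)).length_le
    simp only [Prod.fst_swap, maxFork]
    simp only [] at h₁
    omega

/-- All choices in `B` are possible ones. -/
def Good (B : List M.system.Block) : Prop :=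
  M.system.Rel B .good (List.replicate B.length 0) (List.replicate B.length 0)

lemma good_cons {b : M.system.Block} {B : List M.system.Block} :
    Good (b :: B) ↔ Good B ∧ (M.legitF b.hdr).Holds B.length (M.system.Rel B)
      (M.system.env b.cells (List.replicate B.length 0) (List.replicate B.length 0)) := by
  simp only [Good, List.length_cons, List.replicate_succ, System.Rel, ruleF, Form.holds_and]
  refine and_congr_left fun _ => ?_
  simp [Form.Holds, System.env]

lemma holds_legitF_env {B : List M.system.Block} {c : Config M.dirs}
    {N : List (List (Fin (M.maxFork + 2)))} {θ : List (List (Fin (M.maxFork + 2)) × Thread)}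
    (H : M.Models B.length (M.system.Rel B) c N θ) {b : M.system.Block}
    (hb : b.cells.length = B.length) :
    (M.legitF b.hdr).Holds B.length (M.system.Rel B)
      (M.system.env b.cells (List.replicate B.length 0) (List.replicate B.length 0)) ↔
    (∀ ℓ, M.Selects c.mem ℓ (M.selection c.mem N (chosen b) ℓ)) ∧
      match b.hdr.1 with
      | none => c.threads ≠ [] ∧ (b.hdr.2 = true ↔ c.threads.any M.reads = true)
      | some a => c.threads = [] ∧ b.hdr.2 = false ∧
          forks (M.selection c.mem N (chosen b)) M.topLevel[a] ≠ [] := by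
  rw [H.toDescribes.holds_legitF (σ := chosen b) (env_length hb (by simp) (by simp))
    (fun l => by simp [System.env, chosen])]
  refine and_congr_right fun _ => ?_
  rcases b.hdr.1 with _ | a <;> simp [forks_ne_nil, ← H.map_snd]

/-- Soundness of the coding: the checks in `Good` turn each block into an actual step, and the flags
in the headers count the symbols that are really read. -/
theorem exists_reaches {w : List α} : ∀ {B : List M.system.Block}, M.system.Valid w B → Good B →
    ∃ c N θ, M.Reaches w B.length c ∧ M.Models (m := M.maxFork) B.length (M.system.Rel B) c N θ ∧
      c.pos = M.system.position B
  | [], _, _ => ⟨M.init, _, _, .init, models_init, rfl⟩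
  | b :: B, hv, hg => by
    obtain ⟨hletter, hcells, hv⟩ := hv
    obtain ⟨hg, hl⟩ := good_cons.mp hg
    obtain ⟨c, N, θ, hr, H, hpos⟩ := exists_reaches hv hg
    obtain ⟨hsel, hl⟩ := (holds_legitF_env H hcells).mp hl
    rcases hh : b.hdr.1 with _ | a <;> simp only [hh] at hl
    · obtain ⟨N', θ', H'⟩ := models_exec H hcells hh (hpos ▸ hletter)
      refine ⟨_, N', θ', .step hr (.exec c _ hl.1 hsel), H', ?_⟩
      simp only [exec, System.position, hl.2, hpos]
      split <;> rfl
    · obtain ⟨N', θ', H'⟩ := models_round H hcells hh hl.1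
      refine ⟨_, N', θ', .step hr (.round c _ _ hl.1 hsel (List.getElem_mem a.2) hl.2.2), H', ?_⟩
      simp [System.position, hl.2.1, hpos]

/-- Any choice of one name for each line can be written into the tracks of a block; the tracks of
the other variables are filled with zeros. -/
lemma exists_block (hdr : M.Hdr) (letter : Option α) {s : ℕ}
    {σ : Fin M.prog.length → List (Fin (M.maxFork + 2))} (hσ : ∀ l, (σ l).length = s) :
    ∃ b : M.system.Block, b.hdr = hdr ∧ b.letter = letter ∧ b.cells.length = s ∧
      chosen b = σ := by
  refine ⟨⟨hdr, letter, (List.range s).map fun i v => match v with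
    | .loc _ => 0
    | .sel l => (σ l).getD i 0⟩, rfl, rfl, by simp, funext fun l => ?_⟩
  simp only [chosen, System.track, List.map_map]
  refine List.ext_getElem (by simp [hσ]) fun i h₁ h₂ => ?_
  simp [h₂]

/-- Completeness of the coding: the outcome of every step is expressed by names and put into a
block. -/
theorem exists_blocks {w : List α} {T : ℕ} {c : Config M.dirs} (hr : M.Reaches w T c) :
    ∃ (B : List M.system.Block) (N : List (List (Fin (M.maxFork + 2))))
      (θ : List (List (Fin (M.maxFork + 2)) × Thread)), B.length = T ∧ M.system.Valid w B ∧
      Good B ∧ M.Models B.length (M.system.Rel B) c N θ ∧ c.pos = M.system.position B := by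
  induction hr with
  | init => exact ⟨[], _, _, rfl, trivial, rfl, models_init, rfl⟩
  | @step T c c' hr hs ih =>
    obtain ⟨B, N, θ, rfl, hv, hg, H, hpos⟩ := ih
    cases hs with
    | exec sel hc hsel =>
      obtain ⟨σ, hσ, rfl⟩ := exists_selection H.toDescribes hsel
      obtain ⟨b, h₁, h₂, h₃, rfl⟩ :=
        exists_block (none, c.threads.any M.reads) w[M.system.position B]? hσ
      obtain ⟨N', θ', H'⟩ := models_exec H h₃ (by rw [h₁]) (hpos ▸ h₂)
      refine ⟨b :: B, N', θ', rfl, ⟨h₂, h₃, hv⟩, good_cons.mpr ⟨hg, (holds_legitF_env H h₃).mpr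
        ⟨hsel, ?_⟩⟩, H', ?_⟩
      · simp only [h₁]
        exact ⟨hc, trivial⟩
      · simp only [exec, System.position, h₁, hpos]
        split <;> rfl
    | round sel blocks hc hsel hb hne =>
      obtain ⟨σ, hσ, rfl⟩ := exists_selection H.toDescribes hsel
      obtain ⟨i, hi, rfl⟩ := List.getElem_of_mem hb
      obtain ⟨b, h₁, h₂, h₃, rfl⟩ :=
        exists_block (some ⟨i, hi⟩, false) w[M.system.position B]? hσ
      obtain ⟨N', θ', H'⟩ := models_round (a := ⟨i, hi⟩) H h₃ (by rw [h₁]) hc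
      refine ⟨b :: B, N', θ', rfl, ⟨h₂, h₃, hv⟩, good_cons.mpr ⟨hg, (holds_legitF_env H h₃).mpr
        ⟨hsel, ?_⟩⟩, H', ?_⟩
      · simp only [h₁]
        exact ⟨hc, trivial, hne⟩
      · simp [System.position, h₁, hpos]

lemma holds_final {B : List M.system.Block} {c : Config M.dirs}
    {N : List (List (Fin (M.maxFork + 2)))} {θ : List (List (Fin (M.maxFork + 2)) × Thread)}
    (H : M.Models B.length (M.system.Rel B) c N θ) (w : List α) :
    (M.finalF true).Holds B.length (M.system.Rel B) (fun _ => List.replicate B.length 0) ↔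
      Good B ∧ M.Halted w c ∧ M.accept.eval c.mem c.center = true := by
  have D := H.toDescribes
  have he : ∀ v : M.V, ((fun _ => List.replicate B.length 0 :
      M.V → List (Fin (M.maxFork + 2))) v).length = B.length := by simp
  have hthr : θ = [] ↔ c.threads = [] := by simp [← H.map_snd]
  simp only [finalF, if_true, Form.holds_and, Form.holds_not, D.holds_anyF he, not_not, roundF,
    Form.holds_disj, List.mem_map, exists_exists_and_eq_and, D.holds_ex_matchF he, halted_iff,
    hthr, and_assoc]
  refine and_congr Iff.rfl (and_congr_right fun _ => and_congr (by simp) ?_)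
  obtain ⟨x, hx, hx'⟩ := D.exists_name H.center_lt_size
  rw [Form.holds_ex]
  constructor
  · rintro ⟨u, hu, h₁, h₂⟩
    refine (D.holds_boolF (Describes.update_len he _ hu) (v := .loc 2) (by simp) (by simp)
      ?_ _).mp h₂
    simp only [Form.Holds, Function.update_self] at h₁ ⊢
    exact (H.center u hu).mp h₁
  · intro h
    refine ⟨x, hx, ?_, (D.holds_boolF (Describes.update_len he _ hx) (v := .loc 2) (by simp)
      (by simp) ?_ _).mpr h⟩
    · simp only [Form.Holds, Function.update_self]
      exact (H.center x hx).mpr hx'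
    · rwa [Function.update_self]

theorem value_true {w : List α} {T : ℕ} : M.system.Value w true T ↔
    ∃ c, M.Reaches w T c ∧ M.Halted w c ∧ M.accept.eval c.mem c.center = true := by
  constructor
  · rintro ⟨B, rfl, hv, h⟩
    have hg : Good B := h.1
    obtain ⟨c, N, θ, hr, H, -⟩ := exists_reaches hv hg
    exact ⟨c, hr, ((holds_final H w).mp h).2⟩
  · rintro ⟨c, hr, h⟩
    obtain ⟨B, N, θ, rfl, hv, hg, H, -⟩ := exists_blocks hr
    exact ⟨B, rfl, hv, (holds_final H w).mpr ⟨hg, h⟩⟩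

theorem value_false {w : List α} {T : ℕ} :
    M.system.Value w false T ↔ ∃ c, M.Reaches w T c := by
  constructor
  · rintro ⟨B, rfl, hv, h⟩
    have hg : Good B := h.1
    obtain ⟨c, N, θ, hr, -, -⟩ := exists_reaches hv hg
    exact ⟨c, hr⟩
  · rintro ⟨c, hr⟩
    obtain ⟨B, N, θ, rfl, hv, hg, -, -⟩ := exists_blocks hr
    exact ⟨B, rfl, hv, hg, by simp⟩

end MWSMM.Machine

/-! ### Space bounds and the conclusion. -/

namespace MWSMM.Machine

open OfflineTM (Form System)
open scoped Classical

variable {α : Type} {M : Machine α} {w : List α}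

/-- Justifies the rejection: if no computation has `T` steps, none has more, so no longer one can
accept. -/
lemma Reaches.of_le {T T' : ℕ} {c : Config M.dirs} (h : M.Reaches w T c) (hT : T' ≤ T) :
    ∃ c', M.Reaches w T' c' := by
  induction h with
  | init => exact ⟨M.init, Nat.le_zero.mp hT ▸ .init⟩
  | @step T c c' h hs ih =>
    rcases Nat.le_succ_iff.mp hT with h' | rfl
    · exact ih h'
    · exact ⟨c', h.step hs⟩

variable (M w) in
/-- Some computation stops after exactly `T` steps and accepts. -/
def AcceptsAt (T : ℕ) : Prop :=
  ∃ c, M.Reaches w T c ∧ M.Halted w c ∧ M.accept.eval c.mem c.center = true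

lemma mem_language_iff : w ∈ M.language ↔ ∃ T, M.AcceptsAt w T :=
  ⟨fun ⟨_, T, _, h⟩ => ⟨T, h⟩, fun ⟨T, h⟩ => ⟨T, T, le_rfl, h⟩⟩

lemma exists_size_bound [Finite α] (Y : System α) : ∃ m, ∀ φ ∈ Y.formulas, φ.size ≤ m := by
  obtain ⟨m, hm⟩ := (Y.finite_formulas.image Form.size).bddAbove
  exact ⟨m, fun φ h => hm (Set.mem_image_of_mem _ h)⟩

lemma space_mono (K : ℕ) : Monotone fun T : ℕ => (K + 1) * (T + 1) ^ 2 := fun _ _ h =>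
  Nat.mul_le_mul_left _ (Nat.pow_le_pow_left (Nat.succ_le_succ h) 2)

lemma le_space (K T : ℕ) : T + 1 ≤ (K + 1) * (T + 1) ^ 2 := by
  nlinarith [Nat.zero_le (K * (T + 1) ^ 2), Nat.zero_le (T ^ 2)]

variable [Finite α]

/-- The simulation in quadratic space. -/
theorem exists_simulation (M : Machine α) : ∃ (N : OfflineTM.Machine α) (C : ℕ),
    (∀ w, N.Accepts w ↔ w ∈ M.language) ∧
    ∀ w t, M.AcceptsWithin w t ∨ M.HaltsWithin w t →
      N.Halts w ∧ N.UsesSpace w (C * (t ^ 2 + 1)) := by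
  obtain ⟨m, hm⟩ := exists_size_bound M.system
  have spec := fun w => OfflineTM.ChoiceMachine.search_spec (G := M.system.game) (w := w)
    (space_mono (3 * m + 3)) (le_space (3 * m + 3))
    (M.system.val_game hm w true) (M.system.val_game hm w false)
  simp only [value_true, value_false, decide_eq_true_eq, decide_eq_false_iff_not] at spec
  -- The search ends with the least `T` for which one of the two games is decisive.
  have first : ∀ w, (∃ T, M.AcceptsAt w T ∨ ¬ ∃ c, M.Reaches w T c) →
      ∃ T, (∀ T' < T, ¬ M.AcceptsAt w T' ∧ ∃ c, M.Reaches w T' c) ∧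
        (M.AcceptsAt w T ∨ ¬ ∃ c, M.Reaches w T c) ∧
        ∀ T', (M.AcceptsAt w T' ∨ ¬ ∃ c, M.Reaches w T' c) → T ≤ T' := by
    intro w h
    refine ⟨Nat.find h, fun T' hT' => ?_, Nat.find_spec h, fun T' hT' => Nat.find_min' h hT'⟩
    have := Nat.find_min h hT'
    push Not at this
    exact this
  refine ⟨M.system.game.search.toTM, 6 * (3 * m + 4) + 1, fun w => ?_, fun w t ht => ?_⟩
  · rw [mem_language_iff]
    by_cases h : ∃ T, M.AcceptsAt w T ∨ ¬ ∃ c, M.Reaches w T c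
    · obtain ⟨T, h₁, h₂, -⟩ := first w h
      rw [((spec w).1 T h₁ h₂).2.2]
      refine ⟨fun h => ⟨T, h⟩, fun ⟨T', h'⟩ => ?_⟩
      rcases h₂ with h₂ | h₂
      · exact h₂
      · exfalso
        rcases lt_or_ge T' T with hlt | hle
        · exact (h₁ T' hlt).1 h'
        · obtain ⟨c, hc, -⟩ := h'
          exact h₂ (hc.of_le hle)
    · push Not at h
      exact iff_of_false ((spec w).2 h) fun ⟨T, hT⟩ => (h T).1 hT
  -- If all computations stop after at most `t` steps, the second game fails at `t + 1` at the
  -- latest.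
  · have key : ∃ T ≤ t + 1, M.AcceptsAt w T ∨ ¬ ∃ c, M.Reaches w T c := by
      rcases ht with ⟨T, hT, h⟩ | h
      · exact ⟨T, by omega, .inl h⟩
      · refine ⟨t + 1, le_rfl, .inr ?_⟩
        rintro ⟨c, hc⟩
        have := h _ _ hc
        omega
    obtain ⟨T', hT', h'⟩ := key
    obtain ⟨T, h₁, h₂, h₃⟩ := first w ⟨T', h'⟩
    obtain ⟨hh, hs, -⟩ := (spec w).1 T h₁ h₂
    refine ⟨hh, fun i j => (hs i j).trans_le ?_⟩
    have hle : T + 1 ≤ t + 2 := by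
      have := h₃ T' h'
      omega
    -- From `(t + 2) ^ 2 ≤ 6 * (t ^ 2 + 1)`; the cell at the bottom of the stacks adds the final `+
    -- 1` to the constant `C`.
    have h4 : (T + 1) ^ 2 ≤ 6 * (t ^ 2 + 1) := by
      refine (Nat.pow_le_pow_left hle 2).trans ?_
      zify
      nlinarith [sq_nonneg ((t : ℤ) - 1)]
    calc (3 * m + 3 + 1) * (T + 1) ^ 2 + 1 ≤ (3 * m + 4) * (6 * (t ^ 2 + 1)) + (t ^ 2 + 1) :=
          Nat.add_le_add (Nat.mul_le_mul_left _ h4) (by omega)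
      _ = (6 * (3 * m + 4) + 1) * (t ^ 2 + 1) := by ring

omit [Finite α] in
-- The value at `1` is the sum of the coefficients. This brings the time bound into the form that
-- the clock can check.
lemma eval_le (p : Polynomial ℕ) (n : ℕ) : p.eval n ≤ p.eval 1 * (n + 1) ^ p.natDegree := by
  rw [Polynomial.eval_eq_sum_range, Polynomial.eval_eq_sum_range, Finset.sum_mul]
  refine Finset.sum_le_sum fun i hi => ?_
  rw [one_pow, mul_one]
  refine Nat.mul_le_mul_left _ ((Nat.pow_le_pow_left (Nat.le_succ n) i).trans ?_)
  exact Nat.pow_le_pow_right (by omega) (by simpa [Nat.lt_succ_iff] using hi)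

/-- The simulation with a clock. -/
theorem language_mem_PSPACE (M : Machine α) (p : Polynomial ℕ)
    (hp : ∀ w ∈ M.language, M.AcceptsWithin w (p.eval w.length)) :
    M.language ∈ OfflineTM.PSPACE α := by
  obtain ⟨m, hm⟩ := exists_size_bound M.system
  let k := p.natDegree
  let d := p.eval 1
  -- The clock only counts, so any stack symbol of the game will do.
  let g₀ : M.system.game.Symbol := .hdr M.system.hdr none
  have spec := fun w => (OfflineTM.ChoiceMachine.search_spec
    (G := M.system.game.withClock g₀ k d) (w := w) (space_mono (3 * m + 3))
    (le_space (3 * m + 3))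
    (fun T => (M.system.val_game hm w true T).liftConf (g₀ := g₀) (k := k) (d := d))
    (fun T => OfflineTM.ChoiceMachine.Val.mono
      (OfflineTM.ChoiceMachine.val_clock ((Nat.le_succ T).trans (le_space (3 * m + 3) T)))
      (Nat.zero_le _))).1
  simp only [value_true, decide_eq_true_eq, decide_eq_false_iff_not] at spec
  refine ⟨(M.system.game.withClock g₀ k d).search.toTM,
    Polynomial.C (3 * m + 4) * (Polynomial.C (d + 1) * (Polynomial.X + 1) ^ k + 1) ^ 2 + 1,
    fun w => ?_⟩
  have hpos : 0 < (w.length + 1) ^ k := Nat.pow_pos (by omega)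
  -- The clock has run out at this value of `T`, so the search always ends, within polynomial space.
  have hlim : ¬ (d + 1) * (w.length + 1) ^ k / (w.length + 1) ^ k ≤ d := by
    rw [Nat.mul_div_cancel _ hpos]
    omega
  have hex : ∃ T, M.AcceptsAt w T ∨ ¬ T / (w.length + 1) ^ k ≤ d := ⟨_, .inr hlim⟩
  have h₁ : ∀ T' < Nat.find hex, ¬ M.AcceptsAt w T' ∧ T' / (w.length + 1) ^ k ≤ d := by
    intro T' hT'
    have := Nat.find_min hex hT'
    push Not at this
    exact this
  obtain ⟨hh, hs, ha⟩ := spec w (Nat.find hex) h₁ (Nat.find_spec hex)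
  refine ⟨hh, fun i j => (hs i j).trans_le ?_, ha.trans ⟨fun h => mem_language_iff.mpr ⟨_, h⟩, ?_⟩⟩
  · have := Nat.find_min' hex (.inr hlim)
    simp only [Polynomial.eval_add, Polynomial.eval_mul, Polynomial.eval_pow, Polynomial.eval_C,
      Polynomial.eval_X, Polynomial.eval_one]
    exact Nat.add_le_add_right (space_mono (3 * m + 3) this) 1
  · intro hw
    obtain ⟨s, hs, h⟩ := hp w hw
    rcases Nat.find_spec hex with h' | h'
    · exact h'
    · exfalso
      rcases lt_or_ge s (Nat.find hex) with hlt | hle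
      · exact (h₁ s hlt).1 h
      -- The clock cannot run out at or before the length `s` of a shortest guaranteed accepting
      -- computation, since `s` is at most `d * (n + 1) ^ k`.
      · refine h' ((Nat.div_le_div_right (hle.trans (hs.trans (eval_le p _)))).trans ?_)
        rw [Nat.mul_div_cancel _ hpos]

end MWSMM.Machine

theorem mainTheorem2 {α : Type} [Finite α] :
    MWSMM.NPTIME α ⊆ OfflineTM.PSPACE α ∧
    ∀ M : MWSMM.Machine α, ∃ (N : OfflineTM.Machine α) (C : ℕ),
      (∀ w, N.Accepts w ↔ w ∈ M.language) ∧
      ∀ w t, M.AcceptsWithin w t ∨ M.HaltsWithin w t →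
        N.Halts w ∧ N.UsesSpace w (C * (t ^ 2 + 1)) := by
  refine ⟨?_, fun M => M.exists_simulation⟩
  rintro L ⟨M, p, rfl, hp⟩
  exact M.language_mem_PSPACE p hp
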